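/- **Setting.** Let $\mathfrak g$ be a finite-dimensional complex semisimple Lie algebra with Cartan subalgebra $\mathfrak h$, simple roots $\alpha_i$, simple coroots $\check\alpha_i$ and Chevalley–Serre generators $E_i, \check\alpha_i, F_i$ ($i \in I$), and Cartan matrix $a_{ij} = \langle \alpha_j, \check\alpha_i\rangle$. Let $\mathfrak n$ be the sum of the root spaces of the positive roots and $\mathfrak b = \mathfrak h \oplus \mathfrak n$. Put $p_{-1} = \sum_i F_i$, write $2\check\rho = \sum_i c_i \check\alpha_i$, where $\check\rho\in\mathfrak h$ is defined by $\alpha_i(\check\rho) = 1$ for all $i$, and put $p_1 = \sum_i c_i E_i$ and $\mathfrak a = \ker(\mathrm{ad}_{p_1})$. Let $N$ be the closed connected unipotent subgroup with Lie algebra $\mathfrak n$ of the adjoint group $G = (\mathrm{Aut}\,\mathfrak g)^\circ$. Let $\nu$ be a permutation of $I$ with $a_{\nu(i)\nu(j)} = a_{ij}$ for all $i,j$, let $T \ge 1$ be a multiple of the order of $\nu$, let $\omega$ be a primitive $T$-th root of unity and $\Gamma = \langle\omega\rangle$. Let $\varsigma$ be the automorphism of $\mathfrak g$ with $\varsigma(E_i)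 = \omega^{-1}E_{\nu(i)}$, $\varsigma(\check\alpha_i)=\check\alpha_{\nu(i)}$, $\varsigma(F_i) = \omega F_{\nu(i)}$. Let $\mathcal M$ be the algebra of meromorphic functions on $\mathbb P^1 = \mathbb C\cup\{\infty\}$, with coordinate $t$ on $\mathbb C$, let $\Omega = \mathcal M\,dt$, and let $\mu_{\omega^{-1}}^*$ denote the pullback of functions and of differentials along $t \mapsto \omega^{-1}t$. For a subspace $\mathfrak p \subset \mathfrak g$ put $\Omega(\mathfrak p) = \mathfrak p\otimes_{\mathbb C}\Omega$. Let $\hat\varsigma = \varsigma \otimes \mu_{\omega^{-1}}^*$ on $\Omega(\mathfrak g)$, and for $\varsigma$-stable $\mathfrak p$ let $\Omega^{\hat\varsigma}(\mathfrak p) = \{ A \in \Omega(\mathfrak p) : \hat\varsigma(A) = A\}$. Let $N(\mathcal M)$ be the group of $\mathcal M$-points of $N$, i.e. of $\mathbb C$-algebra homomorphisms $g:\mathscr O(N) \to \mathcal M$. Let $\hat\varsigma(g) = \mu_{\omega^{-1}}^*\circ g\circ\varsigma^*$, where $\varsigma$ acts on $N$ by conjugation, and let $N^{\hat\varsigma}(\mathcal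 M)$ be the subgroup of the $g$ with $\hat\varsigma(g) = g$. The group $N(\mathcal M)$ acts by the gauge transformations $$d + A \longmapsto g(d+A)g^{-1} = d - dg\,g^{-1} + \mathrm{Ad}_g A$$ on $$\mathrm{op}_{\mathfrak g}(\mathbb P^1) = \{ d + p_{-1}dt + v : v \in \Omega(\mathfrak b)\},$$ and this restricts to an action of $N^{\hat\varsigma}(\mathcal M)$ on $$\mathrm{op}^\Gamma_{\mathfrak g}(\mathbb P^1) = \{ d + p_{-1}dt + v : v \in \Omega^{\hat\varsigma}(\mathfrak b)\}.$$ The $\mathfrak g$-opers are the elements of $\mathrm{Op}_{\mathfrak g}(\mathbb P^1) = \mathrm{op}_{\mathfrak g}(\mathbb P^1)/N(\mathcal M)$ and the cyclotomic $\mathfrak g$-opers are the elements of $\mathrm{Op}^\Gamma_{\mathfrak g}(\mathbb P^1) = \mathrm{op}^\Gamma_{\mathfrak g}(\mathbb P^1)/N^{\hat\varsigma}(\mathcal M)$. **Theorem 4.5.** The action of $N^{\hat\varsigma}(\mathcal M)$ on $\mathrm{op}^\Gamma_{\mathfrak g}(\mathbb P^1)$ and the action of $N(\mathcal M)$ on $\mathrm{op}_{\mathfrak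 g}(\mathbb P^1)$ are free. Moreover, every cyclotomic $\mathfrak g$-oper has a unique representative of the form $d + p_{-1}dt + c$ with $c \in \Omega^{\hat\varsigma}(\mathfrak a)$, and every $\mathfrak g$-oper has a unique representative of the form $d + p_{-1}dt + c$ with $c \in \Omega(\mathfrak a)$. -/

import Mathlib

open scoped TensorProduct

noncomputable section

namespace CycOper

/-- Functions `ℂ → ℂ` which are meromorphic at every point of `ℂ` and at `∞`
(in the coordinate `1/t`). -/
def meroFun : Subalgebra ℂ (ℂ → ℂ) where
  carrier := {f | Meromorphic f ∧ MeromorphicAt (fun z => f z⁻¹) 0}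
  mul_mem' hf hg := ⟨hf.1.mul hg.1, hf.2.mul hg.2⟩
  add_mem' hf hg := ⟨hf.1.add hg.1, hf.2.add hg.2⟩
  algebraMap_mem' c := ⟨Meromorphic.const c, MeromorphicAt.const c 0⟩

/-- The functions which vanish outside a closed discrete subset of `ℂ`. -/
def meroNull : Ideal meroFun where
  carrier := {f | ∀ᶠ z in Filter.codiscrete ℂ, (f : ℂ → ℂ) z = 0}
  add_mem' {f g} hf hg := by
    have hf' : ∀ᶠ z in Filter.codiscrete ℂ, (f : ℂ → ℂ) z = 0 := hf
    have hg' : ∀ᶠ z in Filter.codiscrete ℂ, (g : ℂ → ℂ) z = 0 := hg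
    change ∀ᶠ z in Filter.codiscrete ℂ, (f : ℂ → ℂ) z + (g : ℂ → ℂ) z = 0
    filter_upwards [hf', hg'] with z h1 h2
    simp [h1, h2]
  zero_mem' := by simp
  smul_mem' c f hf := by
    have hf' : ∀ᶠ z in Filter.codiscrete ℂ, (f : ℂ → ℂ) z = 0 := hf
    change ∀ᶠ z in Filter.codiscrete ℂ, (c : ℂ → ℂ) z * (f : ℂ → ℂ) z = 0
    filter_upwards [hf'] with z h
    simp [h]

/-- The algebra `ℳ` of meromorphic functions on the Riemann sphere: functions on `ℂ` meromorphic
at all points of `ℂ ∪ {∞}`, where functions that agree off a closed discrete set are identified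
(so that the values assigned at poles play no role). -/
def Mero : Type := meroFun ⧸ meroNull

instance : CommRing Mero := inferInstanceAs (CommRing (meroFun ⧸ meroNull))

instance : Algebra ℂ Mero := inferInstanceAs (Algebra ℂ (meroFun ⧸ meroNull))

namespace Mero

/-- The meromorphic function on the sphere given by `f`. -/
def mk (f : ℂ → ℂ) (hf : f ∈ meroFun) : Mero := Ideal.Quotient.mk meroNull ⟨f, hf⟩

lemma mk_eq_mk {f g : ℂ → ℂ} {hf : f ∈ meroFun} {hg : g ∈ meroFun} :
    mk f hf = mk g hg ↔ ∀ᶠ z in Filter.codiscrete ℂ, f z = g z := by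
  refine (Ideal.Quotient.eq (I := meroNull)).trans ?_
  change (∀ᶠ z in Filter.codiscrete ℂ, f z - g z = 0) ↔ _
  simp [sub_eq_zero]

lemma exists_mk (x : Mero) : ∃ f hf, x = mk f hf := by
  obtain ⟨⟨f, hf⟩, rfl⟩ := Ideal.Quotient.mk_surjective x
  exact ⟨f, hf, rfl⟩

lemma deriv_mem {f : ℂ → ℂ} (hf : f ∈ meroFun) : deriv f ∈ meroFun := by
  refine ⟨hf.1.deriv, ?_⟩
  have h2 := (hf.2.deriv).mul ((MeromorphicAt.id (0 : ℂ)).pow 2).neg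
  refine h2.congr ?_
  filter_upwards [hf.2.eventually_analyticAt, self_mem_nhdsWithin] with z hz hz0
  have hz0 : z ≠ 0 := hz0
  have key : deriv f z⁻¹ * (-(z ^ 2)⁻¹) = deriv (fun z => f z⁻¹) z := by
    have : DifferentiableAt ℂ f z⁻¹ := by
      have h : f = (fun w => f w⁻¹) ∘ (fun w => w⁻¹) := by ext; simp
      rw [h]
      refine DifferentiableAt.comp _ ?_ (differentiableAt_inv (inv_ne_zero hz0))
      rw [inv_inv]; exact hz.differentiableAt
    have h3 := (this.hasDerivAt).comp z (hasDerivAt_inv hz0)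
    exact h3.deriv.symm
  simp only [Pi.mul_apply, Pi.neg_apply, Pi.pow_apply, id]
  rw [← key]
  field_simp

lemma eventually_deriv {f g : ℂ → ℂ} (h : ∀ᶠ z in Filter.codiscrete ℂ, f z = g z) :
    ∀ᶠ z in Filter.codiscrete ℂ, deriv f z = deriv g z := by
  have h' := mem_codiscrete'.1 h
  filter_upwards [h] with z hz
  exact Filter.EventuallyEq.deriv_eq (h'.1.mem_nhds hz)

lemma eventually_differentiableAt {f : ℂ → ℂ} (hf : f ∈ meroFun) :
    ∀ᶠ z in Filter.codiscrete ℂ, DifferentiableAt ℂ f z := by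
  have := (MeromorphicOn.eventually_codiscreteWithin_analyticAt (U := Set.univ) f
    hf.1.meromorphicOn)
  filter_upwards [this] with z hz using hz.differentiableAt

/-- `f ↦ df/dt`, as a map. -/
def derivFun : Mero → Mero :=
  Quotient.map' (fun f : meroFun => ⟨deriv (f : ℂ → ℂ), deriv_mem f.2⟩) (by
    intro f g h
    rw [Submodule.quotientRel_def] at h ⊢
    have h' : ∀ᶠ z in Filter.codiscrete ℂ, (f : ℂ → ℂ) z - (g : ℂ → ℂ) z = 0 := h
    change ∀ᶠ z in Filter.codiscrete ℂ, deriv (f : ℂ → ℂ) z - deriv (g : ℂ → ℂ) z = 0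
    simp only [sub_eq_zero] at h' ⊢
    exact eventually_deriv h')

lemma derivFun_mk (f : ℂ → ℂ) (hf : f ∈ meroFun) :
    derivFun (mk f hf) = mk (deriv f) (deriv_mem hf) := rfl

lemma mk_add (f g : ℂ → ℂ) (hf : f ∈ meroFun) (hg : g ∈ meroFun) :
    mk f hf + mk g hg = mk (f + g) (meroFun.add_mem hf hg) := rfl

lemma mk_mul (f g : ℂ → ℂ) (hf : f ∈ meroFun) (hg : g ∈ meroFun) :
    mk f hf * mk g hg = mk (f * g) (meroFun.mul_mem hf hg) := rfl

lemma mk_smul (c : ℂ) (f : ℂ → ℂ) (hf : f ∈ meroFun) :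
    c • mk f hf = mk (c • f) (meroFun.smul_mem hf c) := rfl

/-- The derivation `d/dt` of `ℳ`. -/
def d : Derivation ℂ Mero Mero :=
  Derivation.mk'
    { toFun := derivFun
      map_add' := by
        intro x y
        obtain ⟨f, hf, rfl⟩ := exists_mk x
        obtain ⟨g, hg, rfl⟩ := exists_mk y
        rw [mk_add, derivFun_mk, derivFun_mk, derivFun_mk, mk_add, mk_eq_mk]
        filter_upwards [eventually_differentiableAt hf, eventually_differentiableAt hg] with z h1 h2
        exact deriv_add h1 h2
      map_smul' := by
        intro c x
        obtain ⟨f, hf, rfl⟩ := exists_mk x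
        rw [RingHom.id_apply, mk_smul, derivFun_mk, derivFun_mk, mk_smul, mk_eq_mk]
        filter_upwards [eventually_differentiableAt hf] with z h1
        exact deriv_const_smul c h1 }
    (by
      intro x y
      obtain ⟨f, hf, rfl⟩ := exists_mk x
      obtain ⟨g, hg, rfl⟩ := exists_mk y
      simp only [LinearMap.coe_mk, AddHom.coe_mk, smul_eq_mul]
      rw [mk_mul, derivFun_mk, derivFun_mk, derivFun_mk, mk_mul, mk_mul, mk_add, mk_eq_mk]
      filter_upwards [eventually_differentiableAt hf, eventually_differentiableAt hg] with z h1 h2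
      rw [deriv_mul h1 h2]
      simp only [Pi.add_apply, Pi.mul_apply]
      ring)

lemma d_mk (f : ℂ → ℂ) (hf : f ∈ meroFun) : d (mk f hf) = mk (deriv f) (deriv_mem hf) := rfl

lemma comp_mul_mem (a : ℂˣ) {f : ℂ → ℂ} (hf : f ∈ meroFun) :
    (fun z => f ((a : ℂ) * z)) ∈ meroFun := by
  constructor
  · intro x
    exact (hf.1 ((a : ℂ) * x)).comp_analyticAt (g := fun z => (a : ℂ) * z) (by fun_prop)
  · have h : MeromorphicAt (fun z => f z⁻¹) (((a⁻¹ : ℂˣ) : ℂ) * 0) := by simpa using hf.2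
    refine (h.comp_analyticAt (g := fun z => ((a⁻¹ : ℂˣ) : ℂ) * z) (by fun_prop)).congr ?_
    refine Filter.Eventually.of_forall fun z => ?_
    simp [Function.comp, mul_comm]

lemma eventually_comp_mul (a : ℂˣ) {p : ℂ → Prop} (h : ∀ᶠ z in Filter.codiscrete ℂ, p z) :
    ∀ᶠ z in Filter.codiscrete ℂ, p ((a : ℂ) * z) := by
  have key : ∀ {q : ℂ → Prop}, (∀ᶠ z in Filter.codiscrete ℂ, q z) ↔
      ∀ x, ∀ᶠ z in nhdsWithin x {x}ᶜ, q z := by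
    intro q
    rw [Filter.Eventually, mem_codiscrete]
    simp only [Filter.disjoint_principal_right, compl_compl]
    rfl
  rw [key] at h ⊢
  intro x
  have ht : Filter.Tendsto (fun z => (a : ℂ) * z) (nhdsWithin x {x}ᶜ)
      (nhdsWithin ((a : ℂ) * x) {(a : ℂ) * x}ᶜ) := by
    refine tendsto_nhdsWithin_of_tendsto_nhds_of_eventually_within _
      ((by fun_prop : Continuous fun z : ℂ => (a : ℂ) * z).continuousAt.tendsto.mono_left
        nhdsWithin_le_nhds) ?_
    filter_upwards [self_mem_nhdsWithin] with z hz
    simpa using hz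
  exact ht.eventually (h _)

/-- Pullback along `t ↦ a t`, as an endomorphism of `ℳ`. -/
def pullback (a : ℂˣ) : Mero →ₐ[ℂ] Mero :=
  Ideal.quotientMapₐ meroNull
    { toFun := fun f : meroFun => (⟨fun z => (f : ℂ → ℂ) ((a : ℂ) * z), comp_mul_mem a f.2⟩ : meroFun)
      map_one' := rfl
      map_mul' := fun _ _ => rfl
      map_zero' := rfl
      map_add' := fun _ _ => rfl
      commutes' := fun _ => rfl }
    (fun _ hf => eventually_comp_mul a hf)

lemma pullback_mk (a : ℂˣ) (f : ℂ → ℂ) (hf : f ∈ meroFun) :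
    pullback a (mk f hf) = mk (fun z => f ((a : ℂ) * z)) (comp_mul_mem a hf) := rfl

/-- The action of `a ∈ ℂˣ` on `ℳ`, namely `(a.f)(t) = f(a⁻¹ t)`. -/
def act (a : ℂˣ) : Mero ≃ₐ[ℂ] Mero :=
  AlgEquiv.ofAlgHom (pullback a⁻¹) (pullback a)
    (by
      ext x
      obtain ⟨f, hf, rfl⟩ := exists_mk x
      simp [pullback_mk])
    (by
      ext x
      obtain ⟨f, hf, rfl⟩ := exists_mk x
      simp [pullback_mk])

lemma act_mk (a : ℂˣ) (f : ℂ → ℂ) (hf : f ∈ meroFun) :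
    act a (mk f hf) = mk (fun z => f (((a⁻¹ : ℂˣ) : ℂ) * z)) (comp_mul_mem a⁻¹ hf) := rfl

lemma d_act (a : ℂˣ) (x : Mero) : d (act a x) = ((a⁻¹ : ℂˣ) : ℂ) • act a (d x) := by
  obtain ⟨f, hf, rfl⟩ := exists_mk x
  rw [act_mk, d_mk, d_mk, act_mk, mk_smul, mk_eq_mk]
  refine Filter.Eventually.of_forall fun z => ?_
  exact deriv_comp_mul_left _ f z

end Mero

end CycOper

namespace CycOper

section Points

variable {V : Type*} [AddCommGroup V] [Module ℂ V]

/-- The matrix coefficient `g ↦ ξ (g v)` on a subgroup `K` of `GL(V)`. -/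
def coef (K : Subgroup (V ≃ₗ[ℂ] V)) (ξ : Module.Dual ℂ V) (v : V) : K → ℂ :=
  fun g => ξ ((g : V ≃ₗ[ℂ] V) v)

/-- The function `g ↦ ξ (g⁻¹ v)` on a subgroup `K` of `GL(V)`. -/
def coefInv (K : Subgroup (V ≃ₗ[ℂ] V)) (ξ : Module.Dual ℂ V) (v : V) : K → ℂ :=
  fun g => ξ (((g⁻¹ : K) : V ≃ₗ[ℂ] V) v)

/-- The algebra `𝒪(K)` of regular functions on a closed subgroup `K` of `GL(V)`: the functions on
`K` generated by the matrix coefficients of `g` and of `g⁻¹`. -/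
def regFun (K : Subgroup (V ≃ₗ[ℂ] V)) : Subalgebra ℂ (K → ℂ) :=
  Algebra.adjoin ℂ ({f | ∃ ξ v, f = coef K ξ v} ∪ {f | ∃ ξ v, f = coefInv K ξ v})

/-- `coef` as an element of `𝒪(K)`. -/
def regCoef (K : Subgroup (V ≃ₗ[ℂ] V)) (ξ : Module.Dual ℂ V) (v : V) : regFun K :=
  ⟨coef K ξ v, Algebra.subset_adjoin (Or.inl ⟨ξ, v, rfl⟩)⟩

/-- `coefInv` as an element of `𝒪(K)`. -/
def regCoefInv (K : Subgroup (V ≃ₗ[ℂ] V)) (ξ : Module.Dual ℂ V) (v : V) : regFun K :=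
  ⟨coefInv K ξ v, Algebra.subset_adjoin (Or.inr ⟨ξ, v, rfl⟩)⟩

/-- The `R`-linear extension `R ⊗ V → R` of a linear form `ξ` on `V`. -/
def coord (R : Type*) [CommRing R] [Algebra ℂ R] (ξ : Module.Dual ℂ V) : R ⊗[ℂ] V →ₗ[R] R :=
  Module.Dual.baseChange R ξ

variable {R : Type*} [CommRing R] [Algebra ℂ R]

@[simp] lemma coord_tmul (ξ : Module.Dual ℂ V) (r : R) (v : V) :
    coord R ξ (r ⊗ₜ v) = ξ v • r := by
  simp [coord]

/-- The `R`-linear automorphism `φ` of `R ⊗ V` is the matrix of the point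
`χ : 𝒪(K) → R` of `K`. -/
def IsPoint (K : Subgroup (V ≃ₗ[ℂ] V)) (χ : regFun K →ₐ[ℂ] R)
    (φ : (R ⊗[ℂ] V) ≃ₗ[R] (R ⊗[ℂ] V)) : Prop :=
  ∀ ξ v, χ (regCoef K ξ v) = coord R ξ (φ (1 ⊗ₜ v)) ∧
    χ (regCoefInv K ξ v) = coord R ξ (φ⁻¹ (1 ⊗ₜ v))

/-- The pull back of functions along the multiplication `K × K → K`. -/
def mulPull (K : Subgroup (V ≃ₗ[ℂ] V)) : (K → ℂ) →ₐ[ℂ] (K × K → ℂ) where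
  toFun f p := f (p.1 * p.2)
  map_one' := rfl
  map_mul' _ _ := rfl
  map_zero' := rfl
  map_add' _ _ := rfl
  commutes' _ := rfl

/-- The pull back of functions along inversion. -/
def invPull (K : Subgroup (V ≃ₗ[ℂ] V)) : (K → ℂ) →ₐ[ℂ] (K → ℂ) where
  toFun f g := f g⁻¹
  map_one' := rfl
  map_mul' _ _ := rfl
  map_zero' := rfl
  map_add' _ _ := rfl
  commutes' _ := rfl

lemma invPull_apply (K : Subgroup (V ≃ₗ[ℂ] V)) (f : K → ℂ) (g : K) :
    invPull K f g = f g⁻¹ := rfl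

/-- The pull back of functions along the first projection `K × K → K`. -/
def fstPull (K : Subgroup (V ≃ₗ[ℂ] V)) : (K → ℂ) →ₐ[ℂ] (K × K → ℂ) where
  toFun f p := f p.1
  map_one' := rfl
  map_mul' _ _ := rfl
  map_zero' := rfl
  map_add' _ _ := rfl
  commutes' _ := rfl

/-- The pull back of functions along the second projection `K × K → K`. -/
def sndPull (K : Subgroup (V ≃ₗ[ℂ] V)) : (K → ℂ) →ₐ[ℂ] (K × K → ℂ) where
  toFun f p := f p.2
  map_one' := rfl
  map_mul' _ _ := rfl
  map_zero' := rfl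
  map_add' _ _ := rfl
  commutes' _ := rfl

/-- The map `𝒪(K) ⊗ 𝒪(K) → (K × K → ℂ)`. -/
def tensorFun (K : Subgroup (V ≃ₗ[ℂ] V)) : (regFun K ⊗[ℂ] regFun K) →ₐ[ℂ] (K × K → ℂ) :=
  Algebra.TensorProduct.productMap ((fstPull K).comp (regFun K).val)
    ((sndPull K).comp (regFun K).val)

lemma tensorFun_tmul (K : Subgroup (V ≃ₗ[ℂ] V)) (f g : regFun K) (p : K × K) :
    tensorFun K (f ⊗ₜ g) p = (f : K → ℂ) p.1 * (g : K → ℂ) p.2 := by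
  rw [tensorFun, Algebra.TensorProduct.productMap_apply_tmul]
  rfl

lemma tensorFun_injective (K : Subgroup (V ≃ₗ[ℂ] V)) : Function.Injective (tensorFun K) := by
  rw [injective_iff_map_eq_zero]
  intro x hx
  let b := Module.Basis.ofVectorSpace ℂ (regFun K)
  obtain ⟨c, rfl⟩ := TensorProduct.eq_repr_basis_right b x
  have h0 : ∀ i, c i = 0 := by
    intro i
    ext g
    have h1 : ∑ j ∈ c.support, ((c j : K → ℂ) g) • b j = 0 := by
      ext g'
      have := congrFun hx (g, g')
      rw [Finsupp.sum, map_sum, Finset.sum_apply] at this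
      simp only [tensorFun_tmul] at this
      simpa [Finset.sum_apply] using this
    by_cases hi : i ∈ c.support
    · exact linearIndependent_iff'.1 b.linearIndependent _ _ h1 i hi
    · rw [Finsupp.notMem_support_iff.1 hi]
  exact Finset.sum_eq_zero fun i _ => by simp [h0 i]

lemma invPull_mem (K : Subgroup (V ≃ₗ[ℂ] V)) (f : regFun K) : invPull K f ∈ regFun K := by
  have : regFun K ≤ (regFun K).comap (invPull K) := by
    refine Algebra.adjoin_le ?_
    rintro f (⟨ξ, v, rfl⟩ | ⟨ξ, v, rfl⟩)
    · exact (regCoefInv K ξ v).2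
    · have : invPull K (coefInv K ξ v) = coef K ξ v := by
        ext g; simp [invPull_apply, coef, coefInv]
      change invPull K (coefInv K ξ v) ∈ regFun K
      rw [this]
      exact (regCoef K ξ v).2
  exact this f.2

/-- The antipode of `𝒪(K)`. -/
def antipode (K : Subgroup (V ≃ₗ[ℂ] V)) : regFun K →ₐ[ℂ] regFun K :=
  ((invPull K).comp (regFun K).val).codRestrict _ (invPull_mem K)

variable [FiniteDimensional ℂ V]

lemma coord_expand (ξ : Module.Dual ℂ V) (φ : (R ⊗[ℂ] V) ≃ₗ[R] (R ⊗[ℂ] V)) (x : R ⊗[ℂ] V) :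
    coord R ξ (φ x) = ∑ k, coord R ξ (φ (1 ⊗ₜ Module.finBasis ℂ V k)) *
      coord R ((Module.finBasis ℂ V).coord k) x := by
  induction x with
  | zero => simp
  | add x y hx hy => simp [hx, hy, mul_add, Finset.sum_add_distrib]
  | tmul r v =>
    have key : ∀ v : V, coord R ξ (φ (1 ⊗ₜ v)) =
        ∑ k, (Module.finBasis ℂ V).repr v k • coord R ξ (φ (1 ⊗ₜ Module.finBasis ℂ V k)) := by
      intro v
      let F : V →ₗ[ℂ] R := ((coord R ξ ∘ₗ φ.toLinearMap).restrictScalars ℂ) ∘ₗ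
        TensorProduct.mk ℂ R V 1
      have hF : ∀ v, F v = coord R ξ (φ (1 ⊗ₜ v)) := fun _ => rfl
      rw [← hF]
      conv_lhs => rw [← (Module.finBasis ℂ V).sum_repr v, map_sum]
      exact Finset.sum_congr rfl fun k _ => by rw [map_smul, hF]
    have hr : (r ⊗ₜ[ℂ] v : R ⊗[ℂ] V) = r • (1 ⊗ₜ[ℂ] v) := by
      simp [TensorProduct.smul_tmul']
    rw [hr, map_smul, map_smul, key, Finset.smul_sum]
    refine Finset.sum_congr rfl fun k _ => ?_
    rw [map_smul, coord_tmul, Module.Basis.coord_apply, smul_eq_mul, smul_eq_mul,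
      mul_smul_comm, mul_left_comm, mul_smul_comm, mul_smul_comm, mul_one]

lemma expand (ξ : Module.Dual ℂ V) (f : V ≃ₗ[ℂ] V) (v : V) :
    ξ (f v) = ∑ k, ξ (f (Module.finBasis ℂ V k)) * (Module.finBasis ℂ V).coord k v := by
  conv_lhs => rw [← (Module.finBasis ℂ V).sum_repr v, map_sum, map_sum]
  simp [mul_comm]

lemma mulPull_coef (K : Subgroup (V ≃ₗ[ℂ] V)) (ξ : Module.Dual ℂ V) (v : V) :
    mulPull K (coef K ξ v) = tensorFun K (∑ k, regCoef K ξ (Module.finBasis ℂ V k) ⊗ₜ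
      regCoef K ((Module.finBasis ℂ V).coord k) v) := by
  ext p
  rw [map_sum, Finset.sum_apply]
  simp only [tensorFun_tmul]
  exact expand ξ (p.1 : V ≃ₗ[ℂ] V) ((p.2 : V ≃ₗ[ℂ] V) v)

lemma mulPull_coefInv (K : Subgroup (V ≃ₗ[ℂ] V)) (ξ : Module.Dual ℂ V) (v : V) :
    mulPull K (coefInv K ξ v) = tensorFun K (∑ k, regCoefInv K ((Module.finBasis ℂ V).coord k) v ⊗ₜ
      regCoefInv K ξ (Module.finBasis ℂ V k)) := by
  ext p
  rw [map_sum, Finset.sum_apply]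
  simp only [tensorFun_tmul]
  have := expand ξ ((p.2⁻¹ : K) : V ≃ₗ[ℂ] V) (((p.1⁻¹ : K) : V ≃ₗ[ℂ] V) v)
  simp only [mul_comm (ξ _)] at this
  rw [← show (coefInv K ξ v) (p.1 * p.2) =
    ξ (((p.2⁻¹ : K) : V ≃ₗ[ℂ] V) (((p.1⁻¹ : K) : V ≃ₗ[ℂ] V) v)) by
      simp [coefInv]] at this
  exact this

lemma mulPull_mem (K : Subgroup (V ≃ₗ[ℂ] V)) (f : regFun K) :
    mulPull K f ∈ (tensorFun K).range := by
  have : regFun K ≤ (tensorFun K).range.comap (mulPull K) := by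
    refine Algebra.adjoin_le ?_
    rintro f (⟨ξ, v, rfl⟩ | ⟨ξ, v, rfl⟩)
    · exact ⟨_, (mulPull_coef K ξ v).symm⟩
    · exact ⟨_, (mulPull_coefInv K ξ v).symm⟩
  exact this f.2

/-- The coproduct of `𝒪(K)`. -/
def comul (K : Subgroup (V ≃ₗ[ℂ] V)) : regFun K →ₐ[ℂ] (regFun K ⊗[ℂ] regFun K) :=
  ((AlgEquiv.ofInjective (tensorFun K) (tensorFun_injective K)).symm : _ →ₐ[ℂ] _).comp
    (((mulPull K).comp (regFun K).val).codRestrict _ (mulPull_mem K))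

lemma tensorFun_comul (K : Subgroup (V ≃ₗ[ℂ] V)) (f : regFun K) :
    tensorFun K (comul K f) = mulPull K f := by
  have := (AlgEquiv.ofInjective (tensorFun K) (tensorFun_injective K)).apply_symm_apply
    ⟨_, mulPull_mem K f⟩
  exact congrArg Subtype.val this

lemma comul_regCoef (K : Subgroup (V ≃ₗ[ℂ] V)) (ξ : Module.Dual ℂ V) (v : V) :
    comul K (regCoef K ξ v) = ∑ k, regCoef K ξ (Module.finBasis ℂ V k) ⊗ₜ
      regCoef K ((Module.finBasis ℂ V).coord k) v :=
  tensorFun_injective K ((tensorFun_comul K _).trans (mulPull_coef K ξ v))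

lemma comul_regCoefInv (K : Subgroup (V ≃ₗ[ℂ] V)) (ξ : Module.Dual ℂ V) (v : V) :
    comul K (regCoefInv K ξ v) = ∑ k, regCoefInv K ((Module.finBasis ℂ V).coord k) v ⊗ₜ
      regCoefInv K ξ (Module.finBasis ℂ V k) :=
  tensorFun_injective K ((tensorFun_comul K _).trans (mulPull_coefInv K ξ v))

/-- The group `K(R)` of `R`-points of a closed subgroup `K` of `GL(V)`, that is of the
`ℂ`-algebra homomorphisms `χ : 𝒪(K) → R`. A point is identified with the `R`-linear automorphism
of `R ⊗ V` whose matrix coefficients are the images under `χ` of those of `K`; the group structure,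
given by the coproduct, counit and antipode of `𝒪(K)`, is then the composition. -/
def points (K : Subgroup (V ≃ₗ[ℂ] V)) (R : Type*) [CommRing R] [Algebra ℂ R] :
    Subgroup ((R ⊗[ℂ] V) ≃ₗ[R] (R ⊗[ℂ] V)) where
  carrier := {φ | ∃ χ : regFun K →ₐ[ℂ] R, IsPoint K χ φ}
  one_mem' := by
    refine ⟨((Algebra.ofId ℂ R).comp (Pi.evalAlgHom ℂ (fun _ : K => ℂ) 1)).comp (regFun K).val, ?_⟩
    intro ξ v
    constructor
    · simp [regCoef, coef, Algebra.ofId_apply, Algebra.algebraMap_eq_smul_one]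
    · simp [regCoefInv, coefInv, Algebra.ofId_apply, Algebra.algebraMap_eq_smul_one]
  mul_mem' := by
    rintro φ ψ ⟨χ₁, h₁⟩ ⟨χ₂, h₂⟩
    refine ⟨(Algebra.TensorProduct.productMap χ₁ χ₂).comp (comul K), fun ξ v => ⟨?_, ?_⟩⟩
    · rw [AlgHom.comp_apply, comul_regCoef, map_sum]
      simp only [Algebra.TensorProduct.productMap_apply_tmul]
      rw [LinearEquiv.mul_apply, coord_expand]
      exact Finset.sum_congr rfl fun k _ => by rw [(h₁ _ _).1, (h₂ _ _).1]
    · rw [AlgHom.comp_apply, comul_regCoefInv, map_sum]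
      simp only [Algebra.TensorProduct.productMap_apply_tmul]
      rw [mul_inv_rev, LinearEquiv.mul_apply, coord_expand]
      exact Finset.sum_congr rfl fun k _ => by rw [(h₁ _ _).2, (h₂ _ _).2, mul_comm]
  inv_mem' := by
    rintro φ ⟨χ, h⟩
    refine ⟨χ.comp (antipode K), fun ξ v => ⟨?_, ?_⟩⟩
    · have : antipode K (regCoef K ξ v) = regCoefInv K ξ v := rfl
      rw [AlgHom.comp_apply, this, (h ξ v).2]
    · have : antipode K (regCoefInv K ξ v) = regCoef K ξ v := by
        ext g
        change coefInv K ξ v g⁻¹ = coef K ξ v g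
        simp [coef, coefInv]
      rw [AlgHom.comp_apply, this, (h ξ v).1, inv_inv]

end Points

end CycOper

namespace CycOper

section Iso

variable {ι : Type*} [Fintype ι] {L : Type*} [LieRing L] [LieAlgebra ℂ L]
  {H H' : LieSubalgebra ℂ L}

/-- The subalgebra of `L × L` generated by the pairs of corresponding generators. -/
def diag (B : LieAlgebra.Basis ι H) (B' : LieAlgebra.Basis ι H') : LieSubalgebra ℂ (L × L) :=
  LieSubalgebra.lieSpan ℂ (L × L)
    (Set.range (fun i => (B.e i, B'.e i)) ∪ Set.range (fun i => (B.f i, B'.f i)))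

variable (B : LieAlgebra.Basis ι H) (B' : LieAlgebra.Basis ι H')

lemma diag_e (i : ι) : (B.e i, B'.e i) ∈ diag B B' :=
  LieSubalgebra.subset_lieSpan (Or.inl ⟨i, rfl⟩)

lemma diag_f (i : ι) : (B.f i, B'.f i) ∈ diag B B' :=
  LieSubalgebra.subset_lieSpan (Or.inr ⟨i, rfl⟩)

lemma diag_h (i : ι) : (B.h i, B'.h i) ∈ diag B B' := by
  have := (diag B B').lie_mem (diag_e B B' i) (diag_f B B' i)
  simpa [(B.sl2 i).lie_e_f, (B'.sl2 i).lie_e_f] using this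

lemma diag_fst (x : L) : ∃ y, (x, y) ∈ diag B B' := by
  have h : (⊤ : LieSubalgebra ℂ L) ≤ (diag B B').map (LieHom.fst ℂ L L) := by
    rw [← B.span_ef, LieSubalgebra.lieSpan_le]
    rintro _ (⟨i, rfl⟩ | ⟨i, rfl⟩)
    · exact ⟨_, diag_e B B' i, rfl⟩
    · exact ⟨_, diag_f B B' i, rfl⟩
  obtain ⟨⟨a, b⟩, hp, rfl⟩ := h (LieSubalgebra.mem_top x)
  exact ⟨b, hp⟩

lemma diag_snd (y : L) : ∃ x, (x, y) ∈ diag B B' := by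
  have h : (⊤ : LieSubalgebra ℂ L) ≤ (diag B B').map (LieHom.snd ℂ L L) := by
    rw [← B'.span_ef, LieSubalgebra.lieSpan_le]
    rintro _ (⟨i, rfl⟩ | ⟨i, rfl⟩)
    · exact ⟨_, diag_e B B' i, rfl⟩
    · exact ⟨_, diag_f B B' i, rfl⟩
  obtain ⟨⟨a, b⟩, hp, rfl⟩ := h (LieSubalgebra.mem_top y)
  exact ⟨a, hp⟩

/-- The generators of `diag B B'` satisfy the Chevalley-Serre relations. -/
def diagBasis (hA : B'.A = B.A) :
    LieAlgebra.Basis ι (LieSubalgebra.lieSpan ℂ (diag B B')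
      (Set.range fun i => (⟨(B.h i, B'.h i), diag_h B B' i⟩ : diag B B'))) where
  A := B.A
  h i := ⟨(B.h i, B'.h i), diag_h B B' i⟩
  e i := ⟨(B.e i, B'.e i), diag_e B B' i⟩
  f i := ⟨(B.f i, B'.f i), diag_f B B' i⟩
  cartan_eq_lieSpan := rfl
  span_ef := by
    rw [eq_top_iff]
    rintro ⟨x, hx⟩ -
    have h : diag B B' ≤ (LieSubalgebra.lieSpan ℂ (diag B B')
        (Set.range (fun i => (⟨(B.e i, B'.e i), diag_e B B' i⟩ : diag B B')) ∪
          Set.range (fun i => (⟨(B.f i, B'.f i), diag_f B B' i⟩ : diag B B')))).map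
        (diag B B').incl := by
      conv_lhs => rw [diag]
      rw [LieSubalgebra.lieSpan_le]
      rintro _ (⟨i, rfl⟩ | ⟨i, rfl⟩)
      · exact ⟨_, LieSubalgebra.subset_lieSpan (Or.inl ⟨i, rfl⟩), rfl⟩
      · exact ⟨_, LieSubalgebra.subset_lieSpan (Or.inr ⟨i, rfl⟩), rfl⟩
    obtain ⟨y, hy, hyx⟩ := h hx
    have : y = ⟨x, hx⟩ := Subtype.ext hyx
    exact this ▸ hy
  linInd := .of_comp (diag B B').toSubmodule.subtype <| .of_comp (LinearMap.fst ℂ L L) B.linInd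
  nondegen := B.nondegen
  sl2 i :=
    { h_ne_zero := by simp [Subtype.ext_iff, (B.sl2 i).h_ne_zero]
      lie_e_f := by simp [Subtype.ext_iff, (B.sl2 i).lie_e_f, (B'.sl2 i).lie_e_f]
      lie_h_e_nsmul := by
        simp [Subtype.ext_iff, (B.sl2 i).lie_h_e_nsmul, (B'.sl2 i).lie_h_e_nsmul]
      lie_h_f_nsmul := by
        simp [Subtype.ext_iff, (B.sl2 i).lie_h_f_nsmul, (B'.sl2 i).lie_h_f_nsmul] }
  lie_h_h i j := by simp [Subtype.ext_iff, B.lie_h_h, B'.lie_h_h]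
  lie_h_e i j := by simp [Subtype.ext_iff, B.lie_h_e, B'.lie_h_e, hA]
  lie_h_f i j := by simp [Subtype.ext_iff, B.lie_h_f, B'.lie_h_f, hA]
  lie_e_f_ne i j hij := by
    simp [Subtype.ext_iff, B.lie_e_f_ne i j hij, B'.lie_e_f_ne i j hij]

lemma diag_cartan (hA : B'.A = B.A) {y : L} (hy : y ∈ H') (hD : (0, y) ∈ diag B B') : y = 0 := by
  have hab := (diagBasis B B' hA).isLieAbelian_cartan
  have hcar := (diagBasis B B' hA).cartan_eq
  have hab' := B'.isLieAbelian_cartan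
  have hcomm : ∀ i, ⁅B'.h i, y⁆ = 0 := by
    intro i
    have h := congrArg Subtype.val (trivial_lie_zero H' H' (B'.h' i) ⟨y, hy⟩)
    exact h
  have hmem : (⟨(0, y), hD⟩ : diag B B') ∈ LieSubalgebra.lieSpan ℂ (diag B B')
      (Set.range fun i => (⟨(B.h i, B'.h i), diag_h B B' i⟩ : diag B B')) := by
    rw [← LieSubalgebra.mem_toLieSubmodule, hcar, LieModule.mem_genWeightSpace]
    rintro ⟨z, hz⟩
    refine ⟨1, ?_⟩
    have hz' : z ∈ Submodule.span ℂ (Set.range (diagBasis B B' hA).h) := by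
      rw [← (diagBasis B B' hA).coe_cartan_eq_span]
      exact hz
    have : ⁅z, (⟨(0, y), hD⟩ : diag B B')⁆ = 0 := by
      induction hz' using Submodule.span_induction with
      | mem u hu =>
        obtain ⟨i, rfl⟩ := hu
        simp [diagBasis, Subtype.ext_iff, hcomm]
      | zero => simp
      | add u v hu hv hu' hv' =>
        rw [← (diagBasis B B' hA).coe_cartan_eq_span] at hu hv
        rw [add_lie, hu' hu, hv' hv, add_zero]
      | smul t u hu hu' =>
        rw [← (diagBasis B B' hA).coe_cartan_eq_span] at hu
        rw [smul_lie, hu' hu, smul_zero]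
    simpa using this
  have hspan : (⟨(0, y), hD⟩ : diag B B') ∈ Submodule.span ℂ (Set.range (diagBasis B B' hA).h) := by
    rw [← (diagBasis B B' hA).coe_cartan_eq_span]
    exact hmem
  obtain ⟨c, hc⟩ := (Submodule.mem_span_range_iff_exists_fun ℂ).1 hspan
  have h1 := congrArg (LinearMap.fst ℂ L L ∘ₗ (diag B B').toSubmodule.subtype) hc
  rw [map_sum] at h1
  have h0 := Fintype.linearIndependent_iff.1 B.linInd c h1
  simp only [h0, zero_smul, Finset.sum_const_zero] at hc
  exact (congrArg (fun z : diag B B' => (z : L × L).2) hc).symm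

variable [FiniteDimensional ℂ L] [LieAlgebra.IsSemisimple ℂ L]

lemma diag_inj (hA : B'.A = B.A) {y : L} (hD : (0, y) ∈ diag B B') : y = 0 := by
  have := B'.isCartanSubalgebra
  let I : LieIdeal ℂ L :=
    { carrier := {y | (0, y) ∈ diag B B'}
      add_mem' := fun {a b} ha hb => by simpa using (diag B B').add_mem ha hb
      zero_mem' := (diag B B').zero_mem
      smul_mem' := fun c a ha => by simpa using (diag B B').smul_mem c ha
      lie_mem := fun {x m} hm => by
        obtain ⟨z, hz⟩ := diag_snd B B' x
        simpa using (diag B B').lie_mem hz hm }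
  have hI : ∀ α : H'.root, α ∉ I.rootSet := by
    intro α hα
    have h1 := I.corootSubmodule_le hα
      (LieAlgebra.IsKilling.coe_coroot_mem_corootSubmodule (α : LieModule.Weight ℂ H' L))
    have h2 := diag_cartan B B' hA (LieAlgebra.IsKilling.coroot (α : LieModule.Weight ℂ H' L)).2 h1
    have h3 := (LieAlgebra.IsKilling.coroot_eq_zero_iff (α := (α : LieModule.Weight ℂ H' L))).1
      (Subtype.ext h2)
    exact H'.isNonZero_coe_root α h3
  have hbot := I.restr_eq_iSup_sl2SubmoduleOfRoot (H := H')
  simp only [hI, iSup_false, iSup_bot, ] at hbot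
  have : y ∈ I.restr H' := hD
  rw [hbot] at this
  simpa using this

/-- Two families of Chevalley-Serre generators with the same Cartan matrix are exchanged by an
automorphism. -/
theorem exists_equiv (hA : B'.A = B.A) :
    ∃ φ : L ≃ₗ⁅ℂ⁆ L, (∀ i, φ (B.e i) = B'.e i) ∧ (∀ i, φ (B.f i) = B'.f i) := by
  choose g hg using diag_fst B B'
  have huniq : ∀ {x y y'}, (x, y) ∈ diag B B' → (x, y') ∈ diag B B' → y = y' := by
    intro x y y' h1 h2
    have := (diag B B').sub_mem h1 h2
    rw [Prod.mk_sub_mk, sub_self] at this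
    exact sub_eq_zero.1 (diag_inj B B' hA this)
  let φ : L →ₗ⁅ℂ⁆ L :=
    { toFun := g
      map_add' := fun x y => huniq (hg _) (by simpa using (diag B B').add_mem (hg x) (hg y))
      map_smul' := fun c x => huniq (hg _) (by simpa using (diag B B').smul_mem c (hg x))
      map_lie' := fun {x y} => huniq (hg _) (by simpa using (diag B B').lie_mem (hg x) (hg y)) }
  have hsurj : Function.Surjective φ := fun y => by
    obtain ⟨x, hx⟩ := diag_snd B B' y
    exact ⟨x, huniq (hg x) hx⟩
  have hinj : Function.Injective φ :=
    (LinearMap.injective_iff_surjective (f := (φ : L →ₗ[ℂ] L))).2 hsurj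
  exact ⟨LieEquiv.ofBijective φ ⟨hinj, hsurj⟩, fun i => huniq (hg _) (diag_e B B' i),
    fun i => huniq (hg _) (diag_f B B' i)⟩

/-- The generators `ω⁻¹ E_{ν(i)}`, `α̌_{ν(i)}`, `ω F_{ν(i)}`. -/
def twistBasis (B : LieAlgebra.Basis ι H) (ν : Equiv.Perm ι)
    (hν : ∀ i j, B.A (ν i) (ν j) = B.A i j) (ω : ℂˣ) : LieAlgebra.Basis ι H where
  A := B.A
  h i := B.h (ν i)
  e i := ((ω⁻¹ : ℂˣ) : ℂ) • B.e (ν i)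
  f i := (ω : ℂ) • B.f (ν i)
  cartan_eq_lieSpan := by
    have : Set.range (fun i => B.h (ν i)) = Set.range B.h := ν.surjective.range_comp B.h
    rw [this]
    exact B.cartan_eq_lieSpan
  span_ef := by
    rw [eq_top_iff, ← B.span_ef, LieSubalgebra.lieSpan_le]
    rintro _ (⟨i, rfl⟩ | ⟨i, rfl⟩)
    · have h : ((ω⁻¹ : ℂˣ) : ℂ) • B.e (ν (ν.symm i)) ∈ LieSubalgebra.lieSpan ℂ L
        (Set.range (fun i => ((ω⁻¹ : ℂˣ) : ℂ) • B.e (ν i)) ∪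
          Set.range (fun i => (ω : ℂ) • B.f (ν i))) :=
        LieSubalgebra.subset_lieSpan (Or.inl ⟨_, rfl⟩)
      simpa [smul_smul] using LieSubalgebra.smul_mem _ (ω : ℂ) h
    · have h : (ω : ℂ) • B.f (ν (ν.symm i)) ∈ LieSubalgebra.lieSpan ℂ L
        (Set.range (fun i => ((ω⁻¹ : ℂˣ) : ℂ) • B.e (ν i)) ∪
          Set.range (fun i => (ω : ℂ) • B.f (ν i))) :=
        LieSubalgebra.subset_lieSpan (Or.inr ⟨_, rfl⟩)
      simpa [smul_smul] using LieSubalgebra.smul_mem _ ((ω⁻¹ : ℂˣ) : ℂ) h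
  linInd := B.linInd.comp ν ν.injective
  nondegen := B.nondegen
  sl2 i :=
    { h_ne_zero := (B.sl2 (ν i)).h_ne_zero
      lie_e_f := by simp [smul_smul, (B.sl2 (ν i)).lie_e_f]
      lie_h_e_nsmul := by rw [lie_smul, (B.sl2 (ν i)).lie_h_e_nsmul, smul_comm]
      lie_h_f_nsmul := by rw [lie_smul, (B.sl2 (ν i)).lie_h_f_nsmul, smul_neg, smul_comm] }
  lie_h_h i j := B.lie_h_h _ _
  lie_h_e i j := by rw [lie_smul, B.lie_h_e, hν, smul_comm]
  lie_h_f i j := by rw [lie_smul, B.lie_h_f, hν, smul_comm]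
  lie_e_f_ne i j hij := by
    rw [lie_smul, smul_lie, B.lie_e_f_ne _ _ (fun h => hij (ν.injective h)), smul_zero, smul_zero]

/-- The automorphism `ς = Ad_{ω^{-ρ̌}} ∘ ν` of `𝔤`: the Lie algebra automorphism with
`ς(E_i) = ω⁻¹ E_{ν(i)}` and `ς(F_i) = ω F_{ν(i)}` (unique, as the `E_i`, `F_i` generate `𝔤`). -/
def cycAut (B : LieAlgebra.Basis ι H) (ν : Equiv.Perm ι)
    (hν : ∀ i j, B.A (ν i) (ν j) = B.A i j) (ω : ℂˣ) : L ≃ₗ⁅ℂ⁆ L :=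
  (exists_equiv B (twistBasis B ν hν ω) rfl).choose

lemma cycAut_e (B : LieAlgebra.Basis ι H) (ν : Equiv.Perm ι)
    (hν : ∀ i j, B.A (ν i) (ν j) = B.A i j) (ω : ℂˣ) (i : ι) :
    cycAut B ν hν ω (B.e i) = ((ω⁻¹ : ℂˣ) : ℂ) • B.e (ν i) :=
  (exists_equiv B (twistBasis B ν hν ω) rfl).choose_spec.1 i

lemma cycAut_f (B : LieAlgebra.Basis ι H) (ν : Equiv.Perm ι)
    (hν : ∀ i j, B.A (ν i) (ν j) = B.A i j) (ω : ℂˣ) (i : ι) :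
    cycAut B ν hν ω (B.f i) = (ω : ℂ) • B.f (ν i) :=
  (exists_equiv B (twistBasis B ν hν ω) rfl).choose_spec.2 i

end Iso

end CycOper

namespace CycOper

section Lie

variable {ι : Type*} [Fintype ι] {L : Type*} [LieRing L] [LieAlgebra ℂ L]
  {H : LieSubalgebra ℂ L} (B : LieAlgebra.Basis ι H)

/-- The root space of `∑ᵢ kᵢ αᵢ`, where the `αᵢ` are the simple roots (it vanishes when
`k ≠ 0` and this is not a root). -/
def rootSp (k : ι → ℕ) : Submodule ℂ L :=
  letI := B.isLieAbelian_cartan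
  (LieAlgebra.rootSpace H (∑ i, k i • B.baseSupp i)).toSubmodule

/-- `𝔫`, the sum of the root spaces of the positive roots. -/
def nPos : Submodule ℂ L := ⨆ (k : ι → ℕ) (_ : k ≠ 0), rootSp B k

/-- The Borel subalgebra `𝔟 = 𝔥 ⊕ 𝔫`. -/
def borel : Submodule ℂ L := H.toSubmodule ⊔ nPos B

/-- `p₋₁ = ∑ᵢ Fᵢ`. -/
def pMinus : L := ∑ i, B.f i

open Classical in
/-- The coefficients `cᵢ` in `2ρ̌ = ∑ᵢ cᵢ α̌ᵢ`: they solve `∑ᵢ cᵢ ⟨αⱼ, α̌ᵢ⟩ = 2` for all `j`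
(in `LieAlgebra.Basis`, the entry `A j i` is `⟨αⱼ, α̌ᵢ⟩`). -/
def rhoCoeff : ι → ℂ := (B.A.map (Int.cast : ℤ → ℂ))⁻¹.mulVec fun _ => 2

/-- `p₁ = ∑ᵢ cᵢ Eᵢ`, which completes `p₋₁`, `2ρ̌` to the principal `𝔰𝔩₂`-triple. -/
def pPlus : L := ∑ i, rhoCoeff B i • B.e i

/-- `𝔞`, the centraliser of `p₁`. -/
def cent : Submodule ℂ L := LinearMap.ker (LieAlgebra.ad ℂ L (pPlus B))

lemma nPos_eq : nPos B = (LieSubalgebra.lieSpan ℂ L (Set.range B.e)).toSubmodule := by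
  have h := congrArg LieSubmodule.toSubmodule B.borelUpper_eq
  simp only [LieSubmodule.iSup_toSubmodule] at h
  exact h.symm

lemma nPos_le_borel : nPos B ≤ borel B := le_sup_right

lemma lie_nPos_borel {x y : L} (hx : x ∈ nPos B) (hy : y ∈ borel B) : ⁅x, y⁆ ∈ nPos B := by
  obtain ⟨h, hh, u, hu, rfl⟩ := Submodule.mem_sup.1 hy
  rw [nPos_eq] at hx hu ⊢
  rw [lie_add]
  refine add_mem ?_ (LieSubalgebra.lie_mem _ hx hu)
  rw [← lie_skew]
  exact neg_mem (B.borelUpper.lie_mem (x := ⟨h, hh⟩) hx)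

lemma lie_nPos_pMinus {x : L} (hx : x ∈ nPos B) : ⁅x, pMinus B⁆ ∈ borel B := by
  have hx' := hx
  rw [nPos_eq] at hx'
  induction hx' using LieSubalgebra.lieSpan_induction with
  | mem u hu =>
    obtain ⟨i, rfl⟩ := hu
    have : ⁅B.e i, pMinus B⁆ = B.h i := by
      classical
      rw [pMinus, lie_sum, Finset.sum_eq_single i, (B.sl2 i).lie_e_f]
      · intro j _ hj
        exact B.lie_e_f_ne i j hj.symm
      · simp
    rw [this]
    exact Submodule.mem_sup_left (B.h' i).2
  | zero => simp
  | add u v hu hv hu' hv' =>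
    rw [add_lie]
    exact add_mem (hu' (by rw [nPos_eq]; exact hu)) (hv' (by rw [nPos_eq]; exact hv))
  | smul t u hu hu' =>
    rw [smul_lie]
    exact Submodule.smul_mem _ _ (hu' (by rw [nPos_eq]; exact hu))
  | lie u v hu hv hu' hv' =>
    rw [lie_lie]
    have hu1 : u ∈ nPos B := by rw [nPos_eq]; exact hu
    have hv1 : v ∈ nPos B := by rw [nPos_eq]; exact hv
    exact sub_mem (nPos_le_borel B (lie_nPos_borel B hu1 (hv' hv1)))
      (nPos_le_borel B (lie_nPos_borel B hv1 (hu' hu1)))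

lemma mem_borel_of_lie {x : L} (hx : ∀ h ∈ H, ⁅x, h⁆ ∈ nPos B) : x ∈ borel B := by
  have hab := B.isLieAbelian_cartan
  have htop := B.iSup_cartan_borelLower_borelUpper_eq_top
  have hind := B.iSupIndep_rootSpace
  have hcar := B.cartan_eq
  have hdis : Disjoint B.borelLower B.borelUpper := by
    have := hind.pairwiseDisjoint (show (1 : Fin 3) ≠ 2 by decide)
    rw [B.borelLower_eq, B.borelUpper_eq]
    exact this
  have hx0 : x ∈ H.toLieSubmodule ⊔ B.borelLower ⊔ B.borelUpper := by
    have : H.toLieSubmodule ⊔ B.borelLower ⊔ B.borelUpper = ⊤ := by simpa using htop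
    rw [this]; trivial
  obtain ⟨y, hy, u, hu, rfl⟩ := (LieSubmodule.mem_sup _ _ _).1 hx0
  obtain ⟨h, hh, l, hl, rfl⟩ := (LieSubmodule.mem_sup _ _ _).1 hy
  have hu' : u ∈ nPos B := by rw [nPos_eq]; exact hu
  have hlH : l ∈ H.toLieSubmodule := by
    rw [hcar, LieModule.mem_genWeightSpace]
    rintro ⟨z, hz⟩
    refine ⟨1, ?_⟩
    have h1 := hx z hz
    rw [add_lie, add_lie] at h1
    have h2 : ⁅h, z⁆ = 0 :=
      congrArg Subtype.val (trivial_lie_zero H H ⟨h, hh⟩ ⟨z, hz⟩)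
    have h3 : ⁅u, z⁆ ∈ nPos B := lie_nPos_borel B hu' (Submodule.mem_sup_left hz)
    rw [h2, zero_add] at h1
    have h4 : ⁅l, z⁆ ∈ nPos B := by simpa using sub_mem h1 h3
    have h5 : ⁅z, l⁆ ∈ B.borelLower := B.borelLower.lie_mem (x := ⟨z, hz⟩) hl
    have h6 : ⁅z, l⁆ ∈ B.borelUpper := by
      rw [← lie_skew]
      rw [nPos_eq] at h4
      exact neg_mem h4
    have h7 := (LieSubmodule.disjoint_toSubmodule.2 hdis)
    have h8 : ⁅z, l⁆ = 0 := Submodule.disjoint_def.1 h7 _ h5 h6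
    simpa using h8
  exact add_mem (add_mem (Submodule.mem_sup_left hh) (Submodule.mem_sup_left hlH))
    (nPos_le_borel B hu')

/-- `exp(ad x)` as a finite sum, for an `ad`-nilpotent element `x`. -/
def expAd (x : L) : Module.End ℂ L :=
  ∑ j ∈ Finset.range (Module.finrank ℂ L + 1), ((j.factorial : ℂ))⁻¹ • (LieAlgebra.ad ℂ L x) ^ j

/-- The unipotent group `N`, as a group of automorphisms of `𝔤`: it is generated by the root
subgroups `{exp(ad x) | x ∈ 𝔤_α}` of the positive roots `α`. -/
def unip : Subgroup (L ≃ₗ[ℂ] L) :=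
  Subgroup.closure {φ | ∃ k : ι → ℕ, k ≠ 0 ∧ ∃ x ∈ rootSp B k,
    ∃ ψ : L ≃ₗ⁅ℂ⁆ L, ψ.toLinearEquiv = φ ∧ ∀ y, ψ y = expAd x y}

lemma expAd_sub_mem {S : Submodule ℂ L} {x y : L} (hS : ∀ z ∈ S, ⁅x, z⁆ ∈ S) (hy : ⁅x, y⁆ ∈ S) :
    expAd x y - y ∈ S := by
  have h : ∀ j, ((LieAlgebra.ad ℂ L x) ^ (j + 1)) y ∈ S := by
    intro j
    induction j with
    | zero => simpa using hy
    | succ j ih =>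
      rw [pow_succ', Module.End.mul_apply]
      exact hS _ ih
  rw [expAd, Finset.sum_range_succ', LinearMap.add_apply, LinearMap.sum_apply]
  simp only [Nat.factorial_zero, Nat.cast_one, inv_one, pow_zero, one_smul, Module.End.one_apply,
    add_sub_cancel_right]
  exact Submodule.sum_mem _ fun j _ => Submodule.smul_mem _ _ (h j)

variable [FiniteDimensional ℂ L]

lemma unip_spec {φ : L ≃ₗ[ℂ] L} (hφ : φ ∈ unip B) :
    (∀ x y, φ ⁅x, y⁆ = ⁅φ x, φ y⁆) ∧ (∀ y ∈ borel B, φ y - y ∈ nPos B) ∧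
      φ (pMinus B) - pMinus B ∈ borel B := by
  have hsymm : ∀ (φ : L ≃ₗ[ℂ] L) (S : Submodule ℂ L), (∀ y ∈ S, φ y ∈ S) →
      ∀ y ∈ S, φ⁻¹ y ∈ S := by
    intro φ S h y hy
    have hle : S.map (φ : L →ₗ[ℂ] L) ≤ S := by
      rintro _ ⟨z, hz, rfl⟩
      exact h z hz
    have heq := Submodule.eq_of_le_of_finrank_eq hle (LinearEquiv.finrank_map_eq φ S)
    rw [← heq] at hy
    obtain ⟨z, hz, rfl⟩ := hy
    change φ.symm (φ z) ∈ S
    simpa using hz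
  induction hφ using Subgroup.closure_induction with
  | mem φ h =>
    obtain ⟨k, hk, x, hx, ψ, rfl, hψ⟩ := h
    have hxn : x ∈ nPos B := (le_iSup₂_of_le k hk le_rfl : rootSp B k ≤ nPos B) hx
    refine ⟨fun a b => LieEquiv.map_lie ψ a b, fun y hy => ?_, ?_⟩
    · change ψ y - y ∈ _
      rw [hψ]
      exact expAd_sub_mem (fun z hz => lie_nPos_borel B hxn (nPos_le_borel B hz))
        (lie_nPos_borel B hxn hy)
    · change ψ _ - _ ∈ _
      rw [hψ]
      exact expAd_sub_mem (fun z hz => nPos_le_borel B (lie_nPos_borel B hxn hz))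
        (lie_nPos_pMinus B hxn)
  | one => simp
  | mul φ ψ _ _ h1 h2 =>
    refine ⟨fun a b => ?_, fun y hy => ?_, ?_⟩
    · simp [LinearEquiv.mul_apply, h1.1, h2.1]
    · have h3 := h2.2.1 y hy
      have h4 := h1.2.1 _ (nPos_le_borel B h3)
      have h5 := h1.2.1 y hy
      have : (φ * ψ) y - y = (φ (ψ y - y) - (ψ y - y)) + (ψ y - y) + (φ y - y) := by
        rw [LinearEquiv.mul_apply, map_sub]; abel
      rw [this]
      exact add_mem (add_mem h4 h3) h5
    · have h3 := h2.2.2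
      have h4 := nPos_le_borel B (h1.2.1 _ h3)
      have : (φ * ψ) (pMinus B) - pMinus B = (φ (ψ (pMinus B) - pMinus B) - (ψ (pMinus B) - pMinus B))
          + (ψ (pMinus B) - pMinus B) + (φ (pMinus B) - pMinus B) := by
        rw [LinearEquiv.mul_apply, map_sub]; abel
      rw [this]
      exact add_mem (add_mem h4 h3) h1.2.2
  | inv φ _ h =>
    have hinv : ∀ y, φ (φ⁻¹ y) = y := fun y => φ.apply_symm_apply y
    have hinv' : ∀ y, φ⁻¹ (φ y) = y := fun y => φ.symm_apply_apply y
    have hn := hsymm φ (nPos B) fun y hy => by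
      simpa using add_mem (h.2.1 y (nPos_le_borel B hy)) hy
    have hb := hsymm φ (borel B) fun y hy => by
      simpa using add_mem (nPos_le_borel B (h.2.1 y hy)) hy
    have hd : ∀ y, φ⁻¹ y - y = -φ⁻¹ (φ y - y) := fun y => by rw [map_sub, hinv']; abel
    refine ⟨fun a b => φ.injective ?_, fun y hy => ?_, ?_⟩
    · rw [h.1, hinv, hinv, hinv]
    · rw [hd]; exact neg_mem (hn _ (h.2.1 y hy))
    · rw [hd]; exact neg_mem (hb _ h.2.2)

end Lie

end CycOper

namespace CycOper

section BaseChange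

variable {L : Type*} [LieRing L] [LieAlgebra ℂ L] {R : Type*} [CommRing R] [Algebra ℂ R]

/-- The components of an element of `R ⊗ L` with respect to a basis of `R`. -/
def comp (k : Module.Basis.ofVectorSpaceIndex ℂ R) : R ⊗[ℂ] L →ₗ[ℂ] L :=
  (TensorProduct.lid ℂ L).toLinearMap ∘ₗ ((Module.Basis.ofVectorSpace ℂ R).coord k).rTensor L

@[simp] lemma comp_tmul (k : Module.Basis.ofVectorSpaceIndex ℂ R) (r : R) (x : L) :
    comp k (r ⊗ₜ[ℂ] x) = (Module.Basis.ofVectorSpace ℂ R).coord k r • x := by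
  simp [comp]

lemma exists_comp (Z : R ⊗[ℂ] L) : ∃ c : Module.Basis.ofVectorSpaceIndex ℂ R →₀ L,
    (c.sum fun k x => Module.Basis.ofVectorSpace ℂ R k ⊗ₜ[ℂ] x) = Z ∧ ∀ k, comp k Z = c k := by
  obtain ⟨c, hc⟩ := TensorProduct.eq_repr_basis_left (Module.Basis.ofVectorSpace ℂ R) Z
  refine ⟨c, hc, fun k => ?_⟩
  rw [← hc, Finsupp.sum, map_sum]
  simp only [comp_tmul, Module.Basis.coord_apply, Module.Basis.repr_self]
  rw [Finset.sum_eq_single k]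
  · simp
  · intro j _ hj
    rw [Finsupp.single_eq_of_ne (Ne.symm hj), zero_smul]
  · intro hk
    rw [Finsupp.notMem_support_iff.1 hk, smul_zero]

lemma ext_comp {Z W : R ⊗[ℂ] L} (h : ∀ k, comp k Z = comp k W) : Z = W := by
  rw [← sub_eq_zero]
  obtain ⟨c, hc, hc'⟩ := exists_comp (Z - W)
  have : c = 0 := by
    ext k
    rw [← hc', map_sub, h, sub_self]
    rfl
  rw [← hc, this, Finsupp.sum_zero_index]

lemma comp_lie (k : Module.Basis.ofVectorSpaceIndex ℂ R) (Z : R ⊗[ℂ] L) (x : L) :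
    comp k ⁅Z, (1 : R) ⊗ₜ[ℂ] x⁆ = ⁅comp k Z, x⁆ := by
  induction Z with
  | zero => simp
  | add a b ha hb => rw [add_lie, map_add, ha, hb, map_add, add_lie]
  | tmul r y => simp [LieAlgebra.ExtendScalars.bracket_tmul]

lemma mem_baseChange {S : Submodule ℂ L} {Z : R ⊗[ℂ] L} :
    Z ∈ S.baseChange R ↔ ∀ k, comp k Z ∈ S := by
  constructor
  · intro hZ
    rw [Submodule.baseChange_eq_span] at hZ
    induction hZ using Submodule.span_induction with
    | mem u hu =>
      obtain ⟨x, hx, rfl⟩ := hu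
      intro k
      simpa using S.smul_mem _ hx
    | zero => intro k; simp
    | add u v hu hv hu' hv' =>
      intro k
      rw [map_add]
      exact add_mem (hu' k) (hv' k)
    | smul r u hu hu' =>
      intro k
      obtain ⟨c, hc, hc'⟩ := exists_comp u
      rw [← hc, Finsupp.sum, Finset.smul_sum, map_sum]
      refine Submodule.sum_mem _ fun j _ => ?_
      rw [TensorProduct.smul_tmul', comp_tmul]
      refine S.smul_mem _ ?_
      rw [← hc']
      exact hu' j
  · intro h
    obtain ⟨c, hc, hc'⟩ := exists_comp Z
    rw [← hc]
    refine Submodule.sum_mem _ fun j _ => Submodule.tmul_mem_baseChange_of_mem _ ?_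
    rw [← hc']
    exact h j

lemma coord_eq (ξ : Module.Dual ℂ L) (Z : R ⊗[ℂ] L) (k : Module.Basis.ofVectorSpaceIndex ℂ R) :
    (Module.Basis.ofVectorSpace ℂ R).coord k (coord R ξ Z) = ξ (comp k Z) := by
  induction Z with
  | zero => simp
  | add a b ha hb => simp only [map_add, ha, hb]
  | tmul r y => simp [mul_comm]

lemma mem_baseChange_of_coord {S : Submodule ℂ L} {Z : R ⊗[ℂ] L}
    (h : ∀ ξ : Module.Dual ℂ L, (∀ x ∈ S, ξ x = 0) → coord R ξ Z = 0) : Z ∈ S.baseChange R := by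
  rw [mem_baseChange]
  intro k
  by_contra hk
  obtain ⟨ξ, hξ, hS⟩ := Submodule.exists_le_ker_of_notMem hk
  refine hξ ?_
  rw [← coord_eq, h ξ fun x hx => hS hx, map_zero]

lemma ext_coord {Z W : R ⊗[ℂ] L} (h : ∀ ξ : Module.Dual ℂ L, coord R ξ Z = coord R ξ W) :
    Z = W := by
  refine ext_comp fun k => ?_
  rw [← sub_eq_zero, ← Module.forall_dual_apply_eq_zero_iff ℂ]
  intro ξ
  rw [map_sub, ← coord_eq, ← coord_eq, h, sub_self]

/-- Two maps which are additive, `R`-linear and agree on `1 ⊗ x` agree. -/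
lemma eq_of_tmul {F G : R ⊗[ℂ] L →ₗ[R] R ⊗[ℂ] L} (h : ∀ x : L, F (1 ⊗ₜ x) = G (1 ⊗ₜ x)) :
    F = G := by
  refine LinearMap.ext fun Z => ?_
  induction Z with
  | zero => simp
  | add a b ha hb => simp only [map_add, ha, hb]
  | tmul r y =>
    have : (r ⊗ₜ[ℂ] y : R ⊗[ℂ] L) = r • (1 ⊗ₜ[ℂ] y) := by simp [TensorProduct.smul_tmul']
    rw [this, map_smul, map_smul, h]

variable [FiniteDimensional ℂ L] [LieAlgebra.IsSemisimple ℂ L]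

lemma eq_of_lie {Z W : R ⊗[ℂ] L} (h : ∀ X : R ⊗[ℂ] L, ⁅Z, X⁆ = ⁅W, X⁆) : Z = W := by
  refine ext_comp fun k => ?_
  have : comp k Z - comp k W ∈ LieAlgebra.center ℂ L := by
    rw [LieModule.mem_maxTrivSubmodule]
    intro x
    rw [← lie_skew, sub_lie, ← comp_lie, ← comp_lie, h, sub_self, neg_zero]
  rw [LieAlgebra.center_eq_bot] at this
  exact sub_eq_zero.1 this

/-- Every `R`-linear derivation of `R ⊗ L` is inner. -/
lemma exists_inner (D : R ⊗[ℂ] L →ₗ[R] R ⊗[ℂ] L)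
    (hD : ∀ X Y : R ⊗[ℂ] L, D ⁅X, Y⁆ = ⁅D X, Y⁆ + ⁅X, D Y⁆) :
    ∃ Z : R ⊗[ℂ] L, ∀ X : R ⊗[ℂ] L, ⁅Z, X⁆ = D X := by
  have h1 : ∀ k : Module.Basis.ofVectorSpaceIndex ℂ R, ∃ z : L, ∀ x : L,
      ⁅z, x⁆ = comp k (D ((1 : R) ⊗ₜ x)) := by
    intro k
    let δ : LieDerivation ℂ L L :=
      { toLinearMap := comp k ∘ₗ D.restrictScalars ℂ ∘ₗ TensorProduct.mk ℂ R L 1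
        leibniz' := fun a b => by
          have h := hD (1 ⊗ₜ a) (1 ⊗ₜ b)
          rw [LieAlgebra.ExtendScalars.bracket_tmul, one_mul] at h
          have h' := congrArg (comp k) h
          rw [map_add, comp_lie, ← lie_skew ((1 : R) ⊗ₜ[ℂ] a), map_neg, comp_lie, lie_skew]
            at h'
          simp only [LinearMap.comp_apply, TensorProduct.mk_apply, LinearMap.restrictScalars_apply]
          rw [h', ← lie_skew _ b]
          abel }
    obtain ⟨z, hz⟩ := LieDerivation.IsKilling.exists_eq_ad δ
    refine ⟨z, fun x => ?_⟩
    rw [← LieDerivation.ad_apply_apply (R := ℂ), hz]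
    rfl
  choose z hz using h1
  choose c hc hc' using fun i => exists_comp (D ((1 : R) ⊗ₜ[ℂ] Module.finBasis ℂ L i))
  classical
  let S : Finset (Module.Basis.ofVectorSpaceIndex ℂ R) := Finset.univ.biUnion fun i => (c i).support
  refine ⟨∑ k ∈ S, Module.Basis.ofVectorSpace ℂ R k ⊗ₜ[ℂ] z k, fun X => ?_⟩
  have hS : ∀ k, k ∉ S → z k = 0 := by
    intro k hk
    have hk' : ∀ i, c i k = 0 := by
      intro i
      by_contra hi
      exact hk (Finset.mem_biUnion.2 ⟨i, Finset.mem_univ _, Finsupp.mem_support_iff.2 hi⟩)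
    have hm : z k ∈ LieAlgebra.center ℂ L := by
      rw [LieModule.mem_maxTrivSubmodule]
      intro x
      have : LieAlgebra.ad ℂ L (z k) = 0 := by
        refine (Module.finBasis ℂ L).ext fun i => ?_
        rw [LieAlgebra.ad_apply, hz, hc', hk', LinearMap.zero_apply]
      rw [← lie_skew, ← LieAlgebra.ad_apply (R := ℂ), this, LinearMap.zero_apply, neg_zero]
    rw [LieAlgebra.center_eq_bot] at hm
    exact hm
  have hcomp : ∀ k, comp k (∑ k ∈ S, Module.Basis.ofVectorSpace ℂ R k ⊗ₜ[ℂ] z k) = z k := by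
    intro k
    rw [map_sum]
    simp only [comp_tmul, Module.Basis.coord_apply, Module.Basis.repr_self]
    by_cases hk : k ∈ S
    · rw [Finset.sum_eq_single k]
      · simp
      · intro j _ hj
        rw [Finsupp.single_eq_of_ne (Ne.symm hj), zero_smul]
      · exact fun h => absurd hk h
    · rw [hS k hk]
      refine Finset.sum_eq_zero fun j hj => ?_
      rw [Finsupp.single_eq_of_ne (Ne.symm (ne_of_mem_of_not_mem hj hk)), zero_smul]
  have := eq_of_tmul (F := LieAlgebra.ad R (R ⊗[ℂ] L)
    (∑ k ∈ S, Module.Basis.ofVectorSpace ℂ R k ⊗ₜ[ℂ] z k)) (G := D) (fun x => ?_)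
  · exact LinearMap.congr_fun this X
  · refine ext_comp fun k => ?_
    rw [LieAlgebra.ad_apply, comp_lie, hcomp, hz]

end BaseChange

section Gauge

variable {ι : Type*} [Fintype ι] {L : Type*} [LieRing L] [LieAlgebra ℂ L] [FiniteDimensional ℂ L]
  {H : LieSubalgebra ℂ L} (B : LieAlgebra.Basis ι H)

/-- The operator `d/dt` on `𝔤(ℳ) = ℳ ⊗ 𝔤`. -/
def dOp : Mero ⊗[ℂ] L →ₗ[ℂ] Mero ⊗[ℂ] L := Mero.d.toLinearMap.rTensor L

/-- `N(ℳ)`, the group of `ℳ`-points of `N`. -/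
def unipM : Subgroup ((Mero ⊗[ℂ] L) ≃ₗ[Mero] (Mero ⊗[ℂ] L)) := points (unip B) Mero

open Classical in
/-- `dg g⁻¹ ∈ Ω(𝔤)`, divided by `dt`, for an `ℳ`-linear automorphism `g` of the Lie algebra `𝔤(ℳ)`:
the element of `𝔤(ℳ)` whose adjoint operator is `(dg/dt) g⁻¹ = d/dt - g (d/dt) g⁻¹`. -/
def logDer (g : (Mero ⊗[ℂ] L) ≃ₗ[Mero] (Mero ⊗[ℂ] L)) : Mero ⊗[ℂ] L :=
  if h : ∃ Z : Mero ⊗[ℂ] L, ∀ X, ⁅Z, X⁆ = dOp X - g (dOp (g⁻¹ X)) then h.choose else 0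

/-- The gauge transformation `d + A dt ↦ g (d + A dt) g⁻¹ = d - dg g⁻¹ + Ad_g A dt`. A differential
`A dt ∈ Ω(𝔤) = 𝔤 ⊗ ℳ dt` is represented by `A ∈ 𝔤(ℳ)`. -/
def gauge (g : (Mero ⊗[ℂ] L) ≃ₗ[Mero] (Mero ⊗[ℂ] L)) (A : Mero ⊗[ℂ] L) : Mero ⊗[ℂ] L :=
  g A - logDer g

lemma dOp_smul (f : Mero) (X : Mero ⊗[ℂ] L) : dOp (f • X) = Mero.d f • X + f • dOp X := by
  induction X with
  | zero => simp
  | add a b ha hb => rw [smul_add, map_add, ha, hb, map_add, smul_add, smul_add]; abel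
  | tmul r y =>
    simp only [dOp, TensorProduct.smul_tmul', LinearMap.rTensor_tmul, Derivation.coeFn_coe,
      smul_eq_mul, Derivation.leibniz, TensorProduct.add_tmul]
    rw [add_comm, mul_comm r]

lemma dOp_lie (X Y : Mero ⊗[ℂ] L) : dOp ⁅X, Y⁆ = ⁅dOp X, Y⁆ + ⁅X, dOp Y⁆ := by
  induction X with
  | zero => simp
  | add a b ha hb => simp only [add_lie, map_add, ha, hb]; abel
  | tmul r x =>
    induction Y with
    | zero => simp
    | add a b ha hb => simp only [lie_add, map_add, ha, hb]; abel
    | tmul s y =>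
      simp only [dOp, LieAlgebra.ExtendScalars.bracket_tmul, LinearMap.rTensor_tmul,
        Derivation.coeFn_coe, Derivation.leibniz, TensorProduct.add_tmul, smul_eq_mul]
      rw [add_comm, mul_comm s]

lemma dOp_mem {S : Submodule ℂ L} {X : Mero ⊗[ℂ] L} (hX : X ∈ S.baseChange Mero) :
    dOp X ∈ S.baseChange Mero := by
  obtain ⟨c, hc, hc'⟩ := exists_comp X
  rw [← hc, Finsupp.sum, map_sum]
  refine Submodule.sum_mem _ fun j _ => ?_
  rw [dOp, LinearMap.rTensor_tmul]
  refine Submodule.tmul_mem_baseChange_of_mem _ ?_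
  rw [← hc']
  exact mem_baseChange.1 hX j

lemma dual_lie (ξ : Module.Dual ℂ L) (x y : L) :
    ξ ⁅x, y⁆ = ∑ i, ∑ j, ξ ⁅Module.finBasis ℂ L i, Module.finBasis ℂ L j⁆ *
      ((Module.finBasis ℂ L).coord i x * (Module.finBasis ℂ L).coord j y) := by
  conv_lhs => rw [← (Module.finBasis ℂ L).sum_repr x]
  rw [sum_lie, map_sum]
  refine Finset.sum_congr rfl fun i _ => ?_
  conv_lhs => rw [← (Module.finBasis ℂ L).sum_repr y]
  rw [lie_sum, map_sum]
  refine Finset.sum_congr rfl fun j _ => ?_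
  rw [smul_lie, lie_smul, map_smul, map_smul, smul_eq_mul, smul_eq_mul,
    Module.Basis.coord_apply, Module.Basis.coord_apply]
  ring

lemma coord_lie (ξ : Module.Dual ℂ L) (X Y : Mero ⊗[ℂ] L) :
    coord Mero ξ ⁅X, Y⁆ = ∑ i, ∑ j, ξ ⁅Module.finBasis ℂ L i, Module.finBasis ℂ L j⁆ •
      (coord Mero ((Module.finBasis ℂ L).coord i) X *
        coord Mero ((Module.finBasis ℂ L).coord j) Y) := by
  induction X with
  | zero => simp
  | add a b ha hb => simp only [add_lie, map_add, ha, hb, add_mul, smul_add, Finset.sum_add_distrib]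
  | tmul r x =>
    induction Y with
    | zero => simp
    | add a b ha hb =>
      simp only [lie_add, map_add, ha, hb, mul_add, smul_add, Finset.sum_add_distrib]
    | tmul s y =>
      rw [LieAlgebra.ExtendScalars.bracket_tmul, coord_tmul]
      rw [dual_lie, Finset.sum_smul]
      refine Finset.sum_congr rfl fun i _ => ?_
      rw [Finset.sum_smul]
      refine Finset.sum_congr rfl fun j _ => ?_
      rw [coord_tmul, coord_tmul, smul_mul_smul_comm, smul_smul]

lemma regCoef_eq_const {K : Subgroup (L ≃ₗ[ℂ] L)} {ξ : Module.Dual ℂ L} {v : L} {c : ℂ}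
    (h : ∀ φ ∈ K, ξ (φ v) = c) : regCoef K ξ v = c • (1 : regFun K) := by
  ext φ
  change ξ ((φ : L ≃ₗ[ℂ] L) v) = c • (1 : ℂ)
  rw [h _ φ.2]
  simp

lemma unipM_lie {g : (Mero ⊗[ℂ] L) ≃ₗ[Mero] (Mero ⊗[ℂ] L)} (hg : g ∈ unipM B)
    (X Y : Mero ⊗[ℂ] L) : g ⁅X, Y⁆ = ⁅g X, g Y⁆ := by
  obtain ⟨χ, hχ⟩ := hg
  have key : ∀ x y : L, g ⁅(1 : Mero) ⊗ₜ[ℂ] x, (1 : Mero) ⊗ₜ[ℂ] y⁆ =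
      ⁅g ((1 : Mero) ⊗ₜ[ℂ] x), g ((1 : Mero) ⊗ₜ[ℂ] y)⁆ := by
    intro x y
    refine ext_coord fun ξ => ?_
    rw [LieAlgebra.ExtendScalars.bracket_tmul, one_mul, coord_lie, ← (hχ _ _).1]
    simp only [← (hχ _ _).1]
    have : regCoef (unip B) ξ ⁅x, y⁆ =
        ∑ i, ∑ j, ξ ⁅Module.finBasis ℂ L i, Module.finBasis ℂ L j⁆ •
          (regCoef (unip B) ((Module.finBasis ℂ L).coord i) x *
            regCoef (unip B) ((Module.finBasis ℂ L).coord j) y) := by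
      ext φ
      have h1 : ((∑ i, ∑ j, ξ ⁅Module.finBasis ℂ L i, Module.finBasis ℂ L j⁆ •
          (regCoef (unip B) ((Module.finBasis ℂ L).coord i) x *
            regCoef (unip B) ((Module.finBasis ℂ L).coord j) y) : regFun (unip B)) :
              unip B → ℂ) φ = ∑ i, ∑ j, ξ ⁅Module.finBasis ℂ L i, Module.finBasis ℂ L j⁆ *
          ((Module.finBasis ℂ L).coord i ((φ : L ≃ₗ[ℂ] L) x) *
            (Module.finBasis ℂ L).coord j ((φ : L ≃ₗ[ℂ] L) y)) := by
        simp [regCoef, coef, Finset.sum_apply]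
      rw [h1]
      change ξ ((φ : L ≃ₗ[ℂ] L) ⁅x, y⁆) = _
      rw [(unip_spec B φ.2).1]
      exact dual_lie ξ _ _
    rw [this]
    simp only [map_sum, map_smul, map_mul]
  have hone : ∀ (r : Mero) (x : L), (r ⊗ₜ[ℂ] x : Mero ⊗[ℂ] L) = r • (1 ⊗ₜ[ℂ] x) := fun r x => by
    simp [TensorProduct.smul_tmul']
  induction X with
  | zero => simp
  | add a b ha hb => simp only [add_lie, map_add, ha, hb]
  | tmul r x =>
    induction Y with
    | zero => simp
    | add a b ha hb => simp only [lie_add, map_add, ha, hb]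
    | tmul s y =>
      rw [hone r, hone s, smul_lie, lie_smul, map_smul, map_smul, key, map_smul, map_smul, smul_lie,
        lie_smul]

lemma unipM_sub_mem {g : (Mero ⊗[ℂ] L) ≃ₗ[Mero] (Mero ⊗[ℂ] L)} (hg : g ∈ unipM B)
    {X : Mero ⊗[ℂ] L} (hX : X ∈ (borel B).baseChange Mero) :
    g X - X ∈ (nPos B).baseChange Mero := by
  obtain ⟨χ, hχ⟩ := hg
  have h1 : ∀ x ∈ borel B, g ((1 : Mero) ⊗ₜ[ℂ] x) - (1 : Mero) ⊗ₜ[ℂ] x ∈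
      (nPos B).baseChange Mero := by
    intro x hx
    refine mem_baseChange_of_coord fun ξ hξ => ?_
    rw [map_sub, ← (hχ ξ x).1, regCoef_eq_const (c := ξ x), map_smul, map_one, coord_tmul, sub_self]
    intro φ hφ
    rw [← sub_eq_zero, ← map_sub]
    exact hξ _ ((unip_spec B hφ).2.1 x hx)
  obtain ⟨c, hc, hc'⟩ := exists_comp X
  rw [← hc, Finsupp.sum, map_sum, ← Finset.sum_sub_distrib]
  refine Submodule.sum_mem _ fun j _ => ?_
  have hone : ∀ (r : Mero) (x : L), (r ⊗ₜ[ℂ] x : Mero ⊗[ℂ] L) = r • (1 ⊗ₜ[ℂ] x) := fun r x => by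
    simp [TensorProduct.smul_tmul']
  rw [hone, map_smul, ← smul_sub]
  refine Submodule.smul_mem _ _ (h1 _ ?_)
  rw [← hc']
  exact mem_baseChange.1 hX j

lemma unipM_pMinus {g : (Mero ⊗[ℂ] L) ≃ₗ[Mero] (Mero ⊗[ℂ] L)} (hg : g ∈ unipM B) :
    g ((1 : Mero) ⊗ₜ[ℂ] pMinus B) - (1 : Mero) ⊗ₜ[ℂ] pMinus B ∈ (borel B).baseChange Mero := by
  obtain ⟨χ, hχ⟩ := hg
  refine mem_baseChange_of_coord fun ξ hξ => ?_
  rw [map_sub, ← (hχ ξ _).1, regCoef_eq_const (c := ξ (pMinus B)), map_smul, map_one, coord_tmul,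
    sub_self]
  intro φ hφ
  rw [← sub_eq_zero, ← map_sub]
  exact hξ _ (unip_spec B hφ).2.2

variable [LieAlgebra.IsSemisimple ℂ L]

lemma logDer_spec {g : (Mero ⊗[ℂ] L) ≃ₗ[Mero] (Mero ⊗[ℂ] L)}
    (hg : ∀ X Y, g ⁅X, Y⁆ = ⁅g X, g Y⁆) (X : Mero ⊗[ℂ] L) :
    ⁅logDer g, X⁆ = dOp X - g (dOp (g⁻¹ X)) := by
  have hinv : ∀ y, g (g⁻¹ y) = y := fun y => g.apply_symm_apply y
  have hg' : ∀ X Y, g⁻¹ ⁅X, Y⁆ = ⁅g⁻¹ X, g⁻¹ Y⁆ := fun X Y => g.injective (by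
    rw [hg, hinv, hinv, hinv])
  have h : ∃ Z : Mero ⊗[ℂ] L, ∀ X, ⁅Z, X⁆ = dOp X - g (dOp (g⁻¹ X)) := by
    refine exists_inner
      { toFun := fun X => dOp X - g (dOp (g⁻¹ X))
        map_add' := fun X Y => by simp only [map_add]; abel
        map_smul' := fun f X => by
          simp only [map_smul, dOp_smul, map_add, hinv, RingHom.id_apply, smul_sub]
          abel } ?_
    intro X Y
    simp only [LinearMap.coe_mk, AddHom.coe_mk, hg', dOp_lie, map_add, hg, hinv, sub_lie, lie_sub]
    abel
  rw [logDer, dif_pos h]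
  exact h.choose_spec X

lemma logDer_mem {g : (Mero ⊗[ℂ] L) ≃ₗ[Mero] (Mero ⊗[ℂ] L)} (hg : g ∈ unipM B) :
    logDer g ∈ (borel B).baseChange Mero := by
  rw [mem_baseChange]
  intro k
  refine mem_borel_of_lie B fun h hh => ?_
  rw [← comp_lie, logDer_spec (unipM_lie B hg)]
  have hb : (1 : Mero) ⊗ₜ[ℂ] h ∈ (borel B).baseChange Mero :=
    Submodule.tmul_mem_baseChange_of_mem _ (Submodule.mem_sup_left hh)
  have h0 : dOp ((1 : Mero) ⊗ₜ[ℂ] h) = 0 := by simp [dOp]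
  have h1 := dOp_mem (unipM_sub_mem B ((unipM B).inv_mem hg) hb)
  rw [map_sub, h0, sub_zero] at h1
  have hle : ∀ X ∈ (nPos B).baseChange Mero, X ∈ (borel B).baseChange Mero := fun X hX =>
    mem_baseChange.2 fun k => nPos_le_borel B (mem_baseChange.1 hX k)
  have h2 := add_mem (unipM_sub_mem B hg (hle _ h1)) h1
  rw [sub_add_cancel] at h2
  rw [h0, zero_sub]
  exact mem_baseChange.1 (neg_mem h2) k

lemma logDer_one : logDer (1 : (Mero ⊗[ℂ] L) ≃ₗ[Mero] (Mero ⊗[ℂ] L)) = 0 := by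
  refine eq_of_lie fun X => ?_
  rw [logDer_spec (fun X Y => rfl)]
  simp

lemma logDer_mul {g h : (Mero ⊗[ℂ] L) ≃ₗ[Mero] (Mero ⊗[ℂ] L)}
    (hg : ∀ X Y, g ⁅X, Y⁆ = ⁅g X, g Y⁆) (hh : ∀ X Y, h ⁅X, Y⁆ = ⁅h X, h Y⁆) :
    logDer (g * h) = logDer g + g (logDer h) := by
  have hinv : ∀ y, g (g⁻¹ y) = y := fun y => g.apply_symm_apply y
  refine eq_of_lie fun X => ?_
  rw [logDer_spec (fun X Y => by simp only [LinearEquiv.mul_apply, hg, hh]), add_lie,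
    logDer_spec hg]
  have : ⁅g (logDer h), X⁆ = g ⁅logDer h, g⁻¹ X⁆ := by rw [hg, hinv]
  rw [this, logDer_spec hh, map_sub, mul_inv_rev]
  simp only [LinearEquiv.mul_apply]
  abel

lemma gauge_one (A : Mero ⊗[ℂ] L) : gauge 1 A = A := by
  rw [gauge, logDer_one, sub_zero]; rfl

lemma gauge_mul {g h : (Mero ⊗[ℂ] L) ≃ₗ[Mero] (Mero ⊗[ℂ] L)}
    (hg : ∀ X Y, g ⁅X, Y⁆ = ⁅g X, g Y⁆) (hh : ∀ X Y, h ⁅X, Y⁆ = ⁅h X, h Y⁆) (A : Mero ⊗[ℂ] L) :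
    gauge (g * h) A = gauge g (gauge h A) := by
  rw [gauge, gauge, gauge, logDer_mul hg hh, map_sub, LinearEquiv.mul_apply]
  abel

lemma gauge_mem {g : (Mero ⊗[ℂ] L) ≃ₗ[Mero] (Mero ⊗[ℂ] L)} (hg : g ∈ unipM B)
    {v : Mero ⊗[ℂ] L} (hv : v ∈ (borel B).baseChange Mero) :
    gauge g ((1 : Mero) ⊗ₜ[ℂ] pMinus B + v) - (1 : Mero) ⊗ₜ[ℂ] pMinus B ∈
      (borel B).baseChange Mero := by
  have hle : ∀ X ∈ (nPos B).baseChange Mero, X ∈ (borel B).baseChange Mero := fun X hX =>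
    mem_baseChange.2 fun k => nPos_le_borel B (mem_baseChange.1 hX k)
  have h1 := hle _ (unipM_sub_mem B hg hv)
  have h2 := sub_mem (add_mem (add_mem (unipM_pMinus B hg) h1) hv) (logDer_mem B hg)
  have : gauge g ((1 : Mero) ⊗ₜ[ℂ] pMinus B + v) - (1 : Mero) ⊗ₜ[ℂ] pMinus B =
      g ((1 : Mero) ⊗ₜ[ℂ] pMinus B) - (1 : Mero) ⊗ₜ[ℂ] pMinus B + (g v - v) + v - logDer g := by
    rw [gauge, map_add]; abel
  rw [this]
  exact h2

end Gauge

section Opers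

variable {ι : Type*} [Fintype ι] {L : Type*} [LieRing L] [LieAlgebra ℂ L] [FiniteDimensional ℂ L]
  {H : LieSubalgebra ℂ L}

/-- `Ω(𝔭)`, the `𝔭`-valued meromorphic differentials `A dt`, each represented by `A ∈ 𝔤(ℳ)`. -/
def diff (p : Submodule ℂ L) : Submodule Mero (Mero ⊗[ℂ] L) := p.baseChange Mero

/-- The set `op_𝔤(ℙ¹)` of connections `d + p₋₁ dt + v dt` with `v dt ∈ Ω(𝔟)`. -/
@[ext] structure PreOper (B : LieAlgebra.Basis ι H) where
  /-- The component in `Ω(𝔟)`. -/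
  v : Mero ⊗[ℂ] L
  mem : v ∈ diff (borel B)

/-- The connection form `p₋₁ + v`. -/
def PreOper.form {B : LieAlgebra.Basis ι H} (D : PreOper B) : Mero ⊗[ℂ] L :=
  (1 : Mero) ⊗ₜ[ℂ] pMinus B + D.v

/-- The action of `ω` on `𝔤(ℳ)`: `ς̂(f ⊗ X) = f(ω⁻¹ t) ⊗ ς(X)`. -/
def hat (σ : L ≃ₗ⁅ℂ⁆ L) (ω : ℂˣ) : (Mero ⊗[ℂ] L) ≃ₗ[ℂ] (Mero ⊗[ℂ] L) :=
  TensorProduct.congr (Mero.act ω).toLinearEquiv σ.toLinearEquiv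

/-- The action of `ω` on `Ω(𝔤)`: since `dt` is pulled back to `d(ω⁻¹ t) = ω⁻¹ dt`, this is
`A dt ↦ ω⁻¹ ς̂(A) dt`. -/
def hatDiff (σ : L ≃ₗ⁅ℂ⁆ L) (ω : ℂˣ) (A : Mero ⊗[ℂ] L) : Mero ⊗[ℂ] L :=
  ((ω⁻¹ : ℂˣ) : ℂ) • hat σ ω A

/-- `Ω^ς̂(𝔭)`, the cyclotomic `𝔭`-valued meromorphic differentials. -/
def cycDiff (σ : L ≃ₗ⁅ℂ⁆ L) (ω : ℂˣ) (p : Submodule ℂ L) : Set (Mero ⊗[ℂ] L) :=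
  {A | A ∈ diff p ∧ hatDiff σ ω A = A}

/-- `N^ς̂(ℳ)`, the group of `Γ`-invariant elements of `N(ℳ)`. On automorphisms of `𝔤(ℳ)`, the
action of `ω` is the conjugation by `ς̂`. -/
def cycUnipM (B : LieAlgebra.Basis ι H) (σ : L ≃ₗ⁅ℂ⁆ L) (ω : ℂˣ) :
    Subgroup ((Mero ⊗[ℂ] L) ≃ₗ[Mero] (Mero ⊗[ℂ] L)) :=
  unipM B ⊓
    { carrier := {g | ∀ X, hat σ ω (g X) = g (hat σ ω X)}
      one_mem' := fun _ => rfl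
      mul_mem' := fun {g h} hg hh X => by
        rw [LinearEquiv.mul_apply, LinearEquiv.mul_apply, hg, hh]
      inv_mem' := fun {g} hg X => by
        refine g.injective ?_
        rw [← hg]
        change hat σ ω (g (g.symm X)) = g (g.symm _)
        simp }

/-- The set `op^Γ_𝔤(ℙ¹)` of connections `d + p₋₁ dt + v dt` with `v dt ∈ Ω^ς̂(𝔟)`, where
`ς = Ad_{ω^{-ρ̌}} ∘ ν`. -/
@[ext] structure CycPreOper (B : LieAlgebra.Basis ι H) [LieAlgebra.IsSemisimple ℂ L]
    (ν : Equiv.Perm ι) (hν : ∀ i j, B.A (ν i) (ν j) = B.A i j) (ω : ℂˣ) where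
  /-- The component in `Ω^ς̂(𝔟)`. -/
  v : Mero ⊗[ℂ] L
  mem : v ∈ cycDiff (cycAut B ν hν ω) ω (borel B)

variable [LieAlgebra.IsSemisimple ℂ L]

/-- The gauge action of `N(ℳ)` on `op_𝔤(ℙ¹)`. -/
instance (B : LieAlgebra.Basis ι H) : MulAction (unipM B) (PreOper B) where
  smul g D := ⟨gauge g.1 ((1 : Mero) ⊗ₜ[ℂ] pMinus B + D.v) - (1 : Mero) ⊗ₜ[ℂ] pMinus B,
    gauge_mem B g.2 D.mem⟩
  one_smul D := by
    ext1
    change gauge 1 _ - _ = _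
    rw [gauge_one]; abel
  mul_smul g h D := by
    ext1
    change gauge (g.1 * h.1) _ - _ = gauge g.1 (_ + (gauge h.1 _ - _)) - _
    rw [gauge_mul (unipM_lie B g.2) (unipM_lie B h.2)]
    congr 2
    abel

lemma hat_lie (σ : L ≃ₗ⁅ℂ⁆ L) (ω : ℂˣ) (X Y : Mero ⊗[ℂ] L) :
    hat σ ω ⁅X, Y⁆ = ⁅hat σ ω X, hat σ ω Y⁆ := by
  induction X with
  | zero => simp
  | add a b ha hb => simp only [add_lie, map_add, ha, hb]
  | tmul r x =>
    induction Y with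
    | zero => simp
    | add a b ha hb => simp only [lie_add, map_add, ha, hb]
    | tmul s y => simp [hat, LieAlgebra.ExtendScalars.bracket_tmul, LieEquiv.map_lie]

lemma dOp_hat (σ : L ≃ₗ⁅ℂ⁆ L) (ω : ℂˣ) (X : Mero ⊗[ℂ] L) :
    dOp (hat σ ω X) = ((ω⁻¹ : ℂˣ) : ℂ) • hat σ ω (dOp X) := by
  induction X with
  | zero => simp
  | add a b ha hb => simp only [map_add, ha, hb, smul_add]
  | tmul r x => simp [hat, dOp, Mero.d_act, TensorProduct.smul_tmul']

lemma hatDiff_logDer {σ : L ≃ₗ⁅ℂ⁆ L} {ω : ℂˣ} {g : (Mero ⊗[ℂ] L) ≃ₗ[Mero] (Mero ⊗[ℂ] L)}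
    (hg : ∀ X Y, g ⁅X, Y⁆ = ⁅g X, g Y⁆) (hσ : ∀ X, hat σ ω (g X) = g (hat σ ω X)) :
    hatDiff σ ω (logDer g) = logDer g := by
  have hinv : ∀ y, g (g⁻¹ y) = y := fun y => g.apply_symm_apply y
  have hσ' : ∀ X, hat σ ω (g⁻¹ X) = g⁻¹ (hat σ ω X) := fun X =>
    g.injective (by rw [← hσ, hinv, hinv])
  have hsm : ∀ (c : ℂ) X, g (c • X) = c • g X := fun c X =>
    (g.toLinearMap.restrictScalars ℂ).map_smul c X
  refine eq_of_lie fun X => ?_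
  obtain ⟨Y, rfl⟩ := (hat σ ω).surjective X
  rw [hatDiff, smul_lie, ← hat_lie, logDer_spec hg, logDer_spec hg, dOp_hat, ← hσ', dOp_hat,
    hsm, ← hσ, map_sub, smul_sub]

lemma cyc_gauge_mem (B : LieAlgebra.Basis ι H) (ν : Equiv.Perm ι)
    (hν : ∀ i j, B.A (ν i) (ν j) = B.A i j) (ω : ℂˣ)
    {g : (Mero ⊗[ℂ] L) ≃ₗ[Mero] (Mero ⊗[ℂ] L)} (hg : g ∈ cycUnipM B (cycAut B ν hν ω) ω)
    {v : Mero ⊗[ℂ] L} (hv : v ∈ cycDiff (cycAut B ν hν ω) ω (borel B)) :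
    gauge g ((1 : Mero) ⊗ₜ[ℂ] pMinus B + v) - (1 : Mero) ⊗ₜ[ℂ] pMinus B ∈
      cycDiff (cycAut B ν hν ω) ω (borel B) := by
  have hp : hatDiff (cycAut B ν hν ω) ω ((1 : Mero) ⊗ₜ[ℂ] pMinus B) = 1 ⊗ₜ[ℂ] pMinus B := by
    have h1 : cycAut B ν hν ω (pMinus B) = (ω : ℂ) • pMinus B := by
      rw [pMinus, map_sum]
      simp only [cycAut_f]
      rw [← Finset.smul_sum, Equiv.sum_comp ν B.f]
    rw [hatDiff]
    simp [hat, h1, TensorProduct.tmul_smul, smul_smul]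
  have hlin : ∀ X Y, hatDiff (cycAut B ν hν ω) ω (X + Y) =
      hatDiff (cycAut B ν hν ω) ω X + hatDiff (cycAut B ν hν ω) ω Y := fun X Y => by
    simp only [hatDiff, map_add, smul_add]
  have hlin' : ∀ X Y, hatDiff (cycAut B ν hν ω) ω (X - Y) =
      hatDiff (cycAut B ν hν ω) ω X - hatDiff (cycAut B ν hν ω) ω Y := fun X Y => by
    simp only [hatDiff, map_sub, smul_sub]
  have hcomm : ∀ X, hatDiff (cycAut B ν hν ω) ω (g X) = g (hatDiff (cycAut B ν hν ω) ω X) :=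
    fun X => by
      rw [hatDiff, hatDiff, hg.2]
      exact ((g.toLinearMap.restrictScalars ℂ).map_smul _ _).symm
  refine ⟨gauge_mem B hg.1 hv.1, ?_⟩
  rw [hlin', hp, gauge, hlin', hcomm, hlin, hp, hv.2,
    hatDiff_logDer (unipM_lie B hg.1) hg.2]

/-- The gauge action of `N^ς̂(ℳ)` on `op^Γ_𝔤(ℙ¹)`. -/
instance (B : LieAlgebra.Basis ι H) (ν : Equiv.Perm ι)
    (hν : ∀ i j, B.A (ν i) (ν j) = B.A i j) (ω : ℂˣ) :
    MulAction (cycUnipM B (cycAut B ν hν ω) ω) (CycPreOper B ν hν ω) where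
  smul g D := ⟨gauge g.1 ((1 : Mero) ⊗ₜ[ℂ] pMinus B + D.v) - (1 : Mero) ⊗ₜ[ℂ] pMinus B,
    cyc_gauge_mem B ν hν ω g.2 D.mem⟩
  one_smul D := by
    ext1
    change gauge 1 _ - _ = _
    rw [gauge_one]; abel
  mul_smul g h D := by
    ext1
    change gauge (g.1 * h.1) _ - _ = gauge g.1 (_ + (gauge h.1 _ - _)) - _
    rw [gauge_mul (unipM_lie B g.2.1) (unipM_lie B h.2.1)]
    congr 2
    abel

/-- The `𝔤`-opers `Op_𝔤(ℙ¹) = op_𝔤(ℙ¹) / N(ℳ)`. -/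
def Oper (B : LieAlgebra.Basis ι H) : Type _ :=
  MulAction.orbitRel.Quotient (unipM B) (PreOper B)

/-- The class `[∇]` of a connection. -/
def PreOper.cls {B : LieAlgebra.Basis ι H} (D : PreOper B) : Oper B :=
  Quotient.mk (MulAction.orbitRel (unipM B) (PreOper B)) D

/-- The cyclotomic `𝔤`-opers `Op^Γ_𝔤(ℙ¹) = op^Γ_𝔤(ℙ¹) / N^ς̂(ℳ)`. -/
def CyclotomicOper (B : LieAlgebra.Basis ι H) (ν : Equiv.Perm ι)
    (hν : ∀ i j, B.A (ν i) (ν j) = B.A i j) (ω : ℂˣ) : Type _ :=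
  MulAction.orbitRel.Quotient (cycUnipM B (cycAut B ν hν ω) ω) (CycPreOper B ν hν ω)

/-- The class `[∇]_Γ` of a cyclotomic connection. -/
def CycPreOper.cls {B : LieAlgebra.Basis ι H} {ν : Equiv.Perm ι}
    {hν : ∀ i j, B.A (ν i) (ν j) = B.A i j} {ω : ℂˣ} (D : CycPreOper B ν hν ω) :
    CyclotomicOper B ν hν ω :=
  Quotient.mk (MulAction.orbitRel (cycUnipM B (cycAut B ν hν ω) ω) (CycPreOper B ν hν ω)) D

end Opers

end CycOper

end

/-! The proof runs degree by degree in the principal grading of `𝔤`, the grading by eigenvalues of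
`ad ρ̌`. Here `p₁` and `p₋₁` have degrees `1` and `-1`, `𝔟` lies in degrees at least `0`, and `[p₁,
p₋₁] = 2ρ̌`. The linear input is that `ad p₁ ∘ ad p₋₁` is injective on every piece of positive
degree (`eq_zero_of_lie_pPlus_lie_pMinus_eq`). So a nonzero `z` of positive degree never has `[p₋₁,
z]` in `𝔞`, and in finite dimension every element of degree `k ≥ 0` is the sum of an element of `𝔞`
and some `[p₋₁, z]` with `z` of degree `k + 1` (`exists_sub_lie_mem_cent`).

Let `g` in `N(ℳ)` act as `1 + ad Z` modulo terms raising the degree by more than `m`, with `Z` of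
degree at least `m ≥ 1`. Then `dg g⁻¹` has degree at least `m`, so the gauge transformation changes
the connection by `[Z, p₋₁]` up to degree at least `m` (`gauge_sub_mem_filR`).

Existence: choosing `Z` to cancel the part outside `𝔞` pushes the error up one degree, and the
grading is finite (`exists_gauge_mem_cent`). This requires every `Z` of degree `m` to be a leading
term, which products of root subgroup elements provide (`exists_isLead`).

Uniqueness: if `g` carries one canonical form to another, its leading term `Z` satisfies `[p₁, [p₋₁,
Z]] = 0` to leading order, so that term vanishes. Hence `g` is `1` to every order, that is `g = 1`
(`eq_one_of_gauge_eq`). Freeness follows: conjugating a stabiliser element by the gauge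
transformation to canonical form gives an element fixing a canonical form.

The cyclotomic case needs no second construction. If `g` brings an invariant connection to canonical
form, so does its transform `ς̂(g)`, because `ς̂` preserves `𝔞`-valued differentials. Uniqueness
gives `ς̂(g) = g` (`exists_cyc_gauge_mem_cent`). -/

open scoped TensorProduct

noncomputable section

namespace CycOper

/-! ### The principal grading and the operator `ad p₁ ∘ ad p₋₁`. -/

section Height

variable {ι : Type*} [Fintype ι] {L : Type*} [LieRing L] [LieAlgebra ℂ L]
  {H : LieSubalgebra ℂ L} (B : LieAlgebra.Basis ι H)

lemma isUnit_det_cartan [DecidableEq ι] : IsUnit (B.A.map (Int.cast : ℤ → ℂ)).det := by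
  have h : ((Int.castRingHom ℂ).mapMatrix B.A).det ≠ 0 := by
    rw [← RingHom.map_det]
    simpa using B.nondegen.det_ne_zero
  exact isUnit_iff_ne_zero.2 h

lemma rhoCoeff_spec (j : ι) : ∑ i, (B.A j i : ℂ) * rhoCoeff B i = 2 := by
  classical
  have h : (B.A.map (Int.cast : ℤ → ℂ)).mulVec (rhoCoeff B) = fun _ => 2 := by
    rw [rhoCoeff, Matrix.mulVec_mulVec, Matrix.mul_nonsing_inv _ (isUnit_det_cartan B),
      Matrix.one_mulVec]
  exact congrFun h j

/-- The Cartan matrix is invertible. Uniqueness is what transports the coefficients along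
symmetries: the swap of `e` and `f`, and the diagram automorphism `ν`. -/
lemma rhoCoeff_unique {c : ι → ℂ} (hc : ∀ j, ∑ i, (B.A j i : ℂ) * c i = 2) : c = rhoCoeff B := by
  classical
  refine Matrix.mulVec_injective_of_isUnit
    ((Matrix.isUnit_iff_isUnit_det _).2 (isUnit_det_cartan B)) ?_
  ext j
  exact (hc j).trans (rhoCoeff_spec B j).symm

/-- The element `ρ̌` of the Cartan subalgebra. -/
def rho : L := ∑ i, (rhoCoeff B i / 2) • B.h i

lemma rho_mem : rho B ∈ H :=
  H.toSubmodule.sum_mem fun i _ => H.toSubmodule.smul_mem _ (B.h' i).2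

lemma baseSupp_rho (j : ι) : B.baseSupp j ⟨rho B, rho_mem B⟩ = 1 := by
  have h : (⟨rho B, rho_mem B⟩ : H) = ∑ i, (rhoCoeff B i / 2) • B.h' i := by
    ext
    simp [rho, LieAlgebra.Basis.h']
  rw [h, map_sum]
  simp only [map_smul, LieAlgebra.Basis.baseSupp_apply_h', smul_eq_mul]
  have h2 := rhoCoeff_spec B j
  calc _ = (∑ i, (B.A j i : ℂ) * rhoCoeff B i) / 2 := by
        rw [Finset.sum_div]; exact Finset.sum_congr rfl fun i _ => by ring
    _ = 1 := by rw [h2]; norm_num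

/-- The elements of degree `j` in the principal grading, where `ρ̌` acts by `j`. -/
def height (j : ℤ) : Submodule ℂ L := (LieAlgebra.ad ℂ L (rho B)).eigenspace (j : ℂ)

/-- The elements of degree at least `j` in the principal grading. -/
def fil (j : ℤ) : Submodule ℂ L := ⨆ (i : ℤ) (_ : j ≤ i), height B i

variable {B}

lemma mem_height {j : ℤ} {x : L} : x ∈ height B j ↔ ⁅rho B, x⁆ = (j : ℂ) • x := by
  rw [height, Module.End.mem_eigenspace_iff, LieAlgebra.ad_apply]

lemma height_le_fil {i j : ℤ} (h : j ≤ i) : height B i ≤ fil B j :=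
  le_iSup₂_of_le i h le_rfl

lemma fil_antitone {i j : ℤ} (h : j ≤ i) : fil B i ≤ fil B j :=
  iSup₂_le fun _ hk => height_le_fil (h.trans hk)

lemma fil_eq (j : ℤ) : fil B j = height B j ⊔ fil B (j + 1) := by
  refine le_antisymm (iSup₂_le fun i hi => ?_)
    (sup_le (height_le_fil le_rfl) (fil_antitone (by lia)))
  rcases hi.eq_or_lt with rfl | hi
  · exact le_sup_left
  · exact le_sup_of_le_right (height_le_fil hi)

lemma lie_mem_height {i j : ℤ} {x y : L} (hx : x ∈ height B i) (hy : y ∈ height B j) :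
    ⁅x, y⁆ ∈ height B (i + j) := by
  rw [mem_height] at *
  rw [leibniz_lie, hx, hy, smul_lie, lie_smul, ← add_smul]
  push_cast
  rfl

lemma fil_le_comap {j k : ℤ} {f : L →ₗ[ℂ] L}
    (h : ∀ i, j ≤ i → ∀ x ∈ height B i, f x ∈ fil B k) : fil B j ≤ (fil B k).comap f :=
  iSup₂_le fun i hi x hx => h i hi x hx

lemma lie_mem_fil {i j : ℤ} {x y : L} (hx : x ∈ fil B i) (hy : y ∈ fil B j) :
    ⁅x, y⁆ ∈ fil B (i + j) := by
  refine fil_le_comap (f := LieAlgebra.ad ℂ L x) (fun l hl v hv => ?_) hy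
  -- The bracket is rewritten as `ad v` applied to `-x`, so that the criterion for linear maps
  -- applies in the other variable too.
  rw [LieAlgebra.ad_apply, ← lie_skew, ← lie_neg]
  refine fil_le_comap (f := LieAlgebra.ad ℂ L v) (k := i + j) (fun k hk u hu => ?_)
    (neg_mem hx)
  rw [LieAlgebra.ad_apply, ← lie_skew]
  exact neg_mem (height_le_fil (add_le_add hk hl) (lie_mem_height hu hv))

/-- The eigenvalue equation for `ρ̌` on the quotient of consecutive filtration steps. Only
filtrations enter, which makes it usable for non-homogeneous elements after base change. -/
lemma lie_rho_sub_mem {j : ℤ} {x : L} (hx : x ∈ fil B j) :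
    ⁅rho B, x⁆ - (j : ℂ) • x ∈ fil B (j + 1) := by
  rw [fil_eq] at hx
  obtain ⟨y, hy, z, hz, rfl⟩ := Submodule.mem_sup.1 hx
  rw [lie_add, mem_height.1 hy, smul_add, add_sub_add_left_eq_sub]
  refine sub_mem ?_ (Submodule.smul_mem _ _ hz)
  refine fil_le_comap (f := LieAlgebra.ad ℂ L (rho B)) (fun k hk u hu => ?_) hz
  rw [LieAlgebra.ad_apply, mem_height.1 hu]
  exact Submodule.smul_mem _ _ (height_le_fil hk hu)

variable (B)

lemma iSupIndep_height : iSupIndep (height B) :=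
  (Module.End.eigenspaces_iSupIndep _).comp (fun _ _ h => Int.cast_injective h)

lemma disjoint_height_of_ne (m : ℤ) : Disjoint (height B m) (⨆ (j : ℤ) (_ : j ≠ m), height B j) :=
  iSupIndep_height B m

lemma disjoint_height_fil {m j : ℤ} (h : m < j) : Disjoint (height B m) (fil B j) :=
  (disjoint_height_of_ne B m).mono_right
    (iSup₂_le fun i hi => le_iSup₂_of_le i (by lia) le_rfl)

lemma e_mem_height (i : ι) : B.e i ∈ height B 1 := by
  rw [mem_height]
  have := B.baseSupp_apply_smul_e i ⟨rho B, rho_mem B⟩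
  rw [baseSupp_rho] at this
  simpa using this.symm

lemma f_mem_height (i : ι) : B.f i ∈ height B (-1) := by
  rw [mem_height]
  have := B.baseSupp_apply_smul_f i ⟨rho B, rho_mem B⟩
  rw [baseSupp_rho, one_smul] at this
  simpa using (congrArg Neg.neg this).symm

lemma pPlus_mem_height : pPlus B ∈ height B 1 :=
  Submodule.sum_mem _ fun i _ => Submodule.smul_mem _ _ (e_mem_height B i)

lemma pMinus_mem_height : pMinus B ∈ height B (-1) :=
  Submodule.sum_mem _ fun i _ => f_mem_height B i

lemma lie_pPlus_pMinus : ⁅pPlus B, pMinus B⁆ = (2 : ℂ) • rho B := by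
  classical
  rw [pPlus, pMinus, sum_lie, rho, Finset.smul_sum]
  refine Finset.sum_congr rfl fun i _ => ?_
  rw [lie_sum, Finset.sum_eq_single i, smul_lie, (B.sl2 i).lie_e_f, smul_smul]
  · congr 1; ring
  · intro j _ hj
    rw [smul_lie, B.lie_e_f_ne i j hj.symm, smul_zero]
  · simp

lemma rho_mem_height : rho B ∈ height B 0 := by
  rw [mem_height]; simp

lemma cartan_le_height : H.toSubmodule ≤ height B 0 := by
  have := B.isLieAbelian_cartan
  intro x hx
  rw [mem_height]
  have h := congrArg Subtype.val (trivial_lie_zero H H ⟨rho B, rho_mem B⟩ ⟨x, hx⟩)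
  simpa using h

/-- The Chevalley generators are homogeneous and the filtration is multiplicative, so
diagonalisability of `ad ρ̌` is not needed as an input. -/
lemma exists_mem_fil (x : L) : ∃ j, x ∈ fil B j := by
  have hx : x ∈ LieSubalgebra.lieSpan ℂ L (Set.range B.e ∪ Set.range B.f) := by
    rw [B.span_ef]; trivial
  induction hx using LieSubalgebra.lieSpan_induction with
  | mem u hu =>
    obtain ⟨i, rfl⟩ | ⟨i, rfl⟩ := hu
    · exact ⟨1, height_le_fil le_rfl (e_mem_height B i)⟩
    · exact ⟨-1, height_le_fil le_rfl (f_mem_height B i)⟩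
  | zero => exact ⟨0, zero_mem _⟩
  | add u v _ _ hu hv =>
    obtain ⟨⟨j, hj⟩, ⟨k, hk⟩⟩ := hu, hv
    exact ⟨min j k, add_mem (fil_antitone (min_le_left _ _) hj)
      (fil_antitone (min_le_right _ _) hk)⟩
  | smul t u _ hu =>
    obtain ⟨j, hj⟩ := hu
    exact ⟨j, Submodule.smul_mem _ _ hj⟩
  | lie u v _ _ hu hv =>
    obtain ⟨⟨j, hj⟩, ⟨k, hk⟩⟩ := hu, hv
    exact ⟨j + k, lie_mem_fil hj hk⟩

lemma lie_pPlus_lie_pMinus_mem {m : ℤ} {w : L} (hw : w ∈ height B m) :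
    ⁅pPlus B, ⁅pMinus B, w⁆⁆ ∈ height B m := by
  have := lie_mem_height (pPlus_mem_height B) (lie_mem_height (pMinus_mem_height B) hw)
  rwa [show 1 + (-1 + m) = m by lia] at this

/-- Exchanging `e` and `f` negates the coroots and keeps the Cartan matrix. This lets statements
about `𝔫` be read off for the opposite nilpotent subalgebra. -/
lemma symm_rho : rho B.symm = - rho B := by
  have h : rhoCoeff B.symm = rhoCoeff B := rhoCoeff_unique B (rhoCoeff_spec B.symm)
  simp [rho, h]

variable [FiniteDimensional ℂ L]

/-- An independent family of subspaces of a finite-dimensional space has only finitely many nonzero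
members; beyond the largest degree in absolute value nothing is left. -/
lemma exists_height_bound : ∃ N : ℕ, fil B N = ⊥ ∧ fil B (-N) = ⊤ := by
  have hfin := WellFoundedGT.finite_ne_bot_of_iSupIndep (iSupIndep_height B)
  obtain ⟨b, hb⟩ := (hfin.image Int.natAbs).bddAbove
  have hbot : ∀ i : ℤ, b < i.natAbs → height B i = ⊥ := by
    intro i hi
    by_contra h
    exact absurd (hb ⟨i, h, rfl⟩) (not_le.2 hi)
  refine ⟨b + 1, ?_, ?_⟩
  · rw [eq_bot_iff]
    exact iSup₂_le fun i hi => (hbot i (by lia)).le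
  · rw [eq_top_iff]
    rintro x -
    obtain ⟨j, hj⟩ := exists_mem_fil B x
    refine (iSup₂_le fun i _ => ?_ : fil B j ≤ _) hj
    by_cases h : -((b + 1 : ℕ) : ℤ) ≤ i
    · exact height_le_fil h
    · rw [hbot i (by lia)]; exact bot_le

/-- The eigenvalues of `ad p₁ ∘ ad p₋₁` on the part of positive degree are positive. -/
lemma eq_zero_of_lie_pPlus_lie_pMinus_eq {m : ℤ} (hm : 1 ≤ m) {c : ℤ} (hc : c ≤ 0) {w : L}
    (hw : w ∈ height B m) (h : ⁅pPlus B, ⁅pMinus B, w⁆⁆ = (c : ℂ) • w) : w = 0 := by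
  obtain ⟨N, hN, -⟩ := exists_height_bound B
  -- Downward induction on the degree: `n` bounds the distance from `m` to the degree `N`, from
  -- which on everything vanishes.
  obtain ⟨n, hn⟩ : ∃ n : ℕ, (N : ℤ) ≤ m + n := ⟨N, by lia⟩
  induction n generalizing m c w with
  | zero =>
    have := height_le_fil (show (N : ℤ) ≤ m by lia) hw
    rwa [hN, Submodule.mem_bot] at this
  | succ n ih =>
    -- Since `[p₁, p₋₁] = 2ρ̌` acts on degree `m` by `2m`, exchanging the two operators lowers the
    -- eigenvalue by `2m`.
    have h1 : ⁅pMinus B, ⁅pPlus B, w⁆⁆ = ((c - 2 * m : ℤ) : ℂ) • w := by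
      have h2 := leibniz_lie (pPlus B) (pMinus B) w
      rw [h, lie_pPlus_pMinus, smul_lie, mem_height.1 hw, ← sub_eq_iff_eq_add'] at h2
      rw [← h2]
      push_cast
      rw [sub_smul, smul_smul]
    -- The vector `[p₁, w]` is again an eigenvector, one degree higher and with the still
    -- nonpositive eigenvalue `c - 2m`. This is why eigenvalues `c ≤ 0`, and not only `0`, are
    -- carried through the induction. Then `(c - 2m) w = 0` forces `w = 0`.
    have h3 : ⁅pPlus B, w⁆ = 0 := by
      refine ih (m := m + 1) (c := c - 2 * m) (by lia) (by lia)
        (add_comm 1 m ▸ lie_mem_height (pPlus_mem_height B) hw) ?_ (by lia)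
      rw [h1, lie_smul]
    rw [h3, lie_zero] at h1
    exact (smul_eq_zero.1 h1.symm).resolve_left (Int.cast_ne_zero.2 (by lia))

/-- Injectivity of `ad p₁ ∘ ad p₋₁` applied to the lowest component of `w`. The uniqueness argument
uses it to raise the order of a leading term. -/
lemma mem_fil_of_lie_pPlus_lie_pMinus_mem {m : ℤ} (hm : 1 ≤ m) {w : L} (hw : w ∈ fil B m)
    (h : ⁅pPlus B, ⁅pMinus B, w⁆⁆ ∈ fil B (m + 1)) : w ∈ fil B (m + 1) := by
  rw [fil_eq] at hw
  obtain ⟨y, hy, z, hz, rfl⟩ := Submodule.mem_sup.1 hw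
  have hz' : ⁅pPlus B, ⁅pMinus B, z⁆⁆ ∈ fil B (m + 1) := by
    have := lie_mem_fil (height_le_fil le_rfl (pPlus_mem_height B))
      (lie_mem_fil (height_le_fil le_rfl (pMinus_mem_height B)) hz)
    rwa [show 1 + (-1 + (m + 1)) = m + 1 by lia] at this
  rw [lie_add, lie_add] at h
  have h0 := Submodule.disjoint_def.1 (disjoint_height_fil B (show m < m + 1 by lia)) _
    (lie_pPlus_lie_pMinus_mem B hy) (by simpa using sub_mem h hz')
  rw [eq_zero_of_lie_pPlus_lie_pMinus_eq B hm le_rfl hy (by simpa using h0), zero_add]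
  exact hz

/-- The decomposition `𝔟_k = 𝔞_k ⊕ [p₋₁, 𝔫_{k+1}]`. -/
lemma exists_sub_lie_mem_cent {k : ℤ} (hk : 0 ≤ k) {y : L} (hy : y ∈ height B k) :
    ∃ z ∈ height B (k + 1), y - ⁅pMinus B, z⁆ ∈ cent B := by
  -- This endomorphism of a finite-dimensional space is injective, hence surjective, so `[p₁, [p₋₁,
  -- z]] = [p₁, y]` can be solved for `z`.
  let φ : height B (k + 1) →ₗ[ℂ] height B (k + 1) :=
    (LieAlgebra.ad ℂ L (pPlus B) ∘ₗ LieAlgebra.ad ℂ L (pMinus B)).restrict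
      fun _ hw => lie_pPlus_lie_pMinus_mem B hw
  have hinj : Function.Injective φ := by
    rw [injective_iff_map_eq_zero]
    rintro ⟨w, hw⟩ h
    have h0 : ⁅pPlus B, ⁅pMinus B, w⁆⁆ = 0 := congrArg Subtype.val h
    exact Subtype.ext (eq_zero_of_lie_pPlus_lie_pMinus_eq B (by lia) le_rfl hw (by simpa using h0))
  obtain ⟨⟨z, hz⟩, h⟩ := LinearMap.injective_iff_surjective.1 hinj
    ⟨⁅pPlus B, y⁆, add_comm 1 k ▸ lie_mem_height (pPlus_mem_height B) hy⟩
  refine ⟨z, hz, ?_⟩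
  have h' : ⁅pPlus B, ⁅pMinus B, z⁆⁆ = ⁅pPlus B, y⁆ := congrArg Subtype.val h
  rw [cent, LinearMap.mem_ker, LieAlgebra.ad_apply, lie_sub, h', sub_self]

variable [LieAlgebra.IsSemisimple ℂ L]

/-- Root spaces are defined as generalised weight spaces; semisimplicity makes the Cartan subalgebra
act on them by honest scalars. -/
lemma lie_of_mem_rootSp {k : ι → ℕ} {x : L} (hx : x ∈ rootSp B k) (h : H) :
    ⁅(h : L), x⁆ = (∑ i, k i • B.baseSupp i) h • x := by
  have := B.isLieAbelian_cartan
  have := B.isCartanSubalgebra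
  have := LieAlgebra.IsKilling.lie_eq_smul_of_mem_rootSpace (H := H) hx h
  simpa using this

lemma rootSp_le_height (k : ι → ℕ) : rootSp B k ≤ height B (∑ i, k i : ℕ) := by
  intro x hx
  rw [mem_height]
  have := lie_of_mem_rootSp B hx ⟨rho B, rho_mem B⟩
  rw [this, LinearMap.sum_apply]
  simp [baseSupp_rho]

lemma nPos_le_fil : nPos B ≤ fil B 1 := by
  refine iSup₂_le fun k hk => (rootSp_le_height B k).trans (height_le_fil ?_)
  obtain ⟨i, hi⟩ := Function.ne_iff.1 hk
  have : k i ≤ ∑ i, k i := Finset.single_le_sum (fun _ _ => Nat.zero_le _) (Finset.mem_univ i)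
  have : k i ≠ 0 := hi
  lia

lemma borel_le_fil : borel B ≤ fil B 0 :=
  sup_le ((cartan_le_height B).trans (height_le_fil le_rfl))
    ((nPos_le_fil B).trans (fil_antitone (by lia)))

lemma borelLower_le : B.borelLower.toSubmodule ≤ ⨆ (j : ℤ) (_ : j < 0), height B j := by
  have h : B.borelLower.toSubmodule = nPos B.symm := (nPos_eq B.symm).symm
  rw [h]
  refine (nPos_le_fil B.symm).trans (iSup₂_le fun i hi => ?_)
  refine le_iSup₂_of_le (-i) (by lia) fun x hx => ?_
  rw [mem_height, symm_rho, neg_lie] at hx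
  rw [mem_height, Int.cast_neg, neg_smul, ← hx, neg_neg]

/-- The part of positive degree `m` is the sum of the root spaces of the roots of height `m`. -/
lemma height_le_iSup_rootSp {m : ℤ} (hm : 1 ≤ m) :
    height B m ≤ ⨆ k : {k : ι → ℕ // ((∑ i, k i : ℕ) : ℤ) = m}, rootSp B k := by
  set S := ⨆ k : {k : ι → ℕ // ((∑ i, k i : ℕ) : ℤ) = m}, rootSp B k
  set T := ⨆ (j : ℤ) (_ : j ≠ m), height B j
  have hS : S ≤ height B m := iSup_le fun k => by
    have := rootSp_le_height B k.1
    rwa [k.2] at this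
  -- The triangular decomposition puts every summand into `S` or into the part `T` of degrees other
  -- than `m`. As `S` has degree `m`, independence of the degrees then leaves no room in degree `m`
  -- outside `S`.
  have htop : S ⊔ T = ⊤ := by
    have h1 := congrArg LieSubmodule.toSubmodule B.iSup_cartan_borelLower_borelUpper_eq_top
    have h2 : H.toSubmodule ⊔ B.borelLower.toSubmodule ⊔ nPos B = ⊤ := by
      rw [show nPos B = B.borelUpper.toSubmodule from nPos_eq B]
      simpa [← sup_assoc] using h1
    rw [eq_top_iff, ← h2]
    refine sup_le (sup_le ?_ ?_) (iSup₂_le fun k _ => ?_)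
    · exact le_sup_of_le_right ((cartan_le_height B).trans (le_iSup₂_of_le 0 (by lia) le_rfl))
    · exact le_sup_of_le_right ((borelLower_le B).trans
        (iSup₂_le fun j hj => le_iSup₂_of_le j (by lia) le_rfl))
    · by_cases hk : ((∑ i, k i : ℕ) : ℤ) = m
      · exact le_sup_of_le_left (le_iSup (fun k : {k : ι → ℕ // ((∑ i, k i : ℕ) : ℤ) = m} =>
          rootSp B k) ⟨k, hk⟩)
      · exact le_sup_of_le_right ((rootSp_le_height B k).trans (le_iSup₂_of_le _ hk le_rfl))
  intro x hx
  obtain ⟨s, hs, t, ht, rfl⟩ := Submodule.mem_sup.1 (htop ▸ Submodule.mem_top : x ∈ S ⊔ T)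
  have h0 : t = 0 := Submodule.disjoint_def.1 (disjoint_height_of_ne B m) t
    (by simpa using sub_mem hx (hS hs)) ht
  rwa [h0, add_zero]

end Height

/-! ### Points of an algebraic group as automorphisms of `R ⊗ L`. -/

section PointConstruction

/-- The pull back of functions along a map. -/
def funPull {X Y : Type*} (c : X → Y) : (Y → ℂ) →ₐ[ℂ] (X → ℂ) where
  toFun f x := f (c x)
  map_one' := rfl
  map_mul' _ _ := rfl
  map_zero' := rfl
  map_add' _ _ := rfl
  commutes' _ := rfl

/-- Polynomials as functions. -/
def polyFun : Polynomial ℂ →ₐ[ℂ] (ℂ → ℂ) where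
  toFun p z := p.eval z
  map_one' := by ext; simp
  map_mul' _ _ := by ext; simp
  map_zero' := by ext; simp
  map_add' _ _ := by ext; simp
  commutes' _ := by ext; simp

lemma polyFun_injective : Function.Injective polyFun :=
  fun _ _ h => Polynomial.funext fun z => congrFun h z

variable {L : Type*} [LieRing L] [LieAlgebra ℂ L] {R : Type*} [CommRing R] [Algebra ℂ R]

lemma tmul_eq_smul (r : R) (v : L) : (r ⊗ₜ[ℂ] v : R ⊗[ℂ] L) = r • (1 ⊗ₜ[ℂ] v) := by
  simp [TensorProduct.smul_tmul']

/-- A linear condition on `S.baseChange R` may be checked on the elements `1 ⊗ x`. -/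
lemma baseChange_le_comap {S T : Submodule ℂ L} {F : R ⊗[ℂ] L →ₗ[R] R ⊗[ℂ] L}
    (h : ∀ x ∈ S, F (1 ⊗ₜ x) ∈ T.baseChange R) :
    S.baseChange R ≤ (T.baseChange R).comap F := by
  rw [Submodule.baseChange_eq_span, Submodule.span_le]
  rintro _ ⟨x, hx, rfl⟩
  exact h x hx

lemma lie_mem_baseChange {S T U : Submodule ℂ L} (h : ∀ x ∈ S, ∀ y ∈ T, ⁅x, y⁆ ∈ U)
    {X Y : R ⊗[ℂ] L} (hX : X ∈ S.baseChange R) (hY : Y ∈ T.baseChange R) :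
    ⁅X, Y⁆ ∈ U.baseChange R := by
  refine baseChange_le_comap (F := LieAlgebra.ad R _ X) (fun y hy => ?_) hY
  rw [LieAlgebra.ad_apply, mem_baseChange]
  intro k
  rw [comp_lie]
  exact h _ (mem_baseChange.1 hX k) _ hy

/-- The matrix coefficients of the point `χ`. -/
def coefMap (K : Subgroup (L ≃ₗ[ℂ] L)) (χ : regFun K →ₐ[ℂ] R) :
    L →ₗ[ℂ] Module.Dual ℂ L →ₗ[ℂ] R :=
  LinearMap.mk₂ ℂ (fun v ξ => χ (regCoef K ξ v))
    (fun v w ξ => by rw [← map_add]; congr 1; ext φ; simp [regCoef, coef])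
    (fun c v ξ => by rw [← map_smul]; congr 1; ext φ; simp [regCoef, coef])
    (fun v ξ η => by rw [← map_add]; congr 1)
    (fun c v ξ => by rw [← map_smul]; congr 1)

/-- The matrix coefficients of the inverse of the point `χ`. -/
def coefInvMap (K : Subgroup (L ≃ₗ[ℂ] L)) (χ : regFun K →ₐ[ℂ] R) :
    L →ₗ[ℂ] Module.Dual ℂ L →ₗ[ℂ] R :=
  LinearMap.mk₂ ℂ (fun v ξ => χ (regCoefInv K ξ v))
    (fun v w ξ => by rw [← map_add]; congr 1; ext φ; simp [regCoefInv, coefInv])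
    (fun c v ξ => by rw [← map_smul]; congr 1; ext φ; simp [regCoefInv, coefInv])
    (fun v ξ η => by rw [← map_add]; congr 1)
    (fun c v ξ => by rw [← map_smul]; congr 1)

lemma coefMap_apply (K : Subgroup (L ≃ₗ[ℂ] L)) (χ : regFun K →ₐ[ℂ] R) (v : L)
    (ξ : Module.Dual ℂ L) : coefMap K χ v ξ = χ (regCoef K ξ v) := rfl

lemma coefInvMap_apply (K : Subgroup (L ≃ₗ[ℂ] L)) (χ : regFun K →ₐ[ℂ] R) (v : L)
    (ξ : Module.Dual ℂ L) : coefInvMap K χ v ξ = χ (regCoefInv K ξ v) := rfl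

variable [FiniteDimensional ℂ L]

/-- For `ξ` vanishing on `T` and `x` in `S`, the coefficient `φ ↦ ξ (φ x)` is the constant `ξ x` on
`K`. An algebra homomorphism preserves constants, so the congruence passes from `K` to its
`R`-points. -/
lemma sub_mem_baseChange_of_isPoint {K : Subgroup (L ≃ₗ[ℂ] L)} {χ : regFun K →ₐ[ℂ] R}
    {g : (R ⊗[ℂ] L) ≃ₗ[R] (R ⊗[ℂ] L)} (hg : IsPoint K χ g) {S T : Submodule ℂ L}
    (h : ∀ φ ∈ K, ∀ x ∈ S, φ x - x ∈ T) {X : R ⊗[ℂ] L} (hX : X ∈ S.baseChange R) :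
    g X - X ∈ T.baseChange R := by
  refine baseChange_le_comap (F := g.toLinearMap - LinearMap.id) (fun x hx => ?_) hX
  refine mem_baseChange_of_coord fun ξ hξ => ?_
  change coord R ξ (g (1 ⊗ₜ x) - 1 ⊗ₜ x) = 0
  rw [map_sub, ← (hg ξ x).1, regCoef_eq_const (c := ξ x), map_smul, map_one, coord_tmul, sub_self]
  intro φ hφ
  rw [← sub_eq_zero, ← map_sub]
  exact hξ _ (h φ hφ x hx)

/-- The endomorphism of `R ⊗ L` with given matrix coefficients. -/
def ofCoef (m : L →ₗ[ℂ] Module.Dual ℂ L →ₗ[ℂ] R) : R ⊗[ℂ] L →ₗ[R] R ⊗[ℂ] L :=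
  LinearMap.liftBaseChange R (∑ k, (TensorProduct.mk ℂ R L).flip (Module.finBasis ℂ L k) ∘ₗ
    LinearMap.applyₗ ((Module.finBasis ℂ L).coord k) ∘ₗ m)

lemma ofCoef_one_tmul (m : L →ₗ[ℂ] Module.Dual ℂ L →ₗ[ℂ] R) (v : L) :
    ofCoef m (1 ⊗ₜ v) = ∑ k, m v ((Module.finBasis ℂ L).coord k) ⊗ₜ Module.finBasis ℂ L k := by
  simp [ofCoef, LinearMap.sum_apply]

lemma coord_ofCoef (m : L →ₗ[ℂ] Module.Dual ℂ L →ₗ[ℂ] R) (ξ : Module.Dual ℂ L) (v : L) :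
    coord R ξ (ofCoef m (1 ⊗ₜ v)) = m v ξ := by
  rw [ofCoef_one_tmul, map_sum]
  simp only [coord_tmul]
  have h : ξ = ∑ k, ξ (Module.finBasis ℂ L k) • (Module.finBasis ℂ L).coord k :=
    ((Module.finBasis ℂ L).sum_dual_apply_smul_coord ξ).symm
  conv_rhs => rw [h, map_sum]
  simp only [map_smul]

lemma coord_ofCoef_ofCoef (m m' : L →ₗ[ℂ] Module.Dual ℂ L →ₗ[ℂ] R) (ξ : Module.Dual ℂ L) (v : L) :
    coord R ξ (ofCoef m (ofCoef m' (1 ⊗ₜ v))) =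
      ∑ k, m' v ((Module.finBasis ℂ L).coord k) * m (Module.finBasis ℂ L k) ξ := by
  rw [ofCoef_one_tmul, map_sum, map_sum]
  refine Finset.sum_congr rfl fun k _ => ?_
  rw [tmul_eq_smul, map_smul, map_smul, coord_ofCoef, smul_eq_mul]

/-- Every `R`-point of `K` is given by an automorphism of `R ⊗ L`. -/
lemma exists_isPoint (K : Subgroup (L ≃ₗ[ℂ] L)) (χ : regFun K →ₐ[ℂ] R) :
    ∃ φ, IsPoint K χ φ := by
  -- The identity `f f⁻¹ = 1` in matrix coefficients. Read as a relation in `𝒪(K)`, it is carried by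
  -- `χ` to the statement that the two matrices over `R` are inverse to each other.
  have key : ∀ (ξ : Module.Dual ℂ L) (f : L ≃ₗ[ℂ] L) (v : L),
      ξ v = ∑ k, (Module.finBasis ℂ L).coord k (f⁻¹ v) * ξ (f (Module.finBasis ℂ L k)) := by
    intro ξ f v
    have := expand ξ f (f⁻¹ v)
    rw [show f (f⁻¹ v) = v from f.apply_symm_apply v] at this
    rw [this]
    exact Finset.sum_congr rfl fun k _ => mul_comm _ _
  have hconst : ∀ (ξ : Module.Dual ℂ L) (v : L), coord R ξ (1 ⊗ₜ v) = χ (ξ v • 1) := by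
    intro ξ v
    rw [coord_tmul, map_smul, map_one]
  have h1 : ofCoef (coefMap K χ) ∘ₗ ofCoef (coefInvMap K χ) = LinearMap.id := by
    refine eq_of_tmul fun v => ext_coord fun ξ => ?_
    rw [LinearMap.comp_apply, coord_ofCoef_ofCoef, LinearMap.id_apply, hconst]
    simp only [coefMap_apply, coefInvMap_apply, ← map_mul, ← map_sum]
    congr 1
    ext φ
    simp only [regCoef, regCoefInv, AddSubmonoidClass.coe_finsetSum, Finset.sum_apply,
      MulMemClass.coe_mul, Pi.mul_apply]
    refine (key ξ φ.1 v).symm.trans ?_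
    simp
  have h2 : ofCoef (coefInvMap K χ) ∘ₗ ofCoef (coefMap K χ) = LinearMap.id := by
    refine eq_of_tmul fun v => ext_coord fun ξ => ?_
    rw [LinearMap.comp_apply, coord_ofCoef_ofCoef, LinearMap.id_apply, hconst]
    simp only [coefMap_apply, coefInvMap_apply, ← map_mul, ← map_sum]
    congr 1
    ext φ
    simp only [regCoef, regCoefInv, AddSubmonoidClass.coe_finsetSum, Finset.sum_apply,
      MulMemClass.coe_mul, Pi.mul_apply]
    refine Eq.trans ?_ ((key ξ (φ.1)⁻¹ v).symm.trans ?_)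
    · rw [inv_inv]; rfl
    · simp
  exact ⟨LinearEquiv.ofLinearMap _ _ h1 h2, fun ξ v =>
    ⟨(coord_ofCoef (coefMap K χ) ξ v).symm, (coord_ofCoef (coefInvMap K χ) ξ v).symm⟩⟩

/-- A polynomial one-parameter family in `K` may be evaluated at any element `r` of `R`. -/
lemma exists_mem_points {K : Subgroup (L ≃ₗ[ℂ] L)} {n : ℕ} {a b : ℕ → Module.End ℂ L} (φ : ℂ → K)
    (ha : ∀ z v, (φ z : L ≃ₗ[ℂ] L) v = ∑ j ∈ Finset.range n, z ^ j • a j v)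
    (hb : ∀ z v, ((φ z)⁻¹ : L ≃ₗ[ℂ] L) v = ∑ j ∈ Finset.range n, z ^ j • b j v) (r : R) :
    ∃ g ∈ points K R, ∀ v, g (1 ⊗ₜ v) = ∑ j ∈ Finset.range n, r ^ j • (1 ⊗ₜ a j v) := by
  let P : (ℕ → Module.End ℂ L) → Module.Dual ℂ L → L → Polynomial ℂ := fun c ξ v =>
    ∑ j ∈ Finset.range n, Polynomial.C (ξ (c j v)) * Polynomial.X ^ j
  have hP : ∀ c ξ v, polyFun (P c ξ v) = fun z => ξ (∑ j ∈ Finset.range n, z ^ j • c j v) := by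
    intro c ξ v
    ext z
    change (P c ξ v).eval z = _
    rw [Polynomial.eval_finsetSum, map_sum]
    refine Finset.sum_congr rfl fun j _ => ?_
    rw [Polynomial.eval_mul, Polynomial.eval_C, Polynomial.eval_pow, Polynomial.eval_X, map_smul,
      smul_eq_mul, mul_comm]
  have hPa : ∀ ξ v, funPull φ (coef K ξ v) = polyFun (P a ξ v) := fun ξ v => by
    rw [hP]; ext z; rw [← ha]; rfl
  have hPb : ∀ ξ v, funPull φ (coefInv K ξ v) = polyFun (P b ξ v) := fun ξ v => by
    rw [hP]; ext z; rw [← hb]; rfl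
  -- The generators of `𝒪(K)` restrict to polynomials along the family, hence so does all of `𝒪(K)`.
  -- Since polynomials over `ℂ` are determined by their values, this gives a homomorphism from
  -- `𝒪(K)` to `ℂ[X]`, to be followed by evaluation at `r`.
  have hmem : ∀ f : regFun K, (funPull φ).comp (regFun K).val f ∈ polyFun.range := by
    have : regFun K ≤ polyFun.range.comap (funPull φ) := by
      refine Algebra.adjoin_le ?_
      rintro f (⟨ξ, v, rfl⟩ | ⟨ξ, v, rfl⟩)
      · exact ⟨_, (hPa ξ v).symm⟩
      · exact ⟨_, (hPb ξ v).symm⟩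
    exact fun f => this f.2
  let χ : regFun K →ₐ[ℂ] Polynomial ℂ :=
    ((AlgEquiv.ofInjective polyFun polyFun_injective).symm : _ →ₐ[ℂ] _).comp
      (((funPull φ).comp (regFun K).val).codRestrict _ hmem)
  have hχ : ∀ f, polyFun (χ f) = funPull φ f := fun f =>
    congrArg Subtype.val
      ((AlgEquiv.ofInjective polyFun polyFun_injective).apply_symm_apply ⟨_, hmem f⟩)
  obtain ⟨g, hg⟩ := exists_isPoint K ((Polynomial.aeval r).comp χ)
  refine ⟨g, ⟨_, hg⟩, fun v => ext_coord fun ξ => ?_⟩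
  have h1 : χ (regCoef K ξ v) = P a ξ v := polyFun_injective ((hχ _).trans (hPa ξ v))
  rw [← (hg ξ v).1, AlgHom.comp_apply, h1]
  simp only [P, map_sum, map_smul, coord_tmul, map_mul, Polynomial.aeval_C, map_pow,
    Polynomial.aeval_X, Algebra.algebraMap_eq_smul_one, smul_eq_mul, mul_smul_comm, smul_mul_assoc,
    one_mul, mul_one]

end PointConstruction

/-! ### Exponentials, and the elements of `N` as filtered unipotent maps. -/

section Unipotent

variable {ι : Type*} [Fintype ι] {L : Type*} [LieRing L] [LieAlgebra ℂ L]
  {H : LieSubalgebra ℂ L} (B : LieAlgebra.Basis ι H)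

lemma expAd_smul (z : ℂ) (x y : L) : expAd (z • x) y = ∑ j ∈ Finset.range (Module.finrank ℂ L + 1),
    z ^ j • (((j.factorial : ℂ))⁻¹ • (LieAlgebra.ad ℂ L x) ^ j) y := by
  rw [expAd, LinearMap.sum_apply]
  refine Finset.sum_congr rfl fun j _ => ?_
  rw [map_smul, smul_pow, smul_comm, LinearMap.smul_apply]

variable [FiniteDimensional ℂ L]

/-- By Cayley-Hamilton, since the characteristic polynomial is a power of `X`. It identifies the
truncated sum `expAd` with the full exponential series. -/
lemma pow_eq_zero_of_isNilpotent {f : Module.End ℂ L} (hf : IsNilpotent f) :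
    f ^ (Module.finrank ℂ L + 1) = 0 := by
  have h := f.aeval_self_charpoly
  rw [hf.charpoly_eq_X_pow_finrank, map_pow, Polynomial.aeval_X] at h
  rw [pow_succ, h, zero_mul]

/-- Each application raises the degree by at least one, and all degrees lie strictly between `-N`
and `N` or at `-N`, so `2N` applications give zero. -/
lemma isNilpotent_ad {x : L} (hx : x ∈ fil B 1) : IsNilpotent (LieAlgebra.ad ℂ L x) := by
  obtain ⟨N, hN, hN'⟩ := exists_height_bound B
  have h : ∀ (n : ℕ) (y : L), ((LieAlgebra.ad ℂ L x) ^ n) y ∈ fil B (-N + n) := by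
    intro n y
    induction n with
    | zero => simp [hN']
    | succ n ih =>
      rw [pow_succ', Module.End.mul_apply, LieAlgebra.ad_apply]
      have := lie_mem_fil hx ih
      rwa [show (1 : ℤ) + (-N + n) = -N + (n + 1 : ℕ) by push_cast; ring] at this
  refine ⟨2 * N, LinearMap.ext fun y => ?_⟩
  have := h (2 * N) y
  rwa [show (-N + (2 * N : ℕ) : ℤ) = N by push_cast; ring, hN, Submodule.mem_bot] at this

lemma expAd_eq_exp [Module ℚ (Module.End ℂ L)] {x : L}
    (hx : IsNilpotent (LieAlgebra.ad ℂ L x)) :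
    expAd x = IsNilpotent.exp (LieAlgebra.ad ℂ L x) := by
  rw [IsNilpotent.exp_eq_sum (pow_eq_zero_of_isNilpotent hx), expAd]
  refine Finset.sum_congr rfl fun j _ => ?_
  rw [← Rat.cast_smul_eq_qsmul ℂ]
  simp

lemma exists_expAd {x : L} (hx : IsNilpotent (LieAlgebra.ad ℂ L x)) :
    ∃ ψ : L ≃ₗ⁅ℂ⁆ L, ∀ y, ψ y = expAd x y := by
  -- The exponential of a nilpotent derivation is formed with rational coefficients, so the complex
  -- structure is restricted to `ℚ`.
  let : Module ℚ L := Module.compHom L (algebraMap ℚ ℂ)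
  let : LieAlgebra ℚ L := ⟨fun q x y => lie_smul (algebraMap ℚ ℂ q) x y⟩
  have hD : ((LieDerivation.ad ℂ L x : LieDerivation ℂ L L) : L →ₗ[ℂ] L) = LieAlgebra.ad ℂ L x := by
    ext; simp
  have hn : IsNilpotent ((LieDerivation.ad ℂ L x : LieDerivation ℂ L L) : L →ₗ[ℂ] L) := by
    rw [hD]; exact hx
  refine ⟨LieDerivation.exp _ hn, fun y => ?_⟩
  rw [expAd_eq_exp hx, ← hD]
  exact LinearMap.congr_fun (LieDerivation.exp_apply (LieDerivation.ad ℂ L x) hn) y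

lemma expAd_neg_apply {x : L} (hx : IsNilpotent (LieAlgebra.ad ℂ L x)) (y : L) :
    expAd (-x) (expAd x y) = y := by
  let : Module ℚ (Module.End ℂ L) := Module.compHom _ (algebraMap ℚ ℂ)
  have hx' : IsNilpotent (LieAlgebra.ad ℂ L (-x)) := by rw [map_neg]; exact hx.neg
  rw [expAd_eq_exp hx, expAd_eq_exp hx', ← Module.End.mul_apply, map_neg,
    IsNilpotent.exp_neg_mul_exp_self hx]
  rfl

variable {B}

/-- The property holds for exponentials of elements of degree at least `1` and is stable under the
group operations. -/
lemma unip_sub_mem_fil [LieAlgebra.IsSemisimple ℂ L] {φ : L ≃ₗ[ℂ] L} (hφ : φ ∈ unip B) (j : ℤ) :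
    ∀ y ∈ fil B j, φ y - y ∈ fil B (j + 1) := by
  induction hφ using Subgroup.closure_induction generalizing j with
  | mem φ h =>
    obtain ⟨k, hk, x, hx, ψ, rfl, hψ⟩ := h
    have hx1 : x ∈ fil B 1 :=
      nPos_le_fil B ((le_iSup₂_of_le k hk le_rfl : rootSp B k ≤ nPos B) hx)
    intro y hy
    change ψ y - y ∈ _
    rw [hψ]
    refine expAd_sub_mem (fun z hz => fil_antitone ?_ (lie_mem_fil hx1 hz))
      (add_comm 1 j ▸ lie_mem_fil hx1 hy)
    lia
  | one => simp
  | mul φ ψ _ _ h1 h2 =>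
    intro y hy
    have h3 := h2 j y hy
    have h4 := fil_antitone (show j + 1 ≤ j + 1 + 1 by lia) (h1 (j + 1) _ h3)
    have : (φ * ψ) y - y = (φ (ψ y - y) - (ψ y - y)) + (ψ y - y) + (φ y - y) := by
      rw [LinearEquiv.mul_apply, map_sub]; abel
    rw [this]
    exact add_mem (add_mem h4 h3) (h1 j y hy)
  | inv φ _ h =>
    have hle : ∀ j, (fil B j).map (φ : L →ₗ[ℂ] L) ≤ fil B j := by
      rintro j _ ⟨z, hz, rfl⟩
      have := add_mem (fil_antitone (show j ≤ j + 1 by lia) (h j z hz)) hz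
      rwa [sub_add_cancel] at this
    intro y hy
    have hy' := hy
    -- A linear automorphism mapping a finite-dimensional subspace into itself maps it onto itself.
    -- So `y = φ z` with `z` in the same filtration step, and `φ⁻¹ y - y = -(φ z - z)`.
    rw [← Submodule.eq_of_le_of_finrank_eq (hle j) (LinearEquiv.finrank_map_eq φ _)] at hy'
    obtain ⟨z, hz, rfl⟩ := hy'
    have h1 := neg_mem (h j z hz)
    have h2 : φ⁻¹ ((φ : L →ₗ[ℂ] L) z) = z := φ.symm_apply_apply z
    rw [h2]
    simpa using h1

/-- The root subgroups over `R`. -/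
lemma exists_exp_mem_points {R : Type*} [CommRing R] [Algebra ℂ R] [LieAlgebra.IsSemisimple ℂ L]
    {k : ι → ℕ} (hk : k ≠ 0) {x : L} (hx : x ∈ rootSp B k) (r : R) :
    ∃ g ∈ points (unip B) R, ∀ v, g (1 ⊗ₜ v) = ∑ j ∈ Finset.range (Module.finrank ℂ L + 1),
      r ^ j • (1 ⊗ₜ (((j.factorial : ℂ))⁻¹ • (LieAlgebra.ad ℂ L x) ^ j) v) := by
  have hx1 : ∀ z : ℂ, z • x ∈ rootSp B k := fun z => Submodule.smul_mem _ _ hx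
  have hn : ∀ z : ℂ, IsNilpotent (LieAlgebra.ad ℂ L (z • x)) := fun z => isNilpotent_ad B
    (nPos_le_fil B ((le_iSup₂_of_le k hk le_rfl : rootSp B k ≤ nPos B) (hx1 z)))
  choose ψ hψ using fun z => exists_expAd (hn z)
  have hmem : ∀ z, (ψ z).toLinearEquiv ∈ unip B := fun z =>
    Subgroup.subset_closure ⟨k, hk, z • x, hx1 z, ψ z, rfl, hψ z⟩
  -- The inverse family is also polynomial, being the exponential family of `-x`.
  refine exists_mem_points (b := fun j => ((j.factorial : ℂ))⁻¹ • (LieAlgebra.ad ℂ L (-x)) ^ j)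
    (fun z => ⟨_, hmem z⟩) (fun z v => (hψ z v).trans (expAd_smul z x v)) (fun z v => ?_) r
  rw [← expAd_smul, smul_neg]
  obtain ⟨w, rfl⟩ := (ψ z).surjective v
  refine ((ψ z).toLinearEquiv.symm_apply_apply w).trans ?_
  change w = expAd (-(z • x)) (ψ z w)
  rw [hψ, expAd_neg_apply (hn z)]

end Unipotent

/-! ### Leading terms of filtered automorphisms over `R`. -/

section Leading

variable {ι : Type*} [Fintype ι] {L : Type*} [LieRing L] [LieAlgebra ℂ L]
  {H : LieSubalgebra ℂ L} (B : LieAlgebra.Basis ι H) {R : Type*} [CommRing R] [Algebra ℂ R]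

lemma baseChange_induction {S : Submodule ℂ L} {p : R ⊗[ℂ] L → Prop} (zero : p 0)
    (add : ∀ X Y, p X → p Y → p (X + Y)) (tmul : ∀ r, ∀ x ∈ S, p (r ⊗ₜ x))
    {X : R ⊗[ℂ] L} (hX : X ∈ S.baseChange R) : p X := by
  obtain ⟨c, hc, hc'⟩ := exists_comp X
  rw [← hc, Finsupp.sum]
  refine Finset.sum_induction _ p add zero fun k _ => tmul _ _ ?_
  rw [← hc']
  exact mem_baseChange.1 hX k

/-- The elements of `R ⊗ L` of degree at least `j` in the principal grading. -/
def filR (R : Type*) [CommRing R] [Algebra ℂ R] (j : ℤ) : Submodule R (R ⊗[ℂ] L) :=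
  (fil B j).baseChange R

/-- The `m`-th term of `g - 1` in the principal grading is `ad Z`. -/
def IsLead (m : ℤ) (g : (R ⊗[ℂ] L) ≃ₗ[R] (R ⊗[ℂ] L)) (Z : R ⊗[ℂ] L) : Prop :=
  ∀ j, ∀ X ∈ filR B R j, g X - X - ⁅Z, X⁆ ∈ filR B R (j + m + 1)

variable {B}

lemma filR_antitone {i j : ℤ} (h : j ≤ i) : filR B R i ≤ filR B R j := fun _ hX =>
  mem_baseChange.2 fun k => fil_antitone h (mem_baseChange.1 hX k)

lemma lie_mem_filR {i j : ℤ} {X Y : R ⊗[ℂ] L} (hX : X ∈ filR B R i) (hY : Y ∈ filR B R j) :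
    ⁅X, Y⁆ ∈ filR B R (i + j) :=
  lie_mem_baseChange (fun _ hx _ hy => lie_mem_fil hx hy) hX hY

lemma tmul_mem_filR {j : ℤ} (r : R) {x : L} (hx : x ∈ fil B j) : r ⊗ₜ x ∈ filR B R j :=
  Submodule.tmul_mem_baseChange_of_mem _ hx

lemma complex_smul_mem_filR {j : ℤ} (c : ℂ) {X : R ⊗[ℂ] L} (hX : X ∈ filR B R j) :
    c • X ∈ filR B R j :=
  Submodule.smul_of_tower_mem _ c hX

lemma lie_rho_sub_mem_filR {j : ℤ} {X : R ⊗[ℂ] L} (hX : X ∈ filR B R j) :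
    ⁅(1 : R) ⊗ₜ[ℂ] rho B, X⁆ - (j : ℂ) • X ∈ filR B R (j + 1) := by
  refine mem_baseChange.2 fun k => ?_
  rw [map_sub, map_smul, ← lie_skew, map_neg, comp_lie, lie_skew]
  exact lie_rho_sub_mem (mem_baseChange.1 hX k)

section

variable {m : ℤ} {g h : (R ⊗[ℂ] L) ≃ₗ[R] (R ⊗[ℂ] L)} {Z W : R ⊗[ℂ] L}

lemma IsLead.sub_mem (hg : IsLead B m g Z) (hZ : Z ∈ filR B R m) {j : ℤ} {X : R ⊗[ℂ] L}
    (hX : X ∈ filR B R j) : g X - X ∈ filR B R (j + m) := by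
  have := add_mem (filR_antitone (by lia) (hg j X hX)) (add_comm m j ▸ lie_mem_filR hZ hX)
  rwa [sub_add_cancel] at this

lemma isLead_one : IsLead B m (1 : (R ⊗[ℂ] L) ≃ₗ[R] (R ⊗[ℂ] L)) 0 := fun j X _ => by simp

/-- Leading terms add because the cross term `[Z, h X - X]` raises the degree by `2m`, which is at
least `m + 1`. -/
lemma IsLead.mul (hm : 1 ≤ m) (hg : IsLead B m g Z) (hZ : Z ∈ filR B R m) (hh : IsLead B m h W)
    (hW : W ∈ filR B R m) : IsLead B m (g * h) (Z + W) := by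
  intro j X hX
  have h1 := hh.sub_mem hW hX
  have h2 : h X ∈ filR B R j := by
    have := add_mem (filR_antitone (by lia) h1) hX
    rwa [sub_add_cancel] at this
  have h3 : ⁅Z, h X - X⁆ ∈ filR B R (j + m + 1) := filR_antitone (by lia) (lie_mem_filR hZ h1)
  have : (g * h) X - X - ⁅Z + W, X⁆ =
      (g (h X) - h X - ⁅Z, h X⁆) + (h X - X - ⁅W, X⁆) + ⁅Z, h X - X⁆ := by
    rw [LinearEquiv.mul_apply, add_lie, lie_sub]; abel
  rw [this]
  exact add_mem (add_mem (hg j _ h2) (hh j X hX)) h3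

/-- The leading term of a filtered automorphism is inner. -/
lemma exists_isLead_of_sub_mem (hm : 1 ≤ m) (hlie : ∀ X Y, g ⁅X, Y⁆ = ⁅g X, g Y⁆)
    (hg : ∀ j, ∀ X ∈ filR B R j, g X - X ∈ filR B R (j + m)) :
    ∃ Z ∈ filR B R m, IsLead B m g Z := by
  have hm0 : (m : ℂ) ≠ 0 := Int.cast_ne_zero.2 (by lia)
  set P : R ⊗[ℂ] L := 1 ⊗ₜ rho B
  have hP : P ∈ filR B R 0 := tmul_mem_filR 1 (height_le_fil le_rfl (rho_mem_height B))
  -- The candidate is forced by testing on `P = ρ̌`: to leading order `g P - P` should be `[Z, P]`,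
  -- which is `-m Z` for `Z` of degree `m`.
  obtain ⟨Z, hZ⟩ : ∃ Z, Z = -(m : ℂ)⁻¹ • (g P - P) := ⟨_, rfl⟩
  have hgP : g P = P - (m : ℂ) • Z := by
    rw [hZ, smul_smul, mul_neg, mul_inv_cancel₀ hm0]; module
  have hZm : Z ∈ filR B R m := by
    have := hg 0 P hP
    rw [zero_add] at this
    rw [hZ]
    exact complex_smul_mem_filR _ this
  refine ⟨Z, hZm, fun j X hX => ?_⟩
  have hsm : ∀ (c : ℂ) X, g (c • X) = c • g X := fun c X =>
    (g.toLinearMap.restrictScalars ℂ).map_smul c X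
  have h1 := hg _ _ (lie_rho_sub_mem_filR hX)
  have h2 := hg j X hX
  have h3 := lie_rho_sub_mem_filR h2
  have h4 := filR_antitone (show j + m + 1 ≤ m + (j + m) by lia) (lie_mem_filR hZm h2)
  rw [show j + 1 + m = j + m + 1 by ring] at h1
  -- An exact identity obtained from `g [P, X] = [g P, g X]` and `g P = P - m Z`. Each of its three
  -- terms raises degrees by more than `m`: the first since `[P, X] - j X` already lies one step
  -- deeper, the second since `ρ̌` acts by `j + m` on the leading part of `g X - X`, the third since
  -- both factors contribute `m`.
  have key : g X - X - ⁅Z, X⁆ = (m : ℂ)⁻¹ • ((g (⁅P, X⁆ - (j : ℂ) • X) - (⁅P, X⁆ - (j : ℂ) • X)) -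
      (⁅P, g X - X⁆ - ((j + m : ℤ) : ℂ) • (g X - X)) + (m : ℂ) • ⁅Z, g X - X⁆) := by
    rw [eq_inv_smul_iff₀ hm0, map_sub, hsm, hlie, hgP]
    simp only [sub_lie, lie_sub, smul_lie, Int.cast_add]
    module
  rw [key]
  exact complex_smul_mem_filR _ (add_mem (sub_mem h1 h3) (complex_smul_mem_filR _ h4))

end

variable [FiniteDimensional ℂ L]

/-- The filtration runs from everything at `-N` to zero at `N`, so a shift by `2N` kills every
element. -/
lemma eq_one_of_sub_mem {g : (R ⊗[ℂ] L) ≃ₗ[R] (R ⊗[ℂ] L)}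
    (hg : ∀ n : ℕ, ∀ j, ∀ X ∈ filR B R j, g X - X ∈ filR B R (j + n)) : g = 1 := by
  obtain ⟨N, hN, hN'⟩ := exists_height_bound B
  refine LinearEquiv.ext fun X => ?_
  have h := hg (2 * N) (-N) X (mem_baseChange.2 fun k => by rw [hN']; trivial)
  rw [show (-N + (2 * N : ℕ) : ℤ) = N by push_cast; ring] at h
  refine ext_comp fun k => ?_
  have := mem_baseChange.1 h k
  rw [hN, Submodule.mem_bot, map_sub, sub_eq_zero] at this
  exact this

lemma exists_decomposition {n : ℤ} (hn : 0 ≤ n) {X : R ⊗[ℂ] L} (hX : X ∈ filR B R n) :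
    ∃ c ∈ (cent B).baseChange R, ∃ Z ∈ (height B (n + 1)).baseChange R, ∃ W ∈ filR B R (n + 1),
      X = c + ⁅(1 : R) ⊗ₜ[ℂ] pMinus B, Z⁆ + W := by
  refine baseChange_induction (p := fun X => ∃ c ∈ (cent B).baseChange R,
    ∃ Z ∈ (height B (n + 1)).baseChange R, ∃ W ∈ filR B R (n + 1),
      X = c + ⁅(1 : R) ⊗ₜ[ℂ] pMinus B, Z⁆ + W)
    ⟨0, zero_mem _, 0, zero_mem _, 0, zero_mem _, by simp⟩ ?_ ?_ hX
  · rintro _ _ ⟨c, hc, Z, hZ, W, hW, rfl⟩ ⟨c', hc', Z', hZ', W', hW', rfl⟩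
    refine ⟨c + c', add_mem hc hc', Z + Z', add_mem hZ hZ', W + W', add_mem hW hW', ?_⟩
    rw [lie_add]; abel
  · intro r x hx
    rw [fil_eq] at hx
    obtain ⟨y, hy, w, hw, rfl⟩ := Submodule.mem_sup.1 hx
    obtain ⟨z, hz, hc⟩ := exists_sub_lie_mem_cent B hn hy
    refine ⟨_, Submodule.tmul_mem_baseChange_of_mem r hc, _,
      Submodule.tmul_mem_baseChange_of_mem r hz, _, tmul_mem_filR r hw, ?_⟩
    rw [LieAlgebra.ExtendScalars.bracket_tmul, one_mul, ← TensorProduct.tmul_add,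
      ← TensorProduct.tmul_add, sub_add_cancel]

variable [LieAlgebra.IsSemisimple ℂ L]

/-- If the lowest component `u` of `y` had degree below `m`, then `[u, x]` would be homogeneous and
at the same time lie strictly deeper in the filtration, for every homogeneous `x`. So `u` is
central, hence zero. This converts information about the operator `ad y` into information about `y`.
-/
lemma mem_fil_of_lie_mem {m : ℤ} {y : L} (h : ∀ j, ∀ x ∈ fil B j, ⁅y, x⁆ ∈ fil B (j + m)) :
    y ∈ fil B m := by
  obtain ⟨N, -, hN⟩ := exists_height_bound B
  have key : ∀ n : ℕ, -N + n ≤ m → y ∈ fil B (-N + n) := by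
    intro n
    induction n with
    | zero => simp [hN]
    | succ n ih =>
      intro hn
      push_cast at hn ⊢
      have hy := ih (by lia)
      rw [fil_eq] at hy
      obtain ⟨u, hu, w, hw, rfl⟩ := Submodule.mem_sup.1 hy
      have hu0 : u ∈ LieAlgebra.center ℂ L := by
        rw [LieModule.mem_maxTrivSubmodule]
        intro x
        have hle : fil B (-N) ≤ LinearMap.ker (LieAlgebra.ad ℂ L u) := by
          refine iSup₂_le fun j _ x hx => ?_
          have h1 := h j x (height_le_fil le_rfl hx)
          rw [add_lie] at h1
          have h2 := lie_mem_fil hw (height_le_fil le_rfl hx)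
          have h3 := sub_mem (fil_antitone (show -N + n + 1 + j ≤ j + m by lia) h1) h2
          rw [add_sub_cancel_right] at h3
          exact Submodule.disjoint_def.1 (disjoint_height_fil B (by lia)) _
            (lie_mem_height hu hx) h3
        rw [hN] at hle
        have h0 : ⁅u, x⁆ = 0 := hle (Submodule.mem_top (x := x))
        rw [← lie_skew, h0, neg_zero]
      rw [LieAlgebra.center_eq_bot] at hu0
      rw [(LieSubmodule.mem_bot _).1 hu0, zero_add, ← add_assoc]
      exact hw
  by_cases hm : -N ≤ m
  · have := key (m + N).toNat (by lia)
    rwa [show -(N : ℤ) + (m + N).toNat = m by lia] at this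
  · exact fil_antitone (show m ≤ -N by lia) (by rw [hN]; trivial)

lemma sub_mem_filR {g : (R ⊗[ℂ] L) ≃ₗ[R] (R ⊗[ℂ] L)} (hg : g ∈ points (unip B) R) {j : ℤ}
    {X : R ⊗[ℂ] L} (hX : X ∈ filR B R j) : g X - X ∈ filR B R (j + 1) := by
  obtain ⟨χ, hχ⟩ := hg
  exact sub_mem_baseChange_of_isPoint hχ (fun φ hφ => unip_sub_mem_fil hφ j) hX

lemma apply_mem_filR {g : (R ⊗[ℂ] L) ≃ₗ[R] (R ⊗[ℂ] L)} (hg : g ∈ points (unip B) R) {j : ℤ}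
    {X : R ⊗[ℂ] L} (hX : X ∈ filR B R j) : g X ∈ filR B R j := by
  have := add_mem (filR_antitone (by lia) (sub_mem_filR hg hX)) hX
  rwa [sub_add_cancel] at this

lemma exists_isLead_tmul {m : ℤ} (hm : 1 ≤ m) {k : ι → ℕ} (hk : ((∑ i, k i : ℕ) : ℤ) = m)
    {x : L} (hx : x ∈ rootSp B k) (r : R) :
    ∃ g ∈ points (unip B) R, IsLead B m g (r ⊗ₜ x) := by
  have hk0 : k ≠ 0 := by
    rintro rfl
    simp at hk
    lia
  have hxm : x ∈ fil B m := height_le_fil le_rfl (hk ▸ rootSp_le_height B k hx)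
  rcases eq_or_ne x 0 with rfl | hx0
  · exact ⟨1, one_mem _, by rw [TensorProduct.tmul_zero]; exact isLead_one⟩
  have : Nontrivial L := ⟨x, 0, hx0⟩
  -- A positive dimension ensures that the truncated exponential contains its constant and linear
  -- terms; this is why `x = 0` is treated apart. All remaining terms raise the degree by at least
  -- `2m`.
  obtain ⟨d, hd⟩ := Nat.exists_eq_succ_of_ne_zero (Module.finrank_pos (R := ℂ) (M := L)).ne'
  obtain ⟨g, hg, hgv⟩ := exists_exp_mem_points hk0 hx r
  refine ⟨g, hg, fun j X hX => ?_⟩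
  refine baseChange_le_comap (F := g.toLinearMap - LinearMap.id - LieAlgebra.ad R _ (r ⊗ₜ x))
    (fun v hv => ?_) hX
  change g (1 ⊗ₜ v) - 1 ⊗ₜ v - ⁅r ⊗ₜ[ℂ] x, (1 : R) ⊗ₜ[ℂ] v⁆ ∈ filR B R _
  have hpow : ∀ n : ℕ, ((LieAlgebra.ad ℂ L x) ^ n) v ∈ fil B (j + n * m) := by
    intro n
    induction n with
    | zero => simpa using hv
    | succ n ih =>
      rw [pow_succ', Module.End.mul_apply, LieAlgebra.ad_apply]
      have := lie_mem_fil hxm ih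
      rwa [show m + (j + n * m) = j + (n + 1 : ℕ) * m by push_cast; ring] at this
  rw [hgv, hd, Finset.sum_range_succ', Finset.sum_range_succ']
  have h0 : ∀ S : R ⊗[ℂ] L, S + r ^ (0 + 1) • (1 : R) ⊗ₜ[ℂ]
      ((((0 + 1).factorial : ℂ))⁻¹ • (LieAlgebra.ad ℂ L x) ^ (0 + 1)) v +
      r ^ 0 • (1 : R) ⊗ₜ[ℂ] ((((0).factorial : ℂ))⁻¹ • (LieAlgebra.ad ℂ L x) ^ 0) v -
      (1 : R) ⊗ₜ[ℂ] v - ⁅r ⊗ₜ[ℂ] x, (1 : R) ⊗ₜ[ℂ] v⁆ = S := by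
    intro S
    simp [LieAlgebra.ExtendScalars.bracket_tmul, TensorProduct.smul_tmul']
  rw [h0]
  refine Submodule.sum_mem _ fun n _ => Submodule.smul_mem _ _ (tmul_mem_filR _ ?_)
  rw [LinearMap.smul_apply]
  refine Submodule.smul_mem _ _ (fil_antitone ?_ (hpow (n + 1 + 1)))
  push_cast
  nlinarith

/-- Every element of positive degree is the leading term of an element of `N(R)`. -/
lemma exists_isLead {m : ℤ} (hm : 1 ≤ m) {Z : R ⊗[ℂ] L} (hZ : Z ∈ (height B m).baseChange R) :
    ∃ g ∈ points (unip B) R, IsLead B m g Z := by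
  have hle : ∀ {Z : R ⊗[ℂ] L}, Z ∈ (height B m).baseChange R → Z ∈ filR B R m := fun hZ =>
    mem_baseChange.2 fun k => height_le_fil le_rfl (mem_baseChange.1 hZ k)
  have key : ∀ Z W : R ⊗[ℂ] L, (Z ∈ filR B R m ∧ ∃ g ∈ points (unip B) R, IsLead B m g Z) →
      (W ∈ filR B R m ∧ ∃ g ∈ points (unip B) R, IsLead B m g W) →
      (Z + W ∈ filR B R m ∧ ∃ g ∈ points (unip B) R, IsLead B m g (Z + W)) := by
    rintro Z W ⟨hZ, g, hg, hgZ⟩ ⟨hW, h, hh, hhW⟩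
    exact ⟨add_mem hZ hW, g * h, mul_mem hg hh, hgZ.mul hm hZ hhW hW⟩
  refine (baseChange_induction (p := fun Z => Z ∈ filR B R m ∧ ∃ g ∈ points (unip B) R,
    IsLead B m g Z) ⟨zero_mem _, 1, one_mem _, isLead_one⟩ key (fun r x hx => ?_) hZ).2
  -- An element of degree `m` is a sum of root vectors of height `m`; each summand is realised by a
  -- root subgroup, and the product of the group elements has the sum as leading term.
  refine Submodule.iSup_induction _ (motive := fun x => (r ⊗ₜ x ∈ filR B R m ∧
    ∃ g ∈ points (unip B) R, IsLead B m g (r ⊗ₜ x))) (height_le_iSup_rootSp B hm hx)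
    (fun k x hx => ⟨tmul_mem_filR r ?_, exists_isLead_tmul hm k.2 hx r⟩) ?_ fun x y hx hy => ?_
  · exact height_le_fil le_rfl (k.2 ▸ rootSp_le_height B k.1 hx)
  · rw [TensorProduct.tmul_zero]
    exact ⟨zero_mem _, 1, one_mem _, isLead_one⟩
  · rw [TensorProduct.tmul_add]
    exact key _ _ hx hy

end Leading

/-! ### Gauge transformations and canonical forms. -/

section Canonical

variable {ι : Type*} [Fintype ι] {L : Type*} [LieRing L] [LieAlgebra ℂ L]
  [FiniteDimensional ℂ L] [LieAlgebra.IsSemisimple ℂ L]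
  {H : LieSubalgebra ℂ L} {B : LieAlgebra.Basis ι H}
  {g : (Mero ⊗[ℂ] L) ≃ₗ[Mero] (Mero ⊗[ℂ] L)}

lemma borel_baseChange_le : (borel B).baseChange Mero ≤ filR B Mero 0 := fun _ hX =>
  mem_baseChange.2 fun k => borel_le_fil B (mem_baseChange.1 hX k)

/-- On a constant `1 ⊗ x` the operator `ad (dg g⁻¹)` is `-g` applied to the derivative of `g⁻¹ (1 ⊗
x) - 1 ⊗ x`. It raises degrees by `m`, because `d/dt` and `g` preserve the filtration;
`mem_fil_of_lie_mem` then bounds the degree of `dg g⁻¹` itself. -/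
lemma logDer_mem_filR (hg : g ∈ unipM B) {m : ℤ}
    (h : ∀ j, ∀ X ∈ filR B Mero j, g X - X ∈ filR B Mero (j + m)) :
    logDer g ∈ filR B Mero m := by
  have hinv : ∀ j, ∀ X ∈ filR B Mero j, g⁻¹ X - X ∈ filR B Mero (j + m) := by
    intro j X hX
    have h1 := neg_mem (apply_mem_filR ((unipM B).inv_mem hg) (h j X hX))
    have h2 : g⁻¹ (g X) = X := g.symm_apply_apply X
    rwa [map_sub, h2, neg_sub] at h1
  refine mem_baseChange.2 fun k => mem_fil_of_lie_mem fun j x hx => ?_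
  rw [← comp_lie, logDer_spec (unipM_lie B hg)]
  have h0 : dOp ((1 : Mero) ⊗ₜ[ℂ] x) = 0 := by simp [dOp]
  have h1 := dOp_mem (hinv j _ (tmul_mem_filR (1 : Mero) hx))
  rw [map_sub, h0, sub_zero] at h1
  rw [h0, zero_sub]
  exact mem_baseChange.1 (neg_mem (apply_mem_filR hg h1)) k

/-- As `p₋₁` has degree `-1`, its leading change `[Z, p₋₁]` sits in degree `m - 1`, one below the
effect on `v` and the derivative term. To this order the gauge action is therefore linear in `Z` and
free of derivatives. -/
lemma gauge_sub_mem_filR (hg : g ∈ unipM B) {m : ℤ} {Z : Mero ⊗[ℂ] L}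
    (hZ : Z ∈ filR B Mero m) (h : IsLead B m g Z) {v : Mero ⊗[ℂ] L} (hv : v ∈ filR B Mero 0) :
    gauge g ((1 : Mero) ⊗ₜ[ℂ] pMinus B + v) - ((1 : Mero) ⊗ₜ[ℂ] pMinus B + v) -
      ⁅Z, (1 : Mero) ⊗ₜ[ℂ] pMinus B⁆ ∈ filR B Mero m := by
  have h1 := h (-1) _ (tmul_mem_filR (1 : Mero) (height_le_fil le_rfl (pMinus_mem_height B)))
  have h2 := h.sub_mem hZ hv
  have h3 := logDer_mem_filR hg fun j X hX => h.sub_mem hZ hX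
  rw [show -1 + m + 1 = m by ring] at h1
  rw [zero_add] at h2
  have := sub_mem (add_mem h1 h2) h3
  convert this using 1
  rw [gauge, map_add]
  abel

/-- An element of `N(ℳ)` that carries a canonical form to a canonical form is trivial. -/
theorem eq_one_of_gauge_eq (hg : g ∈ unipM B) {c c' : Mero ⊗[ℂ] L}
    (hc0 : c ∈ (borel B).baseChange Mero)
    (hc : c ∈ (cent B).baseChange Mero) (hc' : c' ∈ (cent B).baseChange Mero)
    (h : gauge g ((1 : Mero) ⊗ₜ[ℂ] pMinus B + c) = (1 : Mero) ⊗ₜ[ℂ] pMinus B + c') : g = 1 := by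
  -- The order to which `g` agrees with `1` is raised by one each time, starting from unipotence.
  have step : ∀ n : ℕ, ∀ j, ∀ X ∈ filR B Mero j, g X - X ∈ filR B Mero (j + (n + 1)) := by
    intro n
    induction n with
    | zero => exact fun j X hX => by simpa using sub_mem_filR hg hX
    | succ n ih =>
      obtain ⟨Z, hZ, hlead⟩ := exists_isLead_of_sub_mem (by lia) (unipM_lie B hg) ih
      have h1 := gauge_sub_mem_filR hg hZ hlead (borel_baseChange_le hc0)
      rw [h, add_sub_add_left_eq_sub] at h1
      -- Applying `ad p₁` removes both canonical forms from the comparison of the two connections,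
      -- leaving `[p₁, [p₋₁, Z]]` one degree higher than expected.
      have hZ' : Z ∈ filR B Mero (n + 1 + 1) := by
        refine mem_baseChange.2 fun k => ?_
        refine mem_fil_of_lie_pPlus_lie_pMinus_mem B (by lia) (mem_baseChange.1 hZ k) ?_
        have h2 := mem_baseChange.1 h1 k
        rw [map_sub, map_sub, comp_lie, ← lie_skew, sub_neg_eq_add] at h2
        have h3 := lie_mem_fil (height_le_fil le_rfl (pPlus_mem_height B)) h2
        have e1 : ⁅pPlus B, comp k c⁆ = 0 := mem_baseChange.1 hc k
        have e2 : ⁅pPlus B, comp k c'⁆ = 0 := mem_baseChange.1 hc' k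
        rwa [lie_add, lie_sub, e1, e2, sub_zero, zero_add, add_comm (1 : ℤ)] at h3
      intro j X hX
      have h2 := add_mem (hlead j X hX)
        (filR_antitone (show j + (n + 1) + 1 ≤ n + 1 + 1 + j by lia) (lie_mem_filR hZ' hX))
      rw [sub_add_cancel] at h2
      exact filR_antitone (by push_cast; lia) h2
  exact eq_one_of_sub_mem fun n j X hX => filR_antitone (by lia) (step n j X hX)

/-- Every connection can be brought into canonical form. -/
theorem exists_gauge_mem_cent {v : Mero ⊗[ℂ] L} (hv : v ∈ (borel B).baseChange Mero) :
    ∃ g ∈ unipM B, gauge g ((1 : Mero) ⊗ₜ[ℂ] pMinus B + v) - (1 : Mero) ⊗ₜ[ℂ] pMinus B ∈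
      (cent B).baseChange Mero := by
  -- Invariant: after a gauge transformation the connection is canonical up to an error `w` of
  -- degree at least `n`.
  have step : ∀ n : ℕ, ∃ g ∈ unipM B, ∃ c ∈ (cent B).baseChange Mero, ∃ w ∈ filR B Mero n,
      gauge g ((1 : Mero) ⊗ₜ[ℂ] pMinus B + v) = (1 : Mero) ⊗ₜ[ℂ] pMinus B + (c + w) := by
    intro n
    induction n with
    | zero =>
      refine ⟨1, one_mem _, 0, zero_mem _, v, borel_baseChange_le hv, ?_⟩
      rw [gauge_one, zero_add]
    | succ n ih =>
      obtain ⟨g, hg, c, hc, w, hw, h⟩ := ih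
      -- That `c + w` has nonnegative degrees comes from stability of the space of connections under
      -- the gauge action, not from a description of `𝔞`.
      have hu := gauge_mem B hg hv
      rw [h, add_sub_cancel_left] at hu
      obtain ⟨c₁, hc₁, Z, hZ, W, hW, hw'⟩ := exists_decomposition (by lia) hw
      -- With leading term `Z`, the change `[Z, p₋₁]` cancels the summand `[p₋₁, Z]` of the error.
      obtain ⟨g₁, hg₁, hlead⟩ := exists_isLead (by lia) hZ
      have h1 := gauge_sub_mem_filR hg₁
        (mem_baseChange.2 fun k => height_le_fil le_rfl (mem_baseChange.1 hZ k)) hlead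
        (borel_baseChange_le hu)
      refine ⟨g₁ * g, mul_mem hg₁ hg, c + c₁, add_mem hc hc₁, _, add_mem hW h1, ?_⟩
      rw [gauge_mul (unipM_lie B hg₁) (unipM_lie B hg), h]
      generalize gauge g₁ _ = G
      rw [← lie_skew]
      conv_rhs => rw [hw']
      abel
  obtain ⟨N, hN, -⟩ := exists_height_bound B
  obtain ⟨g, hg, c, hc, w, hw, h⟩ := step N
  have hw0 : w = 0 := ext_comp fun k => by
    have := mem_baseChange.1 hw k
    rwa [hN, Submodule.mem_bot, ← map_zero (comp k)] at this
  refine ⟨g, hg, ?_⟩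
  rwa [h, hw0, add_zero, add_sub_cancel_left]

end Canonical

/-! ### Equivariance under the cyclotomic automorphism. -/

section Twist

variable {ι : Type*} [Fintype ι] {L : Type*} [LieRing L] [LieAlgebra ℂ L]
  {H : LieSubalgebra ℂ L} {B : LieAlgebra.Basis ι H}

lemma rhoCoeff_perm {ν : Equiv.Perm ι} (hν : ∀ i j, B.A (ν i) (ν j) = B.A i j) (i : ι) :
    rhoCoeff B (ν i) = rhoCoeff B i := by
  refine congrFun (rhoCoeff_unique B (c := fun i => rhoCoeff B (ν i)) fun j => ?_) i
  rw [← rhoCoeff_spec B (ν j),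
    ← Equiv.sum_comp ν fun i => (B.A (ν j) i : ℂ) * rhoCoeff B i]
  exact Finset.sum_congr rfl fun i _ => by rw [hν]

lemma expAd_map (σ : L ≃ₗ⁅ℂ⁆ L) (x y : L) : expAd (σ x) (σ y) = σ (expAd x y) := by
  have h : ∀ j : ℕ, ((LieAlgebra.ad ℂ L (σ x)) ^ j) (σ y) = σ (((LieAlgebra.ad ℂ L x) ^ j) y) := by
    intro j
    induction j with
    | zero => simp
    | succ j ih =>
      rw [pow_succ', Module.End.mul_apply, ih, pow_succ', Module.End.mul_apply,
        LieAlgebra.ad_apply, LieAlgebra.ad_apply, LieEquiv.map_lie]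
  rw [expAd, expAd, LinearMap.sum_apply, LinearMap.sum_apply, map_sum]
  refine Finset.sum_congr rfl fun j _ => ?_
  rw [LinearMap.smul_apply, LinearMap.smul_apply, h, map_smul]

lemma hat_smul (σ : L ≃ₗ⁅ℂ⁆ L) (ω : ℂˣ) (f : Mero) (X : Mero ⊗[ℂ] L) :
    hat σ ω (f • X) = Mero.act ω f • hat σ ω X := by
  induction X with
  | zero => simp
  | add a b ha hb => rw [smul_add, map_add, ha, hb, map_add, smul_add]
  | tmul r x => simp [hat, TensorProduct.smul_tmul']

lemma hat_symm_smul (σ : L ≃ₗ⁅ℂ⁆ L) (ω : ℂˣ) (f : Mero) (X : Mero ⊗[ℂ] L) :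
    (hat σ ω).symm (f • X) = (Mero.act ω).symm f • (hat σ ω).symm X := by
  rw [LinearEquiv.symm_apply_eq, hat_smul, AlgEquiv.apply_symm_apply, LinearEquiv.apply_symm_apply]

/-- The action of `ω` on automorphisms of `𝔤(ℳ)`, by conjugation. -/
def hatConj (σ : L ≃ₗ⁅ℂ⁆ L) (ω : ℂˣ) (g : (Mero ⊗[ℂ] L) ≃ₗ[Mero] (Mero ⊗[ℂ] L)) :
    (Mero ⊗[ℂ] L) ≃ₗ[Mero] (Mero ⊗[ℂ] L) where
  toFun X := hat σ ω (g ((hat σ ω).symm X))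
  map_add' X Y := by simp only [map_add]
  map_smul' f X := by
    simp only [hat_symm_smul, map_smul, hat_smul, AlgEquiv.apply_symm_apply, RingHom.id_apply]
  invFun X := hat σ ω (g⁻¹ ((hat σ ω).symm X))
  left_inv X := by
    change hat σ ω (g⁻¹ ((hat σ ω).symm (hat σ ω (g ((hat σ ω).symm X))))) = X
    rw [LinearEquiv.symm_apply_apply, show g⁻¹ (g ((hat σ ω).symm X)) = (hat σ ω).symm X from
      g.symm_apply_apply _, LinearEquiv.apply_symm_apply]
  right_inv X := by
    change hat σ ω (g ((hat σ ω).symm (hat σ ω (g⁻¹ ((hat σ ω).symm X))))) = X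
    rw [LinearEquiv.symm_apply_apply, show g (g⁻¹ ((hat σ ω).symm X)) = (hat σ ω).symm X from
      g.apply_symm_apply _, LinearEquiv.apply_symm_apply]

lemma hatConj_apply (σ : L ≃ₗ⁅ℂ⁆ L) (ω : ℂˣ) (g : (Mero ⊗[ℂ] L) ≃ₗ[Mero] (Mero ⊗[ℂ] L))
    (X : Mero ⊗[ℂ] L) : hatConj σ ω g X = hat σ ω (g ((hat σ ω).symm X)) := rfl

lemma hatConj_inv_apply (σ : L ≃ₗ⁅ℂ⁆ L) (ω : ℂˣ) (g : (Mero ⊗[ℂ] L) ≃ₗ[Mero] (Mero ⊗[ℂ] L))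
    (X : Mero ⊗[ℂ] L) : (hatConj σ ω g)⁻¹ X = hat σ ω (g⁻¹ ((hat σ ω).symm X)) := rfl

lemma hat_symm_one_tmul (σ : L ≃ₗ⁅ℂ⁆ L) (ω : ℂˣ) (x : L) :
    (hat σ ω).symm ((1 : Mero) ⊗ₜ[ℂ] x) = 1 ⊗ₜ[ℂ] σ.symm x := by
  rw [LinearEquiv.symm_apply_eq]
  simp [hat]

lemma coord_hat (σ : L ≃ₗ⁅ℂ⁆ L) (ω : ℂˣ) (ξ : Module.Dual ℂ L) (X : Mero ⊗[ℂ] L) :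
    coord Mero ξ (hat σ ω X) = Mero.act ω (coord Mero (ξ ∘ₗ (σ : L →ₗ[ℂ] L)) X) := by
  induction X with
  | zero => simp
  | add a b ha hb => simp only [map_add, ha, hb]
  | tmul r x => simp [hat]

variable [FiniteDimensional ℂ L]

/-- If `ς` normalises `K`, then the action of `ω` preserves `K(ℳ)`. -/
lemma hatConj_mem_points {K : Subgroup (L ≃ₗ[ℂ] L)} {σ : L ≃ₗ⁅ℂ⁆ L}
    (hK : ∀ φ ∈ K, σ.toLinearEquiv * φ * σ.toLinearEquiv⁻¹ ∈ K) (ω : ℂˣ)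
    {g : (Mero ⊗[ℂ] L) ≃ₗ[Mero] (Mero ⊗[ℂ] L)} (hg : g ∈ points K Mero) :
    hatConj σ ω g ∈ points K Mero := by
  obtain ⟨χ, hχ⟩ := hg
  let c : K → K := fun φ => ⟨_, hK φ.1 φ.2⟩
  have hmem : ∀ f : regFun K, (funPull c).comp (regFun K).val f ∈ regFun K := by
    have : regFun K ≤ (regFun K).comap (funPull c) := by
      refine Algebra.adjoin_le ?_
      rintro f (⟨ξ, v, rfl⟩ | ⟨ξ, v, rfl⟩)
      · exact (regCoef K (ξ ∘ₗ (σ : L →ₗ[ℂ] L)) (σ.symm v)).2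
      · exact (regCoefInv K (ξ ∘ₗ (σ : L →ₗ[ℂ] L)) (σ.symm v)).2
    exact fun f => this f.2
  refine ⟨((Mero.act ω : Mero →ₐ[ℂ] Mero).comp χ).comp
    (((funPull c).comp (regFun K).val).codRestrict _ hmem), fun ξ v => ⟨?_, ?_⟩⟩
  · rw [hatConj_apply, hat_symm_one_tmul, coord_hat, ← (hχ _ _).1]
    rfl
  · rw [hatConj_inv_apply, hat_symm_one_tmul, coord_hat, ← (hχ _ _).2]
    rfl

variable [LieAlgebra.IsSemisimple ℂ L]

lemma hatConj_lie {σ : L ≃ₗ⁅ℂ⁆ L} {ω : ℂˣ} {g : (Mero ⊗[ℂ] L) ≃ₗ[Mero] (Mero ⊗[ℂ] L)}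
    (hg : ∀ X Y, g ⁅X, Y⁆ = ⁅g X, g Y⁆) (X Y : Mero ⊗[ℂ] L) :
    hatConj σ ω g ⁅X, Y⁆ = ⁅hatConj σ ω g X, hatConj σ ω g Y⁆ := by
  obtain ⟨X, rfl⟩ := (hat σ ω).surjective X
  obtain ⟨Y, rfl⟩ := (hat σ ω).surjective Y
  rw [← hat_lie, hatConj_apply, LinearEquiv.symm_apply_apply, hg, hat_lie]
  simp only [hatConj_apply, LinearEquiv.symm_apply_apply]

/-- Moving `d/dt` past `ς̂` costs the factor `ω⁻¹`, which is exactly the factor by which `dt` is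
pulled back. Hence the gauge action is equivariant on differentials. -/
lemma logDer_hatConj {σ : L ≃ₗ⁅ℂ⁆ L} {ω : ℂˣ} {g : (Mero ⊗[ℂ] L) ≃ₗ[Mero] (Mero ⊗[ℂ] L)}
    (hg : ∀ X Y, g ⁅X, Y⁆ = ⁅g X, g Y⁆) :
    logDer (hatConj σ ω g) = hatDiff σ ω (logDer g) := by
  have hsm : ∀ (c : ℂ) X, g (c • X) = c • g X := fun c X =>
    (g.toLinearMap.restrictScalars ℂ).map_smul c X
  refine eq_of_lie fun X => ?_
  obtain ⟨Y, rfl⟩ := (hat σ ω).surjective X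
  rw [logDer_spec (hatConj_lie hg), hatDiff, smul_lie, ← hat_lie, logDer_spec hg,
    hatConj_inv_apply, LinearEquiv.symm_apply_apply, dOp_hat, dOp_hat, hatConj_apply, map_smul,
    LinearEquiv.symm_apply_apply, hsm, map_smul, map_sub, smul_sub]

lemma gauge_hatConj {σ : L ≃ₗ⁅ℂ⁆ L} {ω : ℂˣ} {g : (Mero ⊗[ℂ] L) ≃ₗ[Mero] (Mero ⊗[ℂ] L)}
    (hg : ∀ X Y, g ⁅X, Y⁆ = ⁅g X, g Y⁆) (A : Mero ⊗[ℂ] L) :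
    gauge (hatConj σ ω g) (hatDiff σ ω A) = hatDiff σ ω (gauge g A) := by
  have hsm : ∀ (c : ℂ) X, g (c • X) = c • g X := fun c X =>
    (g.toLinearMap.restrictScalars ℂ).map_smul c X
  rw [gauge, gauge, logDer_hatConj hg, hatConj_apply, hatDiff, hatDiff, hatDiff, map_smul,
    LinearEquiv.symm_apply_apply, hsm, map_smul, map_sub, smul_sub]

variable {ν : Equiv.Perm ι} (hν : ∀ i j, B.A (ν i) (ν j) = B.A i j) (ω : ℂˣ)

lemma cycAut_h (i : ι) : cycAut B ν hν ω (B.h i) = B.h (ν i) := by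
  rw [← (B.sl2 i).lie_e_f, LieEquiv.map_lie, cycAut_e, cycAut_f, smul_lie, lie_smul, smul_smul,
    Units.inv_mul, one_smul, (B.sl2 (ν i)).lie_e_f]

lemma cycAut_pPlus : cycAut B ν hν ω (pPlus B) = ((ω⁻¹ : ℂˣ) : ℂ) • pPlus B := by
  rw [pPlus, map_sum, ← Equiv.sum_comp ν (fun i => rhoCoeff B i • B.e i), Finset.smul_sum]
  refine Finset.sum_congr rfl fun i _ => ?_
  rw [map_smul, cycAut_e, rhoCoeff_perm hν, smul_comm]

lemma cycAut_pMinus : cycAut B ν hν ω (pMinus B) = (ω : ℂ) • pMinus B := by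
  rw [pMinus, map_sum]
  simp only [cycAut_f]
  rw [← Finset.smul_sum, Equiv.sum_comp ν B.f]

/-- Since `ς` permutes the coroots by `ν`, it carries the root `∑ kᵢ αᵢ` to `∑ kᵢ α_{ν(i)}`. The
weight equation is checked on the coroots, which form a basis of the Cartan subalgebra. -/
lemma cycAut_mem_rootSp {k : ι → ℕ} {x : L} (hx : x ∈ rootSp B k) :
    cycAut B ν hν ω x ∈ rootSp B (k ∘ ν.symm) := by
  have := B.isLieAbelian_cartan
  refine LieModule.weightSpace_le_genWeightSpace L (L := H) _ ((LieModule.mem_weightSpace _ _).2 ?_)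
  set χ : Module.Dual ℂ H := ∑ i, (k ∘ ν.symm) i • B.baseSupp i
  have hs : (LieAlgebra.ad ℂ L : L →ₗ[ℂ] Module.End ℂ L).flip (cycAut B ν hν ω x) ∘ₗ
      H.toSubmodule.subtype = χ.smulRight (cycAut B ν hν ω x) := by
    refine ((Module.Basis.span B.linInd).map
      (LinearEquiv.ofEq _ _ B.coe_cartan_eq_span).symm).ext fun i => ?_
    obtain ⟨j, rfl⟩ := ν.surjective i
    have hb : ((Module.Basis.span B.linInd).map
        (LinearEquiv.ofEq _ _ B.coe_cartan_eq_span).symm) (ν j) = B.h' (ν j) :=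
      Subtype.ext (congrArg Subtype.val (Module.Basis.span_apply B.linInd (ν j)) :)
    rw [hb]
    change ⁅B.h (ν j), cycAut B ν hν ω x⁆ = χ (B.h' (ν j)) • cycAut B ν hν ω x
    have h1 := lie_of_mem_rootSp B hx (B.h' j)
    change ⁅B.h j, x⁆ = _ at h1
    rw [← cycAut_h hν ω, ← LieEquiv.map_lie, h1, map_smul]
    congr 1
    simp only [χ, LinearMap.sum_apply, LinearMap.smul_apply, LieAlgebra.Basis.baseSupp_apply_h']
    rw [← Equiv.sum_comp ν fun i => (k ∘ ν.symm) i • (B.A i (ν j) : ℂ)]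
    exact Finset.sum_congr rfl fun i _ => by rw [hν]; simp
  intro h
  simpa [χ] using LinearMap.congr_fun hs h

/-- Conjugation by `ς` turns `exp(ad x)` into `exp(ad ς(x))`, and `ς` permutes the positive root
spaces, so the generators of `N` are permuted. -/
lemma conj_mem_unip {φ : L ≃ₗ[ℂ] L} (hφ : φ ∈ unip B) :
    (cycAut B ν hν ω).toLinearEquiv * φ * (cycAut B ν hν ω).toLinearEquiv⁻¹ ∈ unip B := by
  set σ := cycAut B ν hν ω
  have hle : unip B ≤ (unip B).comap (MulAut.conj σ.toLinearEquiv).toMonoidHom := by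
    refine (Subgroup.closure_le _).2 ?_
    rintro _ ⟨k, hk, x, hx, ψ, rfl, hψ⟩
    refine Subgroup.subset_closure ⟨k ∘ ν.symm, fun h => hk ?_, σ x, cycAut_mem_rootSp hν ω hx,
      (σ.symm.trans ψ).trans σ, rfl, fun y => ?_⟩
    · ext i
      simpa using congrFun h (ν i)
    · obtain ⟨y, rfl⟩ := σ.surjective y
      change σ (ψ (σ.symm (σ y))) = expAd (σ x) (σ y)
      rw [expAd_map, LieEquiv.symm_apply_apply, hψ]
  exact hle hφ

lemma hatDiff_pMinus : hatDiff (cycAut B ν hν ω) ω ((1 : Mero) ⊗ₜ[ℂ] pMinus B) =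
    1 ⊗ₜ[ℂ] pMinus B := by
  rw [hatDiff]
  simp [hat, cycAut_pMinus, TensorProduct.tmul_smul, smul_smul]

/-- `ς` multiplies `p₁` by a nonzero scalar, so it preserves the centraliser. -/
lemma hatDiff_mem_cent {X : Mero ⊗[ℂ] L} (hX : X ∈ (cent B).baseChange Mero) :
    hatDiff (cycAut B ν hν ω) ω X ∈ (cent B).baseChange Mero := by
  refine Submodule.smul_of_tower_mem _ _ ?_
  refine baseChange_induction (p := fun X => hat (cycAut B ν hν ω) ω X ∈
    (cent B).baseChange Mero) (by simp) (fun X Y hX hY => by rw [map_add]; exact add_mem hX hY)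
    (fun r x hx => ?_) hX
  refine Submodule.tmul_mem_baseChange_of_mem (Mero.act ω r) ?_
  have h1 : ⁅pPlus B, x⁆ = 0 := hx
  have h2 := congrArg (cycAut B ν hν ω) h1
  rw [LieEquiv.map_lie, cycAut_pPlus, smul_lie, map_zero] at h2
  exact (smul_eq_zero.1 h2).resolve_left (Units.ne_zero _)

end Twist

/-! ### Freeness and cyclotomic canonical forms. -/

section Main

variable {ι : Type*} [Fintype ι] {L : Type*} [LieRing L] [LieAlgebra ℂ L]
  [FiniteDimensional ℂ L] [LieAlgebra.IsSemisimple ℂ L]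
  {H : LieSubalgebra ℂ L} {B : LieAlgebra.Basis ι H}

lemma PreOper.form_smul (g : unipM B) (D : PreOper B) : (g • D).form = gauge g.1 D.form :=
  add_sub_cancel _ _

lemma CycPreOper.form_smul {ν : Equiv.Perm ι} {hν : ∀ i j, B.A (ν i) (ν j) = B.A i j} {ω : ℂˣ}
    (g : cycUnipM B (cycAut B ν hν ω) ω) (D : CycPreOper B ν hν ω) :
    (1 : Mero) ⊗ₜ[ℂ] pMinus B + (g • D).v = gauge g.1 ((1 : Mero) ⊗ₜ[ℂ] pMinus B + D.v) :=
  add_sub_cancel _ _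

/-- The gauge action of `N(ℳ)` is free. -/
theorem eq_one_of_gauge_eq_self {g : (Mero ⊗[ℂ] L) ≃ₗ[Mero] (Mero ⊗[ℂ] L)} (hg : g ∈ unipM B)
    {v : Mero ⊗[ℂ] L} (hv : v ∈ (borel B).baseChange Mero)
    (h : gauge g ((1 : Mero) ⊗ₜ[ℂ] pMinus B + v) = (1 : Mero) ⊗ₜ[ℂ] pMinus B + v) : g = 1 := by
  obtain ⟨k, hk, hc⟩ := exists_gauge_mem_cent hv
  have hl := fun {g} (hg : g ∈ unipM B) => unipM_lie B hg
  have hk' := (unipM B).inv_mem hk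
  have e : ∀ X, X = (1 : Mero) ⊗ₜ[ℂ] pMinus B + (X - (1 : Mero) ⊗ₜ[ℂ] pMinus B) :=
    fun X => (add_sub_cancel _ _).symm
  -- With `k` taking the connection to canonical form, the conjugate fixes that form, so the
  -- rigidity of canonical forms applies.
  have h1 : k * g * k⁻¹ = 1 := by
    refine eq_one_of_gauge_eq (mul_mem (mul_mem hk hg) hk') (gauge_mem B hk hv) hc hc ?_
    rw [← e, gauge_mul (hl (mul_mem hk hg)) (hl hk'), ← gauge_mul (hl hk') (hl hk), inv_mul_cancel,
      gauge_one, gauge_mul (hl hk) (hl hg), h]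
  simpa using h1

/-- The canonical forms of cyclotomic connections are reached in `N^ς̂(ℳ)`. -/
theorem exists_cyc_gauge_mem_cent {ν : Equiv.Perm ι} (hν : ∀ i j, B.A (ν i) (ν j) = B.A i j)
    (ω : ℂˣ) {v : Mero ⊗[ℂ] L} (hv : v ∈ cycDiff (cycAut B ν hν ω) ω (borel B)) :
    ∃ g ∈ cycUnipM B (cycAut B ν hν ω) ω,
      gauge g ((1 : Mero) ⊗ₜ[ℂ] pMinus B + v) - (1 : Mero) ⊗ₜ[ℂ] pMinus B ∈
        (cent B).baseChange Mero := by
  obtain ⟨g, hg, hc⟩ := exists_gauge_mem_cent hv.1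
  set σ := cycAut B ν hν ω
  have hl := fun {g} (hg : g ∈ unipM B) => unipM_lie B hg
  have hg' : hatConj σ ω g ∈ unipM B :=
    hatConj_mem_points (fun φ hφ => conj_mem_unip hν ω hφ) ω hg
  have hinv := (unipM B).inv_mem hg
  set p : Mero ⊗[ℂ] L := (1 : Mero) ⊗ₜ[ℂ] pMinus B
  set A := gauge g (p + v)
  have hp : hatDiff σ ω p = p := hatDiff_pMinus hν ω
  have hadd : ∀ X Y, hatDiff σ ω (X + Y) = hatDiff σ ω X + hatDiff σ ω Y := fun X Y => by
    simp only [hatDiff, map_add, smul_add]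
  -- Because `p₋₁ dt + v` is invariant, equivariance shows that the transform of `g` sends it to the
  -- transform of its canonical form, which is canonical as well.
  have hA : gauge (hatConj σ ω g) (p + v) = p + hatDiff σ ω (A - p) := by
    conv_lhs => rw [← hp, ← hv.2, ← hadd, gauge_hatConj (hl hg)]
    conv_rhs => rw [← hp, ← hadd, hp, add_sub_cancel]
  -- This quotient carries one canonical form to another, hence is trivial; invariance of `g` is
  -- thus automatic.
  have h1 : hatConj σ ω g * g⁻¹ = 1 := by
    refine eq_one_of_gauge_eq (mul_mem hg' hinv) (gauge_mem B hg hv.1) hc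
      (hatDiff_mem_cent hν ω hc) ?_
    rw [add_sub_cancel, gauge_mul (hl hg') (hl hinv), ← gauge_mul (hl hinv) (hl hg),
      inv_mul_cancel, gauge_one, hA]
  have h2 : hatConj σ ω g = g := mul_inv_eq_one.1 h1
  refine ⟨g, ⟨hg, fun X => ?_⟩, hc⟩
  conv_rhs => rw [← h2, hatConj_apply, LinearEquiv.symm_apply_apply]

end Main

end CycOper

end

theorem theorem4p5 {ι : Type*} [Fintype ι] {L : Type*} [LieRing L] [LieAlgebra ℂ L]
    [FiniteDimensional ℂ L] [LieAlgebra.IsSemisimple ℂ L] {H : LieSubalgebra ℂ L}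
    (B : LieAlgebra.Basis ι H) (ν : Equiv.Perm ι) (hν : ∀ i j, B.A (ν i) (ν j) = B.A i j)
    (T : ℕ) (hT : 1 ≤ T) (hνT : orderOf ν ∣ T) (ω : ℂˣ) (hω : IsPrimitiveRoot (ω : ℂ) T) :
    (∀ (g : CycOper.cycUnipM B (CycOper.cycAut B ν hν ω) ω) (D : CycOper.CycPreOper B ν hν ω),
      g • D = D → g = 1) ∧
    (∀ (g : CycOper.unipM B) (D : CycOper.PreOper B), g • D = D → g = 1) ∧
    (∀ x : CycOper.CyclotomicOper B ν hν ω, ∃! D : CycOper.CycPreOper B ν hν ω,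
      D.cls = x ∧ D.v ∈ CycOper.cycDiff (CycOper.cycAut B ν hν ω) ω (CycOper.cent B)) ∧
    (∀ x : CycOper.Oper B, ∃! D : CycOper.PreOper B,
      D.cls = x ∧ D.v ∈ CycOper.diff (CycOper.cent B)) := by
  refine ⟨fun g D h => ?_, fun g D h => ?_, fun x => ?_, fun x => ?_⟩
  · have h1 := CycOper.CycPreOper.form_smul g D
    rw [h] at h1
    exact Subtype.ext (CycOper.eq_one_of_gauge_eq_self g.2.1 D.mem.1 h1.symm)
  · have h1 := CycOper.PreOper.form_smul g D
    rw [h] at h1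
    exact Subtype.ext (CycOper.eq_one_of_gauge_eq_self g.2 D.mem h1.symm)
  · obtain ⟨D, rfl⟩ := Quotient.exists_rep x
    obtain ⟨g, hg, hc⟩ := CycOper.exists_cyc_gauge_mem_cent hν ω D.mem
    refine ⟨(⟨g, hg⟩ : CycOper.cycUnipM B (CycOper.cycAut B ν hν ω) ω) • D,
      ⟨Quotient.sound ⟨⟨g, hg⟩, rfl⟩, hc, (CycOper.cyc_gauge_mem B ν hν ω hg D.mem).2⟩, ?_⟩
    rintro D' ⟨hD', hc'⟩
    obtain ⟨k, rfl⟩ := Quotient.exact hD'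
    dsimp only at hc' ⊢
    -- Any other representative in the orbit is `u • E`, with `E` the canonical form already found;
    -- if it is canonical too, then `u = 1`.
    obtain ⟨u, rfl⟩ : ∃ u : CycOper.cycUnipM B (CycOper.cycAut B ν hν ω) ω, k = u * ⟨g, hg⟩ :=
      ⟨k * ⟨g, hg⟩⁻¹, by simp⟩
    set E := (⟨g, hg⟩ : CycOper.cycUnipM B (CycOper.cycAut B ν hν ω) ω) • D
    rw [mul_smul] at hc' ⊢
    have h1 : u = 1 := Subtype.ext (CycOper.eq_one_of_gauge_eq u.2.1 E.mem.1 hc hc'.1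
      (CycOper.CycPreOper.form_smul u E).symm)
    rw [h1, one_smul]
  · obtain ⟨D, rfl⟩ := Quotient.exists_rep x
    obtain ⟨g, hg, hc⟩ := CycOper.exists_gauge_mem_cent D.mem
    refine ⟨(⟨g, hg⟩ : CycOper.unipM B) • D, ⟨Quotient.sound ⟨⟨g, hg⟩, rfl⟩, hc⟩, ?_⟩
    rintro D' ⟨hD', hc'⟩
    obtain ⟨k, rfl⟩ := Quotient.exact hD'
    dsimp only at hc' ⊢
    obtain ⟨u, rfl⟩ : ∃ u : CycOper.unipM B, k = u * ⟨g, hg⟩ := ⟨k * ⟨g, hg⟩⁻¹, by simp⟩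
    set E := (⟨g, hg⟩ : CycOper.unipM B) • D
    rw [mul_smul] at hc' ⊢
    have h1 : u = 1 := Subtype.ext (CycOper.eq_one_of_gauge_eq u.2 E.mem hc hc'
      (CycOper.PreOper.form_smul u E).symm)
    rw [h1, one_smul]
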